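/- Let $\mathbb T^3=(\mathbb R/2\pi\mathbb Z)^3$. For a function $f(x)=\sum_{k\in\mathbb Z^3}\hat f(k)e^{ik\cdot x}$ on $\mathbb T^3$ and $\sigma\in\mathbb R$ let $\|f\|_{H^\sigma}^2=\sum_{k\in\mathbb Z^3}(1+|k|^2)^{\sigma}|\hat f(k)|^2$, and put $\|(f,g)\|_{H^\sigma\times H^{\sigma-1}}=\|f\|_{H^\sigma}+\|g\|_{H^{\sigma-1}}$. Fix $s\in(0,1/2)$ and real-valued $u_0,u_1\in C^\infty(\mathbb T^3)$. Then there exist $\delta>0$, $C>0$, a sequence $(t_n)$ of positive numbers tending to zero, and a sequence $(u_n)$ of real-valued functions $u_n\in C^\infty(\mathbb R\times\mathbb T^3)$ solving $$(\partial_t^2-\Delta)u_n+u_n^3=0\quad\text{on }\mathbb R\times\mathbb T^3,$$ such that for every $n\ge 2$ $$\|(u_n(0)-u_0,\ \partial_tu_n(0)-u_1)\|_{H^s\times H^{s-1}}\le C[\log n]^{-\delta}\xrightarrow[n\to\infty]{}0,$$ but $$\|(u_n(t_n),\ \partial_tu_n(t_n))\|_{H^s\times H^{s-1}}\ge C[\log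 n]^{\delta}\xrightarrow[n\to\infty]{}+\infty .$$ In particular, for every $T>0$, $$\lim_{n\to\infty}\|(u_n,\partial_tu_n)\|_{L^\infty([0,T];\,H^s\times H^{s-1})}=+\infty .$$ -/

import Mathlib

open MeasureTheory Filter Topology
open scoped ENNReal ContDiff Laplacian

noncomputable section

namespace CubicWave

/-- Three-dimensional Euclidean space. Functions on the torus `𝕋³ = (ℝ / 2πℤ)³` are the functions
on this space that are `2π`-periodic in each coordinate. -/
abbrev Space : Type := EuclideanSpace ℝ (Fin 3)

/-- `f` is `2π`-periodic in each of the three coordinates, i.e. a function on `𝕋³`. -/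
def IsPeriodic (f : Space → ℝ) : Prop :=
  ∀ i : Fin 3, Function.Periodic f (EuclideanSpace.single i (2 * Real.pi))

/-- `f ∈ C^∞(𝕋³)`, real valued. -/
def IsSmoothOnTorus (f : Space → ℝ) : Prop :=
  IsPeriodic f ∧ ContDiff ℝ ∞ f

/-- The fundamental cell `[0, 2π]³`. -/
def cell : Set Space := {x | ∀ i : Fin 3, x i ∈ Set.Icc 0 (2 * Real.pi)}

/-- The Fourier coefficient `f̂(k) = (2π)⁻³ ∫_{[0,2π]³} f(x) e^{-i k·x} dx`, so that
`f(x) = ∑ₖ f̂(k) e^{i k·x}` for smooth periodic `f`. -/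
def fourierCoeff (f : Space → ℝ) (k : Fin 3 → ℤ) : ℂ :=
  (1 / (2 * (Real.pi : ℂ)) ^ 3) *
    ∫ x in cell, (f x : ℂ) * Complex.exp (-(Complex.I * ((∑ i, (k i : ℝ) * x i : ℝ) : ℂ)))

/-- The Sobolev norm `‖f‖_{H^s} = (∑ₖ ⟨k⟩^{2s} |f̂(k)|²)^{1/2}`, `⟨k⟩ = (1 + |k|²)^{1/2}`,
with values in `[0, ∞]`. -/
def sobolevNorm (s : ℝ) (f : Space → ℝ) : ℝ≥0∞ :=
  (∑' k : Fin 3 → ℤ,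
    ENNReal.ofReal ((Real.sqrt (1 + ∑ i, (k i : ℝ) ^ 2)) ^ (2 * s)) *
      ‖fourierCoeff f k‖ₑ ^ 2) ^ (1 / 2 : ℝ)

/-- The norm of `(f, g)` in `H^s(𝕋³) × H^{s-1}(𝕋³)`. -/
def pairNorm (s : ℝ) (f g : Space → ℝ) : ℝ≥0∞ :=
  sobolevNorm s f + sobolevNorm (s - 1) g

/-- The time derivative `∂ₜu(t, ·)`. -/
def timeDeriv (u : ℝ → Space → ℝ) (t : ℝ) : Space → ℝ :=
  fun x => deriv (fun τ => u τ x) t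

/-- `u` is a global smooth real solution on `ℝ × 𝕋³` of `(∂ₜ² - Δ) u + u³ = 0`. -/
structure IsSmoothGlobalSolution (u : ℝ → Space → ℝ) : Prop where
  periodic : ∀ t, IsPeriodic (u t)
  smooth : ContDiff ℝ ∞ (fun p : ℝ × Space => u p.1 p.2)
  equation : ∀ t x, iteratedDeriv 2 (fun τ => u τ x) t - Δ (u t) x + (u t x) ^ 3 = 0

/-- The norm of `(u, ∂ₜu)` in `L^∞([0, T]; H^s(𝕋³) × H^{s-1}(𝕋³))`. -/
def supNorm (s T : ℝ) (u : ℝ → Space → ℝ) : ℝ≥0∞ :=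
  essSup (fun t => pairNorm s (u t) (timeDeriv u t)) (volume.restrict (Set.Icc 0 T))

end CubicWave

end

/-! Let D = (1 - Δ)^{1/2}, with symbol ⟨k⟩. A bump of height A and width 1/n, each of its roughly n³
low Fourier coefficients being of size A/n³, has H^s norm at most A n^{s-3/2}. With A = ε n^{3/2-s}
it is an ε-perturbation of u₀ in H^s, while A/n = ε n^{1/2-s} tends to infinity because s < 1/2. On
times of order 1/A, much shorter than the dispersion time 1/n, the solution started from u₀ plus the
bump therefore hardly moves, and ∂ₜ²u is close to minus the cube of the bump. That cube has
frequencies in the box of side 3n, and its coefficients sum to A³, its value at the origin.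
Integrating over a time of order 1/A, the low-frequency coefficients of ∂ₜu sum to at least a
multiple of A² in modulus, and Cauchy–Schwarz over the box gives ‖∂ₜu‖_{H^{s-1}} ≳ A² n^{s-5/2} = ε²
n^{1/2-s}, which is unbounded. The norm is thus inflated through the velocity. The lemmas are
`l1_posPart_sub_le`, `norm_sum_velPart_ge`, `sobolevNorm_bump_le` and `le_sobolevNorm_of_sum`. Since
ε is arbitrary, the logarithmic rates cost nothing.

The other half is the existence of global smooth solutions, obtained on the Fourier side. The
profile w = e^{itD}(Du + i∂ₜu) satisfies w' = i e^{itD}(u - u³), an ordinary differential equation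
in ℓ¹(ℤ³) with a locally Lipschitz field, because ℓ¹ is an algebra under convolution. Blow-up is
excluded by the energy: the interpolation ‖u‖_{ℓ¹}³ ≲ ‖u‖_{H¹}² ‖⟨k⟩u‖_{ℓ¹} (`l1_pow_three_le`)
makes the cubic term at most linear in ‖w‖_{ℓ¹}, so Grönwall applies. Rapid decay of the
coefficients propagates (`rapidOn_of_solution`); it justifies energy conservation and makes the
synthesized function smooth in space and time. -/

noncomputable section

namespace CubicWave

/-! ### The frequency lattice -/

/-- The frequency lattice `ℤ³`. -/
abbrev Freq : Type := Fin 3 → ℤ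

/-- The Japanese bracket `⟨k⟩ = (1 + |k|²)^{1/2}`. -/
def jap (k : Freq) : ℝ := Real.sqrt (1 + ∑ i, (k i : ℝ) ^ 2)

lemma jap_sq (k : Freq) : jap k ^ 2 = 1 + ∑ i, (k i : ℝ) ^ 2 :=
  Real.sq_sqrt (by positivity)

lemma one_le_jap (k : Freq) : 1 ≤ jap k := by
  rw [jap, Real.one_le_sqrt]
  have : 0 ≤ ∑ i, (k i : ℝ) ^ 2 := by positivity
  linarith

lemma jap_pos (k : Freq) : 0 < jap k := zero_lt_one.trans_le (one_le_jap k)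

@[simp] lemma jap_neg (k : Freq) : jap (-k) = jap k := by simp [jap]

lemma sq_le_jap_sq (k : Freq) (i : Fin 3) : 1 + (k i : ℝ) ^ 2 ≤ jap k ^ 2 := by
  rw [jap_sq]
  gcongr
  exact Finset.single_le_sum (f := fun i => (k i : ℝ) ^ 2) (fun _ _ => by positivity)
    (Finset.mem_univ i)

lemma abs_le_jap (k : Freq) (i : Fin 3) : |(k i : ℝ)| ≤ jap k :=
  abs_le_of_sq_le_sq (by linarith [sq_le_jap_sq k i]) (jap_pos k).le

lemma sum_sq_le_jap_sq (k : Freq) : ∑ i, (k i : ℝ) ^ 2 ≤ jap k ^ 2 := by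
  rw [jap_sq]; linarith

/-- ⟨k⟩ is the Euclidean norm of (1, k) in ℝ⁴, so this is the triangle inequality for (1, j) + (0,
l). -/
lemma jap_add_le (j l : Freq) : jap (j + l) ≤ jap j + jap l := by
  have h1 : jap (j + l) =
      ‖(!₂[(1 : ℝ), j 0 + l 0, j 1 + l 1, j 2 + l 2] : EuclideanSpace ℝ _)‖ := by
    simp [EuclideanSpace.norm_eq, jap, Fin.sum_univ_succ]
  have h2 : ‖(!₂[(1 : ℝ), j 0, j 1, j 2] : EuclideanSpace ℝ _)‖ = jap j := by
    simp [EuclideanSpace.norm_eq, jap, Fin.sum_univ_succ]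
  have h3 : ‖(!₂[(0 : ℝ), l 0, l 1, l 2] : EuclideanSpace ℝ _)‖ ≤ jap l := by
    simp only [EuclideanSpace.norm_eq, jap]
    apply Real.sqrt_le_sqrt
    simp [Fin.sum_univ_succ]
  have h4 : (!₂[(1 : ℝ), j 0 + l 0, j 1 + l 1, j 2 + l 2] : EuclideanSpace ℝ _) =
      !₂[(1 : ℝ), j 0, j 1, j 2] + !₂[(0 : ℝ), l 0, l 1, l 2] := by
    ext i; fin_cases i <;> simp
  rw [h1, h4, ← h2]
  exact (norm_add_le _ _).trans (by gcongr)

/-- Reduction of lattice sums to one dimension: a nonnegative product majorant, summed over the cube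
T³, factorises. -/
lemma sum_le_of_le_prod {f : ℤ → ℝ} (hf : ∀ j, 0 ≤ f j) {g : Freq → ℝ}
    (hg : ∀ k, g k ≤ ∏ i, f (k i)) (T : Finset ℤ) (s : Finset Freq)
    (hs : ∀ k ∈ s, ∀ i, k i ∈ T) : ∑ k ∈ s, g k ≤ (∑ j ∈ T, f j) ^ 3 := by
  calc ∑ k ∈ s, g k ≤ ∑ k ∈ s, ∏ i, f (k i) := Finset.sum_le_sum fun k _ => hg k
    _ ≤ ∑ k ∈ Fintype.piFinset fun _ : Fin 3 => T, ∏ i, f (k i) := by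
        apply Finset.sum_le_sum_of_subset_of_nonneg
        · intro k hk
          simpa using hs k hk
        · intro k _ _
          exact Finset.prod_nonneg fun i _ => hf _
    _ = (∑ j ∈ T, f j) ^ 3 := by
        rw [Finset.sum_prod_piFinset T fun _ j => f j]
        simp

/-- The power six is what the product reduction needs: ⟨k⟩⁶ dominates the product of the three
factors 1 + kᵢ². -/
lemma summable_inv_jap_pow_six : Summable fun k : Freq => (jap k ^ 6)⁻¹ := by
  have h0 : Summable fun j : ℤ => (1 + (j : ℝ) ^ 2)⁻¹ := by
    refine Summable.of_norm_bounded_eventually (g := fun j : ℤ => 1 / (j : ℝ) ^ 2)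
      (Real.summable_one_div_int_pow.mpr one_lt_two) ?_
    rw [Filter.eventually_cofinite]
    -- The majorant 1 / j² takes the value 0 at j = 0, so the comparison must omit that single
    -- point.
    refine (Set.finite_singleton (0 : ℤ)).subset fun j hj => ?_
    by_contra h
    apply hj
    have hj0 : (j : ℝ) ≠ 0 := by exact_mod_cast h
    rw [Real.norm_of_nonneg (by positivity), one_div]
    gcongr
    linarith
  refine summable_of_sum_le (c := (∑' j : ℤ, (1 + (j : ℝ) ^ 2)⁻¹) ^ 3)
    (fun k => by have := jap_pos k; positivity) fun s => ?_
  classical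
  refine (sum_le_of_le_prod (f := fun j => (1 + (j : ℝ) ^ 2)⁻¹) (fun j => by positivity) ?_
    (s.biUnion fun k => Finset.univ.image k) s ?_).trans ?_
  · intro k
    rw [Finset.prod_inv_distrib, Fin.prod_univ_three,
      show jap k ^ 6 = jap k ^ 2 * jap k ^ 2 * jap k ^ 2 by ring]
    gcongr <;> exact sq_le_jap_sq k _
  · intro k hk i
    simp only [Finset.mem_biUnion, Finset.mem_image, Finset.mem_univ, true_and]
    exact ⟨k, hk, i, rfl⟩
  · gcongr
    exact h0.sum_le_tsum _ fun j _ => by positivity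

/-- Each term is at most |j|^{-2/3}, which is bounded by three times the increment of the cube root
and hence telescopes; the pair ±j accounts for the factor 6. -/
lemma sum_Icc_rpow_le (N : ℕ) : ∑ j ∈ Finset.Icc (-(N : ℤ)) N,
    ((1 + (j : ℝ) ^ 2) ^ (1 / 3 : ℝ))⁻¹ ≤ 1 + 6 * (N : ℝ) ^ (1 / 3 : ℝ) := by
  induction N with
  | zero => simp
  | succ N ih =>
    have h : Finset.Icc (-((N + 1 : ℕ) : ℤ)) (N + 1 : ℕ) =
        insert (-((N : ℤ) + 1)) (insert ((N : ℤ) + 1) (Finset.Icc (-(N : ℤ)) N)) := by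
      ext j; simp only [Finset.mem_Icc, Finset.mem_insert]; push_cast; omega
    rw [h, Finset.sum_insert (by simp; omega), Finset.sum_insert (by simp)]
    set a : ℝ := ((N : ℝ) + 1) ^ (1 / 3 : ℝ) with ha
    set b : ℝ := (N : ℝ) ^ (1 / 3 : ℝ) with hb
    have ha3 : a ^ 3 = N + 1 := by
      rw [ha, ← Real.rpow_natCast, ← Real.rpow_mul (by positivity)]; norm_num
    have hb3 : b ^ 3 = N := by
      rw [hb, ← Real.rpow_natCast, ← Real.rpow_mul (by positivity)]; norm_num
    have ha0 : 0 < a := by positivity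
    have hb0 : 0 ≤ b := by positivity
    have hab : b ≤ a := by rw [ha, hb]; gcongr; linarith
    have h1 : ((1 + ((N : ℝ) + 1) ^ 2) ^ (1 / 3 : ℝ))⁻¹ ≤ (a ^ 2)⁻¹ := by
      gcongr
      rw [ha, ← Real.rpow_natCast, ← Real.rpow_mul (by positivity), mul_comm,
        Real.rpow_mul (by positivity)]
      gcongr
      norm_num
    have h2 : (a ^ 2)⁻¹ ≤ 3 * (a - b) := by
      rw [inv_le_iff_one_le_mul₀ (by positivity)]
      nlinarith [mul_nonneg (sub_nonneg.2 hab)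
        (mul_nonneg (sub_nonneg.2 hab) (by linarith : 0 ≤ 2 * a + b))]
    push_cast
    rw [neg_sq]
    linarith

/-- Distributing ⟨k⟩^{-2} evenly over the coordinates bounds it by the product of (1 + kᵢ²)^{-1/3}.
Each one-dimensional sum is at most 7R^{1/3}, and 343 = 7³. -/
lemma sum_inv_jap_sq_le {R : ℝ} (hR : 1 ≤ R) (s : Finset Freq) (hs : ∀ k ∈ s, jap k ≤ R) :
    ∑ k ∈ s, (jap k ^ 2)⁻¹ ≤ 343 * R := by
  refine (sum_le_of_le_prod (f := fun j => ((1 + (j : ℝ) ^ 2) ^ (1 / 3 : ℝ))⁻¹)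
    (fun j => by positivity) ?_ (Finset.Icc (-(⌊R⌋₊ : ℤ)) ⌊R⌋₊) s ?_).trans ?_
  · intro k
    rw [Finset.prod_inv_distrib]
    have h : ∀ i, (1 + (k i : ℝ) ^ 2) ^ (1 / 3 : ℝ) ≤ (jap k ^ 2) ^ (1 / 3 : ℝ) := fun i => by
      gcongr; exact sq_le_jap_sq k i
    gcongr
    calc ∏ i, (1 + (k i : ℝ) ^ 2) ^ (1 / 3 : ℝ) ≤ ∏ i : Fin 3, (jap k ^ 2) ^ (1 / 3 : ℝ) :=
          Finset.prod_le_prod (fun i _ => by positivity) fun i _ => h i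
      _ = jap k ^ 2 := by
          rw [Finset.prod_const, ← Real.rpow_natCast, ← Real.rpow_mul (by positivity)]; simp
  · intro k hk i
    have h1 : |(k i : ℝ)| ≤ R := (abs_le_jap k i).trans (hs k hk)
    have h2 : ((k i).natAbs : ℝ) ≤ R := by rwa [Nat.cast_natAbs, Int.cast_abs]
    have h3 := Nat.le_floor h2
    rw [Finset.mem_Icc]
    omega
  · have h1 : (⌊R⌋₊ : ℝ) ^ (1 / 3 : ℝ) ≤ R ^ (1 / 3 : ℝ) := by
      gcongr; exact Nat.floor_le (by linarith)
    have h2 : 1 ≤ R ^ (1 / 3 : ℝ) := Real.one_le_rpow hR (by norm_num)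
    calc _ ≤ (7 * R ^ (1 / 3 : ℝ)) ^ 3 := by
          gcongr
          exact (sum_Icc_rpow_le _).trans (by linarith)
      _ = 343 * R := by
          rw [mul_pow, ← Real.rpow_natCast, ← Real.rpow_natCast, ← Real.rpow_mul (by positivity)]
          norm_num

/-! ### Absolutely summable coefficient families and their convolution -/

/-- Absolute summability of a family of Fourier coefficients. -/
def AbsSummable (a : Freq → ℂ) : Prop := Summable fun k => ‖a k‖

/-- The `ℓ¹` norm of a family of Fourier coefficients. -/
def l1 (a : Freq → ℂ) : ℝ := ∑' k, ‖a k‖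

lemma l1_nonneg (a : Freq → ℂ) : 0 ≤ l1 a := tsum_nonneg fun _ => norm_nonneg _

lemma AbsSummable.add {a b : Freq → ℂ} (ha : AbsSummable a) (hb : AbsSummable b) :
    AbsSummable (a + b) :=
  Summable.of_nonneg_of_le (fun _ => norm_nonneg _) (fun _ => norm_add_le _ _) (Summable.add ha hb)

lemma AbsSummable.sub {a b : Freq → ℂ} (ha : AbsSummable a) (hb : AbsSummable b) :
    AbsSummable (a - b) :=
  Summable.of_nonneg_of_le (fun _ => norm_nonneg _) (fun _ => norm_sub_le _ _) (Summable.add ha hb)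

lemma AbsSummable.of_le {a b : Freq → ℂ} (hb : AbsSummable b) (h : ∀ k, ‖a k‖ ≤ ‖b k‖) :
    AbsSummable a :=
  Summable.of_nonneg_of_le (fun _ => norm_nonneg _) h hb

lemma l1_add_le {a b : Freq → ℂ} (ha : AbsSummable a) (hb : AbsSummable b) :
    l1 (a + b) ≤ l1 a + l1 b := by
  rw [l1, l1, l1, ← Summable.tsum_add ha hb]
  exact (ha.add hb).tsum_le_tsum (fun _ => norm_add_le _ _) (Summable.add ha hb)

lemma l1_sub_le {a b : Freq → ℂ} (ha : AbsSummable a) (hb : AbsSummable b) :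
    l1 (a - b) ≤ l1 a + l1 b := by
  rw [l1, l1, l1, ← Summable.tsum_add ha hb]
  exact (ha.sub hb).tsum_le_tsum (fun _ => norm_sub_le _ _) (Summable.add ha hb)

lemma l1_le_of_le {a b : Freq → ℂ} (hb : AbsSummable b) (h : ∀ k, ‖a k‖ ≤ ‖b k‖) : l1 a ≤ l1 b :=
  (hb.of_le h).tsum_le_tsum h hb

lemma AbsSummable.norm_le_l1 {a : Freq → ℂ} (ha : AbsSummable a) (k : Freq) : ‖a k‖ ≤ l1 a :=
  Summable.le_tsum ha k fun _ _ => norm_nonneg _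

lemma AbsSummable.sum_le_l1 {a : Freq → ℂ} (ha : AbsSummable a) (s : Finset Freq) :
    ∑ k ∈ s, ‖a k‖ ≤ l1 a :=
  Summable.sum_le_tsum s (fun _ _ => norm_nonneg _) ha

/-- Convolution of families of Fourier coefficients. -/
def conv (a b : Freq → ℂ) : Freq → ℂ := fun k => ∑' j, a j * b (k - j)

/-- The shear `(k, j) ↦ (j, k - j)` of `ℤ³ × ℤ³`. -/
def shear : Freq × Freq ≃ Freq × Freq where
  toFun p := (p.2, p.1 - p.2)
  invFun q := (q.1 + q.2, q.1)
  left_inv p := by simp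
  right_inv q := by simp

variable {a b c u v : Freq → ℂ}

/-- A shear turns the convolution kernel into a product family. This joint summability gives the
existence of the convolution, Young's inequality and the Fubini exchange in `tsum_conv`. -/
lemma AbsSummable.conv_prod (ha : AbsSummable a) (hb : AbsSummable b) :
    Summable fun p : Freq × Freq => ‖a p.2 * b (p.1 - p.2)‖ := by
  have h : Summable fun q : Freq × Freq => ‖a q.1‖ * ‖b q.2‖ :=
    Summable.mul_of_nonneg ha hb (fun _ => norm_nonneg _) (fun _ => norm_nonneg _)
  have h' := shear.summable_iff.mpr h
  refine h'.congr fun p => ?_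
  simp [shear]

lemma AbsSummable.conv_fiber (ha : AbsSummable a) (hb : AbsSummable b) (k : Freq) :
    Summable fun j => a j * b (k - j) :=
  ((ha.conv_prod hb).prod_factor k).of_norm

lemma AbsSummable.conv_fiber_norm (ha : AbsSummable a) (hb : AbsSummable b) (k : Freq) :
    Summable fun j => ‖a j‖ * ‖b (k - j)‖ := by
  simpa using (ha.conv_prod hb).prod_factor k

lemma norm_conv_le (ha : AbsSummable a) (hb : AbsSummable b) (k : Freq) :
    ‖conv a b k‖ ≤ ∑' j, ‖a j‖ * ‖b (k - j)‖ := by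
  refine (norm_tsum_le_tsum_norm ((ha.conv_prod hb).prod_factor k)).trans_eq ?_
  simp

lemma AbsSummable.conv (ha : AbsSummable a) (hb : AbsSummable b) : AbsSummable (conv a b) :=
  Summable.of_nonneg_of_le (fun _ => norm_nonneg _)
    (fun k => norm_tsum_le_tsum_norm ((ha.conv_prod hb).prod_factor k)) (ha.conv_prod hb).prod

lemma l1_conv_le (ha : AbsSummable a) (hb : AbsSummable b) : l1 (conv a b) ≤ l1 a * l1 b := by
  have h : Summable fun q : Freq × Freq => ‖a q.1‖ * ‖b q.2‖ :=
    Summable.mul_of_nonneg ha hb (fun _ => norm_nonneg _) (fun _ => norm_nonneg _)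
  calc l1 (CubicWave.conv a b) ≤ ∑' k, ∑' j, ‖a j * b (k - j)‖ :=
        Summable.tsum_le_tsum (fun k => norm_tsum_le_tsum_norm ((ha.conv_prod hb).prod_factor k))
          (ha.conv hb) (ha.conv_prod hb).prod
    _ = ∑' p : Freq × Freq, ‖a p.2 * b (p.1 - p.2)‖ := ((ha.conv_prod hb).tsum_prod).symm
    _ = ∑' q : Freq × Freq, ‖a q.1‖ * ‖b q.2‖ := by
        rw [← shear.tsum_eq fun q : Freq × Freq => ‖a q.1‖ * ‖b q.2‖]
        simp [shear]
    _ = l1 a * l1 b := (Summable.tsum_mul_tsum ha hb h).symm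

lemma tsum_conv (ha : AbsSummable a) (hb : AbsSummable b) :
    ∑' k, conv a b k = (∑' k, a k) * ∑' k, b k := by
  rw [tsum_mul_tsum_of_summable_norm ha hb, ← shear.tsum_eq]
  exact ((ha.conv_prod hb).of_norm.tsum_prod).symm

lemma conv_comm (a b : Freq → ℂ) : conv a b = conv b a := by
  ext k
  rw [conv, ← (Equiv.subLeft k).tsum_eq]
  simp [conv, mul_comm]

lemma conv_sub (ha : AbsSummable a) (hb : AbsSummable b) (hc : AbsSummable c) :
    conv a (b - c) = conv a b - conv a c := by
  ext k
  simp only [conv, Pi.sub_apply, mul_sub]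
  exact (ha.conv_fiber hb k).tsum_sub (ha.conv_fiber hc k)

lemma sub_conv (ha : AbsSummable a) (hb : AbsSummable b) (hc : AbsSummable c) :
    conv (a - b) c = conv a c - conv b c := by
  rw [conv_comm, conv_sub hc ha hb, conv_comm c a, conv_comm c b]

/-- The coefficients of `u³`. -/
def cube (u : Freq → ℂ) : Freq → ℂ := conv u (conv u u)

lemma AbsSummable.cube (hu : AbsSummable u) : AbsSummable (cube u) := hu.conv (hu.conv hu)

lemma l1_cube_le (hu : AbsSummable u) : l1 (cube u) ≤ l1 u ^ 3 :=
  (l1_conv_le hu (hu.conv hu)).trans <| by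
    rw [pow_succ', sq]
    exact mul_le_mul_of_nonneg_left (l1_conv_le hu hu) (l1_nonneg _)

lemma cube_sub_cube (hu : AbsSummable u) (hv : AbsSummable v) :
    cube u - cube v = conv (u - v) (conv u u) + (conv v (conv (u - v) u) +
      conv v (conv v (u - v))) := by
  rw [sub_conv hu hv (hu.conv hu), sub_conv hu hv hu, conv_sub hv hu hv,
    conv_sub hv (hu.conv hu) (hv.conv hu), conv_sub hv (hv.conv hu) (hv.conv hv), cube, cube]
  abel

lemma l1_cube_sub_cube_le (hu : AbsSummable u) (hv : AbsSummable v) {M : ℝ}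
    (huM : l1 u ≤ M) (hvM : l1 v ≤ M) : l1 (cube u - cube v) ≤ 3 * M ^ 2 * l1 (u - v) := by
  have hd := hu.sub hv
  have hM : 0 ≤ M := (l1_nonneg u).trans huM
  have h0 := l1_nonneg (u - v)
  have h1 : l1 (conv (u - v) (conv u u)) ≤ l1 (u - v) * (M * M) :=
    (l1_conv_le hd (hu.conv hu)).trans <| by
      have := l1_nonneg u
      gcongr
      exact (l1_conv_le hu hu).trans (by gcongr)
  have h2 : l1 (conv v (conv (u - v) u)) ≤ M * (l1 (u - v) * M) :=
    (l1_conv_le hv (hd.conv hu)).trans <| by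
      have := l1_nonneg (conv (u - v) u)
      gcongr
      exact (l1_conv_le hd hu).trans (by gcongr)
  have h3 : l1 (conv v (conv v (u - v))) ≤ M * (M * l1 (u - v)) :=
    (l1_conv_le hv (hv.conv hd)).trans <| by
      have := l1_nonneg (conv v (u - v))
      gcongr
      exact (l1_conv_le hv hd).trans (by gcongr)
  rw [cube_sub_cube hu hv]
  refine (l1_add_le (hd.conv (hu.conv hu))
    ((hv.conv (hd.conv hu)).add (hv.conv (hv.conv hd)))).trans ?_
  have := l1_add_le (hv.conv (hd.conv hu)) (hv.conv (hv.conv hd))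
  linarith

/-- Coefficients of a real-valued function. -/
def IsHermitian (a : Freq → ℂ) : Prop := ∀ k, a (-k) = starRingEnd ℂ (a k)

lemma IsHermitian.conv (ha : IsHermitian a) (hb : IsHermitian b) : IsHermitian (conv a b) := by
  intro k
  rw [CubicWave.conv, ← (Equiv.neg Freq).tsum_eq, CubicWave.conv, Complex.conj_tsum]
  refine tsum_congr fun j => ?_
  rw [map_mul, ← ha, ← hb, Equiv.neg_apply]
  congr 2
  abel

lemma IsHermitian.cube (ha : IsHermitian a) : IsHermitian (cube a) := ha.conv (ha.conv ha)

lemma IsHermitian.add (ha : IsHermitian a) (hb : IsHermitian b) : IsHermitian (a + b) := fun k => by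
  simp [ha k, hb k]

lemma IsHermitian.sub (ha : IsHermitian a) (hb : IsHermitian b) : IsHermitian (a - b) := fun k => by
  simp [ha k, hb k]

/-- Pointwise decay is preserved by convolution. -/
lemma norm_conv_mul_jap_pow_le (ha : AbsSummable a) (hb : AbsSummable b) {m : ℕ} {A B : ℝ}
    (hA : ∀ k, ‖a k‖ * jap k ^ m ≤ A) (hB : ∀ k, ‖b k‖ * jap k ^ m ≤ B) (k : Freq) :
    ‖conv a b k‖ * jap k ^ m ≤ 2 ^ m * (A * l1 b + l1 a * B) := by
  have hb' : Summable fun j => ‖b (k - j)‖ := (Equiv.subLeft k).summable_iff.mpr hb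
  have hb'' : ∑' j, ‖b (k - j)‖ = l1 b := (Equiv.subLeft k).tsum_eq fun j => ‖b j‖
  have hle : ∀ j, ‖a j‖ * ‖b (k - j)‖ * jap k ^ m ≤ 2 ^ m * (A * ‖b (k - j)‖ + ‖a j‖ * B) := by
    intro j
    have h1 : jap k ^ m ≤ 2 ^ m * (jap j ^ m + jap (k - j) ^ m) := by
      have h := jap_add_le j (k - j)
      rw [add_sub_cancel] at h
      have hj := (jap_pos j).le
      have hkj := (jap_pos (k - j)).le
      calc jap k ^ m ≤ (2 * max (jap j) (jap (k - j))) ^ m := by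
            apply pow_le_pow_left₀ (jap_pos k).le
            linarith [le_max_left (jap j) (jap (k - j)), le_max_right (jap j) (jap (k - j))]
        _ ≤ 2 ^ m * (jap j ^ m + jap (k - j) ^ m) := by
            rw [mul_pow]
            gcongr
            rcases max_cases (jap j) (jap (k - j)) with h | h <;> rw [h.1] <;> simp <;> positivity
    calc ‖a j‖ * ‖b (k - j)‖ * jap k ^ m
        ≤ ‖a j‖ * ‖b (k - j)‖ * (2 ^ m * (jap j ^ m + jap (k - j) ^ m)) := by gcongr
      _ = 2 ^ m * ((‖a j‖ * jap j ^ m) * ‖b (k - j)‖ + ‖a j‖ * (‖b (k - j)‖ * jap (k - j) ^ m)) := by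
          ring
      _ ≤ _ := by
          gcongr
          · exact hA j
          · exact hB _
  calc ‖conv a b k‖ * jap k ^ m ≤ (∑' j, ‖a j‖ * ‖b (k - j)‖) * jap k ^ m := by
        have := jap_pos k
        gcongr
        exact norm_conv_le ha hb k
    _ = ∑' j, ‖a j‖ * ‖b (k - j)‖ * jap k ^ m := tsum_mul_right.symm
    _ ≤ ∑' j, 2 ^ m * (A * ‖b (k - j)‖ + ‖a j‖ * B) :=
        ((ha.conv_fiber_norm hb k).mul_right _).tsum_le_tsum hle
          (((hb'.mul_left A).add (Summable.mul_right B ha)).mul_left _)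
    _ = 2 ^ m * (A * l1 b + l1 a * B) := by
        rw [tsum_mul_left, Summable.tsum_add (hb'.mul_left A) (Summable.mul_right B ha),
          tsum_mul_left, tsum_mul_right, hb'', l1, l1]

/-- `‖u‖_{ℓ¹}³ ≲ ‖u‖_{H¹}² ‖⟨k⟩ u‖_{ℓ¹}`. -/
lemma l1_pow_three_le (hu : AbsSummable fun k => jap k * u k) {H : ℝ}
    (hH : ∀ s : Finset Freq, ∑ k ∈ s, jap k ^ 2 * ‖u k‖ ^ 2 ≤ H) :
    l1 u ^ 3 ≤ 8000 * H * l1 fun k => jap k * u k := by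
  set W := l1 fun k => jap k * u k with hW
  have hnorm : ∀ k, ‖(jap k : ℂ) * u k‖ = jap k * ‖u k‖ := fun k => by
    rw [norm_mul, Complex.norm_real, Real.norm_of_nonneg (jap_pos k).le]
  have hH0 : 0 ≤ H := by simpa using hH ∅
  have hu1 : AbsSummable u := hu.of_le fun k => by
    rw [hnorm]; exact le_mul_of_one_le_left (norm_nonneg _) (one_le_jap k)
  -- Splitting at ⟨k⟩ = R: Cauchy–Schwarz with Σ ⟨k⟩^{-2} ≤ 343R for low frequencies, one factor
  -- ⟨k⟩/R > 1 for high ones.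
  have hsplit : ∀ R : ℝ, 1 ≤ R → l1 u ≤ Real.sqrt (343 * R * H) + W / R := by
    intro R hR
    refine Summable.tsum_le_of_sum_le hu1 fun s => ?_
    rw [← Finset.sum_filter_add_sum_filter_not s fun k => jap k ≤ R]
    gcongr
    · apply Real.le_sqrt_of_sq_le
      calc (∑ k ∈ s with jap k ≤ R, ‖u k‖) ^ 2
          = (∑ k ∈ s with jap k ≤ R, (jap k)⁻¹ * (jap k * ‖u k‖)) ^ 2 := by
            congr 1
            refine Finset.sum_congr rfl fun k _ => ?_
            rw [inv_mul_cancel_left₀ (jap_pos k).ne']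
        _ ≤ (∑ k ∈ s with jap k ≤ R, (jap k)⁻¹ ^ 2) * ∑ k ∈ s with jap k ≤ R, (jap k * ‖u k‖) ^ 2 :=
            Finset.sum_mul_sq_le_sq_mul_sq _ _ _
        _ ≤ 343 * R * H := by
            gcongr
            · simp_rw [inv_pow]
              exact sum_inv_jap_sq_le hR _ fun k hk => (Finset.mem_filter.1 hk).2
            · simp_rw [mul_pow]
              exact hH _
    · rw [le_div_iff₀ (by linarith), Finset.sum_mul]
      refine le_trans ?_ (hu.sum_le_l1 (s.filter fun k => ¬ jap k ≤ R))
      refine Finset.sum_le_sum fun k hk => ?_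
      rw [hnorm, mul_comm]
      gcongr
      exact (not_le.1 (Finset.mem_filter.1 hk).2).le
  have hW0 : 0 ≤ W := l1_nonneg _
  have huW : l1 u ≤ W := l1_le_of_le hu fun k => by
    rw [hnorm]; exact le_mul_of_one_le_left (norm_nonneg _) (one_le_jap k)
  -- The optimal R below is at least 1 only if W² ≥ H; in the other case the trivial bound by W
  -- suffices.
  rcases le_or_gt (W ^ 2) H with hWH | hWH
  · calc l1 u ^ 3 ≤ W ^ 3 := pow_le_pow_left₀ (l1_nonneg u) huW 3
      _ = W ^ 2 * W := by ring
      _ ≤ H * W := by gcongr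
      _ ≤ 8000 * H * W := by nlinarith [mul_nonneg hH0 hW0]
  rcases hH0.eq_or_lt with h0 | hHpos
  · have hz : u = 0 := by
      ext k
      have h1 : jap k ^ 2 * ‖u k‖ ^ 2 ≤ 0 := by simpa [← h0] using hH {k}
      have h2 : ‖u k‖ ^ 2 ≤ 0 := by
        have := jap_pos k
        by_contra hc
        push Not at hc
        exact absurd h1 (not_le.2 (by positivity))
      simpa using h2
    rw [← h0, hz]
    simp [l1]
  set h := Real.sqrt H with hh
  have hhH : h ^ 2 = H := Real.sq_sqrt hH0
  have hhpos : 0 < h := Real.sqrt_pos.2 hHpos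
  have hhW : h < W := by
    rw [hh, Real.sqrt_lt' (lt_of_le_of_ne hW0 ?_)]
    · exact hWH
    · rintro h'
      rw [← h'] at hWH
      simp at hWH
      linarith
  -- The choice R = x² = (W/√H)^{2/3} makes √(RH) and W/R both equal to x√H. Then √343 ≤ 19, 19 + 1
  -- = 20 and 20³ = 8000.
  set x : ℝ := (W / h) ^ (1 / 3 : ℝ) with hx
  have hx1 : 1 ≤ x := Real.one_le_rpow ((one_le_div hhpos).2 hhW.le) (by norm_num)
  have hx3 : x ^ 3 * h = W := by
    rw [hx, ← Real.rpow_natCast, ← Real.rpow_mul (by positivity)]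
    norm_num
    field_simp
  have hmain : l1 u ≤ 20 * (x * h) := by
    refine (hsplit (x ^ 2) (one_le_pow₀ hx1)).trans ?_
    have h1 : Real.sqrt (343 * x ^ 2 * H) ≤ 19 * (x * h) := by
      rw [Real.sqrt_le_left (by positivity), ← hhH]
      nlinarith [mul_pos (pow_pos (zero_lt_one.trans_le hx1) 2) (pow_pos hhpos 2)]
    have h2 : W / x ^ 2 = x * h := by
      rw [← hx3]; field_simp
    linarith
  calc l1 u ^ 3 ≤ (20 * (x * h)) ^ 3 := pow_le_pow_left₀ (l1_nonneg u) hmain 3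
    _ = 8000 * h ^ 2 * (x ^ 3 * h) := by ring
    _ = 8000 * H * W := by rw [hhH, hx3]

/-! ### Global solutions of ordinary differential equations with an a priori bound -/

/-- The continuity method on `[0, T]`. -/
lemma le_of_continuity_method {y : ℝ → ℝ} {T a b : ℝ} (hab : a < b)
    (hy : ContinuousOn y (Set.Icc 0 T))
    (h : ∀ r ∈ Set.Icc 0 T, (∀ s ∈ Set.Ico 0 r, y s ≤ b) → y r ≤ a) :
    ∀ r ∈ Set.Icc 0 T, y r ≤ a := by
  have hcl : IsCompact (Set.Icc 0 T ∩ y ⁻¹' Set.Ici b) :=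
    isCompact_Icc.of_isClosed_subset (hy.preimage_isClosed_of_isClosed isClosed_Icc isClosed_Ici)
      Set.inter_subset_left
  -- If y reached b, then before the first such time y stays below b, so the hypothesis gives y ≤ a
  -- < b at that time, a contradiction.
  have hempty : ∀ r ∈ Set.Icc 0 T, y r ≤ b := by
    by_contra! hne
    obtain ⟨r, hr, hrb⟩ := hne
    obtain ⟨ρ, ⟨hρ, hρb⟩, hmin⟩ := hcl.exists_isLeast ⟨r, hr, hrb.le⟩
    have := h ρ hρ fun s hs => by
      by_contra! hsb
      exact absurd (hmin ⟨⟨hs.1, hs.2.le.trans hρ.2⟩, hsb.le⟩) (not_le.2 hs.2)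
    exact absurd (hab.trans_le hρb) (not_lt.2 this)
  exact fun r hr => h r hr fun s hs => hempty s ⟨hs.1, hs.2.le.trans hr.2⟩

variable {E : Type*} [NormedAddCommGroup E]

/-- A scalar cutoff equal to `1` on the ball of radius `R` and to `0` off the ball of radius
`R + 1`. -/
def cutoff (R : ℝ) (x : E) : ℝ := max 0 (min 1 (R + 1 - ‖x‖))

lemma cutoff_nonneg (R : ℝ) (x : E) : 0 ≤ cutoff R x := le_max_left _ _

lemma cutoff_le_one (R : ℝ) (x : E) : cutoff R x ≤ 1 :=
  max_le zero_le_one (min_le_left _ _)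

lemma cutoff_eq_one {R : ℝ} {x : E} (h : ‖x‖ ≤ R) : cutoff R x = 1 := by
  rw [cutoff, min_eq_left (by linarith), max_eq_right zero_le_one]

lemma cutoff_eq_zero {R : ℝ} {x : E} (h : R + 1 ≤ ‖x‖) : cutoff R x = 0 :=
  max_eq_left ((min_le_right _ _).trans (by linarith))

lemma abs_cutoff_sub_le (R : ℝ) (x y : E) : |cutoff R x - cutoff R y| ≤ ‖x - y‖ := by
  have h : |‖x‖ - ‖y‖| ≤ ‖x - y‖ := abs_norm_sub_norm_le x y
  rw [abs_le] at h ⊢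
  simp only [cutoff]
  grind

variable [NormedSpace ℝ E]

/-- Truncation makes the field globally Lipschitz, so Picard–Lindelöf can be used on intervals of
any length. When one of the points lies outside the ball, the cutoff vanishes there and its own
Lipschitz bound controls the difference. -/
lemma lipschitzWith_cutoff_smul {G : E → E} {R : ℝ} {K L : NNReal}
    (hK : LipschitzOnWith K G (Metric.closedBall 0 (R + 1)))
    (hL : ∀ x ∈ Metric.closedBall (0 : E) (R + 1), ‖G x‖ ≤ L) :
    LipschitzWith (K + L) fun x => cutoff R x • G x := by
  refine LipschitzWith.of_dist_le_mul fun x y => ?_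
  simp only [dist_eq_norm]
  have key : ∀ x y : E, ‖x‖ ≤ R + 1 → R + 1 ≤ ‖y‖ →
      ‖cutoff R x • G x - cutoff R y • G y‖ ≤ (K + L : NNReal) * ‖x - y‖ := by
    intro x y hx hy
    have h := abs_cutoff_sub_le R x y
    rw [cutoff_eq_zero hy, sub_zero] at h
    rw [cutoff_eq_zero hy, zero_smul, sub_zero, norm_smul, Real.norm_eq_abs]
    have hG := hL x (by simpa using hx)
    have := K.2
    calc |cutoff R x| * ‖G x‖ ≤ ‖x - y‖ * L := by gcongr
      _ ≤ (K + L : NNReal) * ‖x - y‖ := by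
        push_cast
        nlinarith [norm_nonneg (x - y), K.coe_nonneg, mul_nonneg K.coe_nonneg (norm_nonneg (x - y))]
  rcases le_total ‖x‖ (R + 1) with hx | hx <;> rcases le_total ‖y‖ (R + 1) with hy | hy
  · have h1 : cutoff R x • G x - cutoff R y • G y =
        cutoff R x • (G x - G y) + (cutoff R x - cutoff R y) • G y := by
      rw [smul_sub, sub_smul]; abel
    have hd := hK.dist_le_mul x (by simpa using hx) y (by simpa using hy)
    rw [dist_eq_norm, dist_eq_norm] at hd
    have hG := hL y (by simpa using hy)
    rw [h1]
    refine (norm_add_le _ _).trans ?_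
    rw [norm_smul, norm_smul, Real.norm_eq_abs, Real.norm_eq_abs, abs_of_nonneg (cutoff_nonneg R x)]
    calc cutoff R x * ‖G x - G y‖ + |cutoff R x - cutoff R y| * ‖G y‖
        ≤ 1 * (K * ‖x - y‖) + ‖x - y‖ * L := by
          gcongr
          · exact cutoff_le_one R x
          · exact abs_cutoff_sub_le R x y
      _ = (K + L : NNReal) * ‖x - y‖ := by push_cast; ring
  · exact key x y hx hy
  · rw [norm_sub_rev, norm_sub_rev x]
    exact key y x hy hx
  · rw [cutoff_eq_zero hx, cutoff_eq_zero hy]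
    simp only [zero_smul, sub_zero, norm_zero]
    positivity

variable [CompleteSpace E]

/-- A solution on `(-T, T)` exists provided that solutions on smaller intervals are bounded. -/
lemma exists_solution_Ioo {G : ℝ → E → E} {x₀ : E} (hcont : ∀ x, Continuous (G · x))
    (hlip : ∀ R : ℝ, ∃ K : NNReal, ∀ t, LipschitzOnWith K (G t) (Metric.closedBall 0 R))
    (hbdd : ∀ R : ℝ, ∃ L : NNReal, ∀ t, ∀ x ∈ Metric.closedBall (0 : E) R, ‖G t x‖ ≤ L)
    {T R : ℝ} (hT : 0 < T)
    (hR : ∀ r, 0 < r → r ≤ T → ∀ w : ℝ → E, w 0 = x₀ →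
      (∀ t ∈ Set.Ioo (-r) r, HasDerivAt w (G t (w t)) t) → ∀ t ∈ Set.Ioo (-r) r, ‖w t‖ ≤ R) :
    ∃ w : ℝ → E, w 0 = x₀ ∧ ∀ t ∈ Set.Ioo (-T) T, HasDerivAt w (G t (w t)) t := by
  set R₁ := max R ‖x₀‖ with hR₁
  set R₂ := R₁ + 1
  obtain ⟨K, hK⟩ := hlip (R₂ + 1)
  obtain ⟨L, hL⟩ := hbdd (R₂ + 1)
  -- The truncated field is bounded by L everywhere, so a solution travels at most L T in time T and
  -- the ball of that radius is never left.
  have hPL : IsPicardLindelof (fun t x => cutoff R₂ x • G t x) (tmin := -T) (tmax := T)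
      ⟨0, by constructor <;> linarith⟩ x₀ (L * T.toNNReal) 0 L (K + L) := by
    refine ⟨fun t _ => (lipschitzWith_cutoff_smul (hK t) (hL t)).lipschitzOnWith,
      fun x _ => ((hcont x).const_smul _).continuousOn, fun t _ x _ => ?_, ?_⟩
    · rcases le_total ‖x‖ (R₂ + 1) with hx | hx
      · rw [norm_smul, Real.norm_of_nonneg (cutoff_nonneg _ _)]
        calc cutoff R₂ x * ‖G t x‖ ≤ 1 * L := by
              gcongr
              · exact cutoff_le_one _ _
              · exact hL t x (by simpa using hx)
          _ = L := one_mul _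
      · rw [cutoff_eq_zero hx, zero_smul, norm_zero]
        exact L.2
    · simp [hT.le]
  obtain ⟨w, hw0, hw⟩ := hPL.exists_eq_forall_mem_Icc_hasDerivWithinAt₀
  simp only at hw0
  have hwc : ContinuousOn w (Set.Icc (-T) T) := fun t ht => (hw t ht).continuousWithinAt
  have hneg : ContinuousOn (fun s => w (-s)) (Set.Icc 0 T) :=
    hwc.comp continuous_neg.continuousOn fun s hs => ⟨by linarith [hs.2], by linarith [hs.1]⟩
  have hpos : ContinuousOn w (Set.Icc 0 T) := hwc.mono (Set.Icc_subset_Icc_left (by linarith))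
  have hsol : ∀ r ≤ T, (∀ s ∈ Set.Ico 0 r, max ‖w s‖ ‖w (-s)‖ ≤ R₂) →
      ∀ t ∈ Set.Ioo (-r) r, HasDerivAt w (G t (w t)) t := by
    intro r hr h t ht
    have h1 : ‖w t‖ ≤ R₂ := by
      rcases le_total 0 t with h0 | h0
      · exact (le_max_left _ _).trans (h t ⟨h0, ht.2⟩)
      · simpa using (le_max_right _ _).trans (h (-t) ⟨by linarith, by linarith [ht.1]⟩)
    have h2 := (hw t ⟨by linarith [ht.1], by linarith [ht.2]⟩).hasDerivAt
      (Icc_mem_nhds (by linarith [ht.1]) (by linarith [ht.2]))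
    rwa [cutoff_eq_one h1, one_smul] at h2
  -- Continuity method with a = R₁ and b = R₁ + 1. As long as the solution has norm at most R₂ the
  -- cutoff equals 1, so the true equation holds and the a priori bound improves R₂ to R₁ on the
  -- open interval; the endpoint follows by continuity.
  have hbound : ∀ r ∈ Set.Icc 0 T, max ‖w r‖ ‖w (-r)‖ ≤ R₁ := by
    refine le_of_continuity_method (lt_add_one R₁) (hpos.norm.sup hneg.norm) ?_
    intro r hr h
    rcases hr.1.eq_or_lt with h0 | h0
    · rw [← h0]
      simp [hw0, hR₁]
    · have h1 := hR r h0 hr.2 w hw0 (hsol r hr.2 h)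
      have h2 : ∀ s ∈ Set.Ioo 0 r, max ‖w s‖ ‖w (-s)‖ ≤ R₁ := fun s hs =>
        (max_le (h1 s ⟨by linarith [hs.1], hs.2⟩)
          (h1 (-s) ⟨by linarith [hs.2], by linarith [hs.1]⟩)).trans (le_max_left _ _)
      have hc : ContinuousWithinAt (fun s => max ‖w s‖ ‖w (-s)‖) (Set.Ioo 0 r) r :=
        ((hpos.norm.sup hneg.norm) r hr).mono fun s hs => ⟨hs.1.le, hs.2.le.trans hr.2⟩
      have hne : (𝓝[Set.Ioo 0 r] r).NeBot := by
        rw [← mem_closure_iff_nhdsWithin_neBot, closure_Ioo h0.ne]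
        exact ⟨h0.le, le_rfl⟩
      exact le_of_tendsto hc (eventually_nhdsWithin_of_forall h2)
  exact ⟨w, hw0, hsol T le_rfl fun s hs => (hbound s ⟨hs.1, hs.2.le⟩).trans (by simp [R₂])⟩

/-- Global existence for a locally Lipschitz vector field with an a priori bound. -/
lemma exists_global_solution {G : ℝ → E → E} {x₀ : E} (hcont : ∀ x, Continuous (G · x))
    (hlip : ∀ R : ℝ, ∃ K : NNReal, ∀ t, LipschitzOnWith K (G t) (Metric.closedBall 0 R))
    (hbdd : ∀ R : ℝ, ∃ L : NNReal, ∀ t, ∀ x ∈ Metric.closedBall (0 : E) R, ‖G t x‖ ≤ L)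
    (hR : ∀ T : ℝ, 0 < T → ∃ R, ∀ r, 0 < r → r ≤ T → ∀ w : ℝ → E, w 0 = x₀ →
      (∀ t ∈ Set.Ioo (-r) r, HasDerivAt w (G t (w t)) t) → ∀ t ∈ Set.Ioo (-r) r, ‖w t‖ ≤ R) :
    ∃ w : ℝ → E, w 0 = x₀ ∧ ∀ t, HasDerivAt w (G t (w t)) t := by
  have hex : ∀ n : ℕ, ∃ w : ℝ → E, w 0 = x₀ ∧
      ∀ t ∈ Set.Ioo (-(n + 1 : ℝ)) (n + 1), HasDerivAt w (G t (w t)) t := fun n => by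
    obtain ⟨R, hR'⟩ := hR (n + 1) (by positivity)
    exact exists_solution_Ioo hcont hlip hbdd (by positivity) hR'
  choose W hW0 hW using hex
  have hagree : ∀ m n : ℕ, m ≤ n → Set.EqOn (W m) (W n) (Set.Ioo (-(m + 1 : ℝ)) (m + 1)) := by
    intro m n hmn
    have hm : (0 : ℝ) < m + 1 := by positivity
    have hmn' : (m : ℝ) + 1 ≤ n + 1 := by gcongr
    obtain ⟨R, hR'⟩ := hR (m + 1) hm
    obtain ⟨K, hK⟩ := hlip R
    have hn : ∀ t ∈ Set.Ioo (-(m + 1 : ℝ)) (m + 1), HasDerivAt (W n) (G t (W n t)) t :=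
      fun t ht => hW n t ⟨by linarith [ht.1], by linarith [ht.2]⟩
    -- The a priori bound confines both solutions to one ball, on which the field is Lipschitz
    -- uniformly in time.
    refine ODE_solution_unique_of_mem_Ioo (s := fun _ => Metric.closedBall 0 R) (t₀ := 0)
      (fun t _ => hK t) ⟨by linarith, hm⟩ (fun t ht => ⟨hW m t ht, ?_⟩)
      (fun t ht => ⟨hn t ht, ?_⟩) ((hW0 m).trans (hW0 n).symm)
    · simpa using hR' _ hm le_rfl _ (hW0 m) (hW m) t ht
    · simpa using hR' _ hm le_rfl _ (hW0 n) hn t ht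
  have heq : ∀ (n : ℕ) (s : ℝ), s ∈ Set.Ioo (-(n + 1 : ℝ)) (n + 1) → W ⌈|s|⌉₊ s = W n s := by
    intro n s hs
    have h1 : s ∈ Set.Ioo (-((⌈|s|⌉₊ : ℝ) + 1)) ((⌈|s|⌉₊ : ℝ) + 1) := by
      rw [Set.mem_Ioo, ← abs_lt]
      linarith [Nat.le_ceil |s|]
    rcases le_total ⌈|s|⌉₊ n with h | h
    · exact hagree _ _ h h1
    · exact (hagree _ _ h hs).symm
  -- The `n`-th solution lives on (-(n + 1), n + 1), so the index ⌈|t|⌉ leaves t in the interior,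
  -- and near t the glued function is a single `W n`.
  refine ⟨fun t => W ⌈|t|⌉₊ t, by simp [hW0], fun t => ?_⟩
  have ht : t ∈ Set.Ioo (-((⌈|t|⌉₊ : ℝ) + 1)) ((⌈|t|⌉₊ : ℝ) + 1) := by
    rw [Set.mem_Ioo, ← abs_lt]
    linarith [Nat.le_ceil |t|]
  refine (hW _ t ht).congr_of_eventuallyEq ?_
  filter_upwards [Ioo_mem_nhds ht.1 ht.2] with s hs
  exact heq _ s hs

/-! ### The vector field on `ℓ¹` -/

/-- The Banach space of absolutely summable families of Fourier coefficients. -/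
abbrev L1 : Type := lp (fun _ : Freq => ℂ) 1

lemma L1.absSummable (w : L1) : AbsSummable w := by
  simpa [AbsSummable] using (lp.memℓp w).summable (by simp)

lemma L1.norm_eq (w : L1) : ‖w‖ = l1 w := by
  simp [lp.norm_eq_tsum_rpow (p := 1) (by simp) w, l1]

/-- An absolutely summable family as an element of `ℓ¹`. -/
def AbsSummable.toL1 {a : Freq → ℂ} (h : AbsSummable a) : L1 :=
  ⟨a, memℓp_gen (by simpa [AbsSummable] using h)⟩

@[simp] lemma AbsSummable.coe_toL1 {a : Freq → ℂ} (h : AbsSummable a) : (h.toL1 : Freq → ℂ) = a :=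
  rfl

lemma AbsSummable.norm_toL1_sub {a b : Freq → ℂ} (ha : AbsSummable a) (hb : AbsSummable b) :
    ‖ha.toL1 - hb.toL1‖ = l1 (a - b) := by
  rw [L1.norm_eq]; rfl

lemma tendsto_l1_zero_of_dominated {ι : Type*} {F : Filter ι} {a : ι → Freq → ℂ} {g : Freq → ℝ}
    (hg : Summable g) (ha : ∀ k, Tendsto (fun t => a t k) F (𝓝 0)) (hb : ∀ t k, ‖a t k‖ ≤ g k) :
    Tendsto (fun t => l1 (a t)) F (𝓝 0) := by
  have := tendsto_tsum_of_dominated_convergence (𝓕 := F) (f := fun t k => ‖a t k‖)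
    (g := fun _ => (0 : ℝ)) hg (fun k => by simpa using (ha k).norm)
    (Eventually.of_forall fun t k => by simpa using hb t k)
  simpa [l1] using this

lemma continuous_toL1_of_dominated {a : ℝ → Freq → ℂ} {g : Freq → ℝ} (hg : Summable g)
    (ha : ∀ k, Continuous fun t => a t k) (hb : ∀ t k, ‖a t k‖ ≤ g k)
    (hs : ∀ t, AbsSummable (a t)) : Continuous fun t => (hs t).toL1 := by
  rw [continuous_iff_continuousAt]
  intro t₀
  rw [ContinuousAt, tendsto_iff_norm_sub_tendsto_zero]
  simp_rw [AbsSummable.norm_toL1_sub]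
  refine tendsto_l1_zero_of_dominated (hg.add hg) (fun k => ?_) (g := fun k => g k + g k)
    fun t k => (norm_sub_le _ _).trans (add_le_add (hb t k) (hb t₀ k))
  have := ((ha k).tendsto t₀).sub_const (a t₀ k)
  simpa using this

/-- The phase `e^{-itD}w`. -/
def unwind (t : ℝ) (w : Freq → ℂ) : Freq → ℂ := fun k =>
  Complex.exp (-(Complex.I * (t * jap k : ℝ))) * w k

lemma norm_exp_neg_I_mul (x : ℝ) : ‖Complex.exp (-(Complex.I * x))‖ = 1 := by
  rw [show -(Complex.I * (x : ℂ)) = ((-x : ℝ) : ℂ) * Complex.I by push_cast; ring]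
  exact Complex.norm_exp_ofReal_mul_I _

lemma norm_exp_I_mul (x : ℝ) : ‖Complex.exp (Complex.I * x)‖ = 1 := by
  rw [mul_comm]
  exact Complex.norm_exp_ofReal_mul_I _

@[simp] lemma norm_unwind (t : ℝ) (w : Freq → ℂ) (k : Freq) : ‖unwind t w k‖ = ‖w k‖ := by
  rw [unwind, norm_mul, norm_exp_neg_I_mul, one_mul]

/-- The coefficients of `u` in terms of the profile `w = e^{itD}(Du + i∂ₜu)`. -/
def posPart (t : ℝ) (w : Freq → ℂ) : Freq → ℂ := fun k =>
  (unwind t w k + starRingEnd ℂ (unwind t w (-k))) / (2 * jap k : ℝ)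

/-- The coefficients of `∂ₜu` in terms of the profile `w = e^{itD}(Du + i∂ₜu)`. -/
def velPart (t : ℝ) (w : Freq → ℂ) : Freq → ℂ := fun k =>
  (unwind t w k - starRingEnd ℂ (unwind t w (-k))) / (2 * Complex.I)

lemma isHermitian_posPart (t : ℝ) (w : Freq → ℂ) : IsHermitian (posPart t w) := fun k => by
  simp only [posPart, neg_neg, jap_neg, map_div₀, map_add, Complex.conj_conj, Complex.conj_ofReal]
  rw [add_comm]

lemma isHermitian_velPart (t : ℝ) (w : Freq → ℂ) : IsHermitian (velPart t w) := fun k => by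
  simp only [velPart, neg_neg, map_div₀, map_sub, Complex.conj_conj, map_mul, Complex.conj_I]
  rw [show starRingEnd ℂ (2 : ℂ) = 2 from Complex.conj_ofReal 2, mul_neg, div_neg, ← neg_div]
  congr 1
  ring

lemma norm_jap_mul_posPart_le (t : ℝ) (w : Freq → ℂ) (k : Freq) :
    jap k * ‖posPart t w k‖ ≤ (‖w k‖ + ‖w (-k)‖) / 2 := by
  have h := jap_pos k
  rw [posPart, norm_div, Complex.norm_real, Real.norm_of_nonneg (by positivity)]
  have h1 : ‖unwind t w k + starRingEnd ℂ (unwind t w (-k))‖ ≤ ‖w k‖ + ‖w (-k)‖ := by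
    refine (norm_add_le _ _).trans ?_
    rw [Complex.norm_conj, norm_unwind, norm_unwind]
  calc jap k * (‖unwind t w k + starRingEnd ℂ (unwind t w (-k))‖ / (2 * jap k))
      = ‖unwind t w k + starRingEnd ℂ (unwind t w (-k))‖ / 2 := by field_simp
    _ ≤ _ := by gcongr

lemma norm_velPart_le (t : ℝ) (w : Freq → ℂ) (k : Freq) :
    ‖velPart t w k‖ ≤ (‖w k‖ + ‖w (-k)‖) / 2 := by
  rw [velPart, norm_div, norm_mul, Complex.norm_I, Complex.norm_two, mul_one]
  gcongr
  refine (norm_sub_le _ _).trans ?_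
  rw [Complex.norm_conj, norm_unwind, norm_unwind]

lemma norm_posPart_le (t : ℝ) (w : Freq → ℂ) (k : Freq) :
    ‖posPart t w k‖ ≤ (‖w k‖ + ‖w (-k)‖) / 2 :=
  (le_mul_of_one_le_left (norm_nonneg _) (one_le_jap k)).trans (norm_jap_mul_posPart_le t w k)

variable {w : Freq → ℂ}

lemma AbsSummable.comp_neg (hw : AbsSummable w) : Summable fun k => ‖w (-k)‖ :=
  (Equiv.neg Freq).summable_iff.mpr hw

lemma AbsSummable.summable_symm (hw : AbsSummable w) :
    Summable fun k => (‖w k‖ + ‖w (-k)‖) / 2 :=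
  (Summable.add hw hw.comp_neg).div_const 2

lemma AbsSummable.tsum_symm (hw : AbsSummable w) : ∑' k, (‖w k‖ + ‖w (-k)‖) / 2 = l1 w := by
  have h : ∑' k, ‖w (-k)‖ = l1 w := (Equiv.neg Freq).tsum_eq fun k => ‖w k‖
  rw [tsum_div_const, Summable.tsum_add hw hw.comp_neg, h, l1]
  ring

lemma AbsSummable.of_le_symm {a : Freq → ℂ} (hw : AbsSummable w)
    (h : ∀ k, ‖a k‖ ≤ (‖w k‖ + ‖w (-k)‖) / 2) : AbsSummable a :=
  Summable.of_nonneg_of_le (fun _ => norm_nonneg _) h hw.summable_symm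

lemma AbsSummable.l1_le_of_le_symm {a : Freq → ℂ} (hw : AbsSummable w)
    (h : ∀ k, ‖a k‖ ≤ (‖w k‖ + ‖w (-k)‖) / 2) : l1 a ≤ l1 w :=
  ((hw.of_le_symm h).tsum_le_tsum h hw.summable_symm).trans_eq hw.tsum_symm

lemma AbsSummable.posPart (hw : AbsSummable w) (t : ℝ) : AbsSummable (posPart t w) :=
  hw.of_le_symm (norm_posPart_le t w)

lemma l1_posPart_le (hw : AbsSummable w) (t : ℝ) : l1 (posPart t w) ≤ l1 w :=
  hw.l1_le_of_le_symm (norm_posPart_le t w)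

lemma AbsSummable.velPart (hw : AbsSummable w) (t : ℝ) : AbsSummable (velPart t w) :=
  hw.of_le_symm (norm_velPart_le t w)

lemma l1_velPart_le (hw : AbsSummable w) (t : ℝ) : l1 (velPart t w) ≤ l1 w :=
  hw.l1_le_of_le_symm (norm_velPart_le t w)

lemma norm_jap_mul_posPart_le' (t : ℝ) (w : Freq → ℂ) (k : Freq) :
    ‖jap k * CubicWave.posPart t w k‖ ≤ (‖w k‖ + ‖w (-k)‖) / 2 := by
  rw [norm_mul, Complex.norm_real, Real.norm_of_nonneg (jap_pos k).le]
  exact norm_jap_mul_posPart_le t w k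

lemma AbsSummable.jap_mul_posPart (hw : AbsSummable w) (t : ℝ) :
    AbsSummable fun k => jap k * CubicWave.posPart t w k :=
  hw.of_le_symm (norm_jap_mul_posPart_le' t w)

lemma l1_jap_mul_posPart_le (hw : AbsSummable w) (t : ℝ) :
    (l1 fun k => jap k * posPart t w k) ≤ l1 w :=
  hw.l1_le_of_le_symm (norm_jap_mul_posPart_le' t w)

lemma posPart_sub (t : ℝ) (w v : Freq → ℂ) : posPart t (w - v) = posPart t w - posPart t v := by
  ext k
  simp only [posPart, unwind, Pi.sub_apply, mul_sub, map_sub]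
  ring

/-- The coefficients of `u - u³`. -/
def force (u : Freq → ℂ) : Freq → ℂ := u - cube u

lemma AbsSummable.force {u : Freq → ℂ} (hu : AbsSummable u) : AbsSummable (force u) :=
  hu.sub hu.cube

lemma IsHermitian.force {u : Freq → ℂ} (hu : IsHermitian u) : IsHermitian (force u) :=
  hu.sub hu.cube

lemma l1_force_le {u : Freq → ℂ} (hu : AbsSummable u) : l1 (force u) ≤ l1 u + l1 u ^ 3 :=
  (l1_sub_le hu hu.cube).trans (by gcongr; exact l1_cube_le hu)

lemma l1_force_sub_le {u v : Freq → ℂ} (hu : AbsSummable u) (hv : AbsSummable v) {M : ℝ}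
    (huM : l1 u ≤ M) (hvM : l1 v ≤ M) :
    l1 (force u - force v) ≤ (1 + 3 * M ^ 2) * l1 (u - v) := by
  have h : force u - force v = (u - v) - (cube u - cube v) := by
    rw [CubicWave.force, CubicWave.force]; abel
  rw [h]
  refine (l1_sub_le (hu.sub hv) (hu.cube.sub hv.cube)).trans ?_
  linarith [l1_cube_sub_cube_le hu hv huM hvM]

/-- The evolution of the profile: `w' = i e^{itD} (u - u³)`. -/
def field (t : ℝ) (w : Freq → ℂ) : Freq → ℂ := fun k =>
  Complex.I * Complex.exp (Complex.I * (t * jap k : ℝ)) * force (posPart t w) k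

@[simp] lemma norm_field (t : ℝ) (w : Freq → ℂ) (k : Freq) :
    ‖field t w k‖ = ‖force (posPart t w) k‖ := by
  rw [field, norm_mul, norm_mul, Complex.norm_I, norm_exp_I_mul, one_mul, one_mul]

lemma AbsSummable.field (hw : AbsSummable w) (t : ℝ) : AbsSummable (field t w) :=
  (hw.posPart t).force.of_le fun k => (norm_field t w k).le

lemma l1_field (t : ℝ) (w : Freq → ℂ) : l1 (field t w) = l1 (force (posPart t w)) := by
  simp [l1]

lemma l1_field_sub (t : ℝ) (w v : Freq → ℂ) :
    l1 (field t w - field t v) = l1 (force (posPart t w) - force (posPart t v)) := by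
  simp only [l1, Pi.sub_apply, CubicWave.field, ← mul_sub]
  simp only [norm_mul, Complex.norm_I, norm_exp_I_mul, one_mul]

/-- The vector field on `ℓ¹`. -/
def fieldL1 (t : ℝ) (w : L1) : L1 := (w.absSummable.field t).toL1

lemma norm_fieldL1_le (t : ℝ) (w : L1) : ‖fieldL1 t w‖ ≤ ‖w‖ + ‖w‖ ^ 3 := by
  rw [L1.norm_eq, fieldL1, AbsSummable.coe_toL1, l1_field, L1.norm_eq]
  have h1 := l1_posPart_le w.absSummable t
  have h0 := l1_nonneg (posPart t w)
  exact (l1_force_le (w.absSummable.posPart t)).trans (by gcongr)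

lemma exists_bound_fieldL1 (R : ℝ) :
    ∃ L : NNReal, ∀ t, ∀ w ∈ Metric.closedBall (0 : L1) R, ‖fieldL1 t w‖ ≤ L := by
  refine ⟨⟨|R| + |R| ^ 3, by positivity⟩, fun t w hw => (norm_fieldL1_le t w).trans ?_⟩
  have : ‖w‖ ≤ |R| := (by simpa using hw : ‖w‖ ≤ R).trans (le_abs_self R)
  change _ ≤ |R| + |R| ^ 3
  gcongr

lemma exists_lipschitzOnWith_fieldL1 (R : ℝ) :
    ∃ K : NNReal, ∀ t, LipschitzOnWith K (fieldL1 t) (Metric.closedBall 0 R) := by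
  refine ⟨⟨1 + 3 * R ^ 2, by positivity⟩, fun t => LipschitzOnWith.of_dist_le_mul ?_⟩
  intro w hw v hv
  rw [dist_eq_norm, dist_eq_norm, fieldL1, fieldL1, AbsSummable.norm_toL1_sub, l1_field_sub]
  rw [mem_closedBall_zero_iff, L1.norm_eq] at hw hv
  refine (l1_force_sub_le (w.absSummable.posPart t) (v.absSummable.posPart t)
    ((l1_posPart_le w.absSummable t).trans hw) ((l1_posPart_le v.absSummable t).trans hv)).trans ?_
  rw [← posPart_sub, L1.norm_eq]
  change _ ≤ (1 + 3 * R ^ 2) * _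
  gcongr
  exact l1_posPart_le (w - v).absSummable t

/-- The phases e^{itD} are only strongly continuous in t. The difference of two values is therefore
split into a change of `force`, controlled by its Lipschitz bound, and a change of phase acting on
one fixed family, controlled by dominated convergence. -/
lemma continuous_fieldL1 (w : L1) : Continuous fun t => fieldL1 t w := by
  have hw := w.absSummable
  have hu : Continuous fun t => (hw.posPart t).toL1 := by
    refine continuous_toL1_of_dominated hw.summable_symm (fun k => ?_)
      (fun t k => norm_posPart_le t w k) _
    simp only [posPart, unwind]
    fun_prop
  rw [continuous_iff_continuousAt]
  intro t₀
  rw [ContinuousAt, tendsto_iff_norm_sub_tendsto_zero]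
  have hd : Tendsto (fun t => l1 (posPart t w - posPart t₀ w)) (𝓝 t₀) (𝓝 0) := by
    have := tendsto_iff_norm_sub_tendsto_zero.1 (hu.tendsto t₀)
    simpa only [AbsSummable.norm_toL1_sub] using this
  set N := force (posPart t₀ w) with hN
  have hNs : AbsSummable N := (hw.posPart t₀).force
  have he : Tendsto (fun t => l1 fun k => (Complex.exp (Complex.I * (t * jap k : ℝ)) -
      Complex.exp (Complex.I * (t₀ * jap k : ℝ))) * N k) (𝓝 t₀) (𝓝 0) := by
    refine tendsto_l1_zero_of_dominated (g := fun k => 2 * ‖N k‖) (Summable.mul_left 2 hNs)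
      (fun k => ?_) fun t k => ?_
    · have hc : Continuous fun t : ℝ => (Complex.exp (Complex.I * (t * jap k : ℝ)) -
        Complex.exp (Complex.I * (t₀ * jap k : ℝ))) * N k := by fun_prop
      simpa using hc.tendsto t₀
    · rw [norm_mul]
      gcongr
      refine (norm_sub_le _ _).trans ?_
      rw [norm_exp_I_mul, norm_exp_I_mul]; norm_num
  have hlim := (hd.const_mul (1 + 3 * l1 w ^ 2)).add he
  rw [mul_zero, add_zero] at hlim
  refine squeeze_zero (fun _ => norm_nonneg _) (fun t => ?_) hlim
  rw [fieldL1, fieldL1, AbsSummable.norm_toL1_sub]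
  have hs1 := (hw.posPart t).force.sub hNs
  have hs2 : AbsSummable fun k => (Complex.exp (Complex.I * (t * jap k : ℝ)) -
      Complex.exp (Complex.I * (t₀ * jap k : ℝ))) * N k := by
    refine Summable.of_nonneg_of_le (fun _ => norm_nonneg _) (fun k => ?_) (Summable.mul_left 2 hNs)
    rw [norm_mul]
    gcongr
    refine (norm_sub_le _ _).trans ?_
    rw [norm_exp_I_mul, norm_exp_I_mul]; norm_num
  have h1 : l1 (field t w - field t₀ w) ≤ l1 (force (posPart t w) - N) +
      l1 fun k => (Complex.exp (Complex.I * (t * jap k : ℝ)) -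
      Complex.exp (Complex.I * (t₀ * jap k : ℝ))) * N k := by
    rw [l1, l1, l1, ← Summable.tsum_add hs1 hs2]
    refine ((hw.field t).sub (hw.field t₀)).tsum_le_tsum (fun k => ?_) (Summable.add hs1 hs2)
    have : (field t w - field t₀ w) k = Complex.I * Complex.exp (Complex.I * (t * jap k : ℝ)) *
        (force (posPart t w) - N) k + Complex.I * ((Complex.exp (Complex.I * (t * jap k : ℝ)) -
        Complex.exp (Complex.I * (t₀ * jap k : ℝ))) * N k) := by
      simp only [field, Pi.sub_apply, hN]
      ring
    rw [this]
    refine (norm_add_le _ _).trans_eq ?_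
    rw [norm_mul, norm_mul, norm_mul Complex.I, Complex.norm_I, norm_exp_I_mul, one_mul, one_mul,
      one_mul]
  refine h1.trans ?_
  gcongr
  exact l1_force_sub_le (hw.posPart t) (hw.posPart t₀) (l1_posPart_le hw t) (l1_posPart_le hw t₀)

lemma hasDerivAt_coord {w : ℝ → L1} {w' : L1} {t : ℝ} (h : HasDerivAt w w' t) (k : Freq) :
    HasDerivAt (fun s => w s k) (w' k) t := by
  have h1 : ∀ f : L1, ‖(f : Freq → ℂ) k‖ ≤ 1 * ‖f‖ := fun f => by
    rw [one_mul, L1.norm_eq]; exact f.absSummable.norm_le_l1 k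
  let ev : L1 →L[ℝ] ℂ := LinearMap.mkContinuous
    { toFun := fun f => f k, map_add' := fun _ _ => rfl, map_smul' := fun _ _ => rfl } 1 h1
  exact ev.hasFDerivAt.comp_hasDerivAt t h

variable {W : ℝ → Freq → ℂ} {t : ℝ}

/-- For z = e^{-itD}w = Du + i∂ₜu the two phases cancel, leaving the first-order form z' = -iDz +
i(u - u³) of the wave equation. -/
lemma hasDerivAt_unwind
    (h : ∀ k, HasDerivAt (fun s => W s k) (field t (W t) k) t) (k : Freq) :
    HasDerivAt (fun s => unwind s (W s) k)
    (-(Complex.I * jap k) * unwind t (W t) k + Complex.I * force (posPart t (W t)) k) t := by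
  have h1 : HasDerivAt (fun s : ℝ => -(Complex.I * ((s * jap k : ℝ) : ℂ)))
      (-(Complex.I * jap k)) t := by
    have := (((hasDerivAt_id t).mul_const (jap k)).ofReal_comp.const_mul Complex.I).fun_neg
    simpa using this
  have h2 := h1.cexp.mul (h k)
  refine h2.congr_deriv ?_
  have h3 : Complex.exp (-(Complex.I * ((t * jap k : ℝ) : ℂ))) *
      Complex.exp (Complex.I * ((t * jap k : ℝ) : ℂ)) = 1 := by
    rw [← Complex.exp_add, neg_add_cancel, Complex.exp_zero]
  rw [unwind, field]
  linear_combination (Complex.I * force (posPart t (W t)) k) * h3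

/-- The forcing is Hermitian, so its contributions at k and, conjugated, at -k cancel in the sum. -/
lemma hasDerivAt_posPart
    (h : ∀ k, HasDerivAt (fun s => W s k) (field t (W t) k) t) (k : Freq) :
    HasDerivAt (fun s => posPart s (W s) k) (velPart t (W t) k) t := by
  have h1 := hasDerivAt_unwind h k
  have h2 := (hasDerivAt_unwind h (-k)).star
  have h3 := (h1.add h2).div_const ((2 * jap k : ℝ) : ℂ)
  refine h3.congr_deriv ?_
  have hN := (isHermitian_posPart t (W t)).force k
  have hj : (jap k : ℂ) ≠ 0 := by exact_mod_cast (jap_pos k).ne'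
  simp only [Complex.star_def, map_add, map_mul, map_neg, Complex.conj_I, jap_neg,
    Complex.conj_ofReal, hN, Complex.conj_conj, velPart]
  push_cast
  field_simp
  linear_combination
    (-jap k * (unwind t (W t) k - starRingEnd ℂ (unwind t (W t) (-k)))) * Complex.I_sq

/-- Here the forcing contributions add up. The linear term u in `force` compensates for ⟨k⟩² = 1 +
|k|², which leaves the symbol of the Laplacian. -/
lemma hasDerivAt_velPart
    (h : ∀ k, HasDerivAt (fun s => W s k) (field t (W t) k) t) (k : Freq) :
    HasDerivAt (fun s => velPart s (W s) k)
    (-((∑ i, (k i : ℝ) ^ 2 : ℝ) : ℂ) * posPart t (W t) k - cube (posPart t (W t)) k) t := by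
  have h1 := hasDerivAt_unwind h k
  have h2 := (hasDerivAt_unwind h (-k)).star
  have h3 := (h1.sub h2).div_const (2 * Complex.I)
  refine h3.congr_deriv ?_
  have hN := (isHermitian_posPart t (W t)).force k
  have hj : (jap k : ℂ) ≠ 0 := by exact_mod_cast (jap_pos k).ne'
  have hu : unwind t (W t) k + starRingEnd ℂ (unwind t (W t) (-k)) =
      2 * jap k * posPart t (W t) k := by
    simp only [posPart]; push_cast; field_simp
  have hk : ((∑ i, (k i : ℝ) ^ 2 : ℝ) : ℂ) = jap k ^ 2 - 1 := by
    rw [← Complex.ofReal_pow, jap_sq]; push_cast; ring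
  have hf : force (posPart t (W t)) k = posPart t (W t) k - cube (posPart t (W t)) k := rfl
  simp only [Complex.star_def, map_add, map_mul, map_neg, Complex.conj_I, jap_neg,
    Complex.conj_ofReal, hN, Complex.conj_conj]
  rw [hk, div_eq_iff (by simp), hf]
  linear_combination (-(Complex.I * jap k)) * hu

/-! ### Rapidly decaying families -/

/-- `a t k` decays faster than any power of `⟨k⟩`, uniformly for `t ∈ S`. -/
def RapidOn (S : Set ℝ) (a : ℝ → Freq → ℂ) : Prop :=
  ∀ m : ℕ, ∃ C, ∀ t ∈ S, ∀ k, ‖a t k‖ * jap k ^ m ≤ C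

/-- `a k` decays faster than any power of `⟨k⟩`. -/
def Rapid (a : Freq → ℂ) : Prop := ∀ m : ℕ, ∃ C, ∀ k, ‖a k‖ * jap k ^ m ≤ C

lemma le_mul_inv_jap_of_le {x C : ℝ} {k : Freq} (h : x * jap k ^ 6 ≤ C) :
    x ≤ C * (jap k ^ 6)⁻¹ := by
  rw [← div_eq_mul_inv, le_div_iff₀ (pow_pos (jap_pos k) 6)]
  exact h

lemma Rapid.absSummable {a : Freq → ℂ} (h : Rapid a) : AbsSummable a := by
  obtain ⟨C, hC⟩ := h 6
  exact Summable.of_nonneg_of_le (fun _ => norm_nonneg _) (fun k => le_mul_inv_jap_of_le (hC k))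
    (summable_inv_jap_pow_six.mul_left C)

lemma Rapid.add {a b : Freq → ℂ} (ha : Rapid a) (hb : Rapid b) : Rapid (a + b) := fun m => by
  obtain ⟨A, hA⟩ := ha m
  obtain ⟨B, hB⟩ := hb m
  refine ⟨A + B, fun k => ?_⟩
  have := (jap_pos k).le
  calc ‖(a + b) k‖ * jap k ^ m ≤ (‖a k‖ + ‖b k‖) * jap k ^ m := by gcongr; exact norm_add_le _ _
    _ ≤ A + B := by linarith [hA k, hB k]

lemma Rapid.of_norm_le {a b : Freq → ℂ} (hb : Rapid b) (d : ℕ) (M : ℝ)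
    (h : ∀ k, ‖a k‖ ≤ M * jap k ^ d * ‖b k‖) : Rapid a := fun m => by
  obtain ⟨B, hB⟩ := hb (d + m)
  refine ⟨|M| * B, fun k => ?_⟩
  have := (jap_pos k).le
  calc ‖a k‖ * jap k ^ m ≤ (M * jap k ^ d * ‖b k‖) * jap k ^ m := by gcongr; exact h k
    _ = M * (‖b k‖ * jap k ^ (d + m)) := by rw [pow_add]; ring
    _ ≤ |M| * B := mul_le_mul (le_abs_self M) (hB k) (by positivity) (abs_nonneg M)

variable {S : Set ℝ} {a b : ℝ → Freq → ℂ} {t : ℝ}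

lemma RapidOn.rapid (h : RapidOn S a) (ht : t ∈ S) : Rapid (a t) := fun m => by
  obtain ⟨C, hC⟩ := h m
  exact ⟨C, hC t ht⟩

lemma RapidOn.absSummable (h : RapidOn S a) (ht : t ∈ S) : AbsSummable (a t) :=
  (h.rapid ht).absSummable

lemma RapidOn.mono {S' : Set ℝ} (h : RapidOn S a) (hS : S' ⊆ S) : RapidOn S' a := fun m => by
  obtain ⟨C, hC⟩ := h m
  exact ⟨C, fun t ht => hC t (hS ht)⟩

lemma RapidOn.exists_summable_bound (h : RapidOn S a) :
    ∃ g : Freq → ℝ, Summable g ∧ ∀ t ∈ S, ∀ k, ‖a t k‖ ≤ g k := by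
  obtain ⟨C, hC⟩ := h 6
  exact ⟨fun k => C * (jap k ^ 6)⁻¹, summable_inv_jap_pow_six.mul_left C,
    fun t ht k => le_mul_inv_jap_of_le (hC t ht k)⟩

lemma RapidOn.exists_l1_bound (h : RapidOn S a) : ∃ M, ∀ t ∈ S, l1 (a t) ≤ M := by
  obtain ⟨g, hg, hag⟩ := h.exists_summable_bound
  exact ⟨∑' k, g k, fun t ht => Summable.tsum_le_tsum (hag t ht) (h.absSummable ht) hg⟩

lemma RapidOn.add (ha : RapidOn S a) (hb : RapidOn S b) : RapidOn S fun t => a t + b t := fun m => by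
  obtain ⟨A, hA⟩ := ha m
  obtain ⟨B, hB⟩ := hb m
  refine ⟨A + B, fun t ht k => ?_⟩
  have := (jap_pos k).le
  calc ‖(a t + b t) k‖ * jap k ^ m ≤ (‖a t k‖ + ‖b t k‖) * jap k ^ m := by
        gcongr; exact norm_add_le _ _
    _ ≤ A + B := by linarith [hA t ht k, hB t ht k]

lemma RapidOn.of_norm_le (hb : RapidOn S b) (d : ℕ) (M : ℝ)
    (h : ∀ t ∈ S, ∀ k, ‖a t k‖ ≤ M * jap k ^ d * ‖b t k‖) : RapidOn S a := fun m => by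
  obtain ⟨B, hB⟩ := hb (d + m)
  refine ⟨|M| * B, fun t ht k => ?_⟩
  have := (jap_pos k).le
  calc ‖a t k‖ * jap k ^ m ≤ (M * jap k ^ d * ‖b t k‖) * jap k ^ m := by gcongr; exact h t ht k
    _ = M * (‖b t k‖ * jap k ^ (d + m)) := by rw [pow_add]; ring
    _ ≤ |M| * B := mul_le_mul (le_abs_self M) (hB t ht k) (by positivity) (abs_nonneg M)

lemma RapidOn.conv (ha : RapidOn S a) (hb : RapidOn S b) :
    RapidOn S fun t => conv (a t) (b t) := fun m => by
  obtain ⟨A, hA⟩ := ha m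
  obtain ⟨B, hB⟩ := hb m
  obtain ⟨M, hM⟩ := ha.exists_l1_bound
  obtain ⟨N, hN⟩ := hb.exists_l1_bound
  refine ⟨2 ^ m * (|A| * N + M * |B|), fun t ht k => ?_⟩
  refine (norm_conv_mul_jap_pow_le (ha.absSummable ht) (hb.absSummable ht) (hA t ht) (hB t ht)
    k).trans ?_
  have h1 : A * l1 (b t) ≤ |A| * N :=
    mul_le_mul (le_abs_self A) (hN t ht) (l1_nonneg _) (abs_nonneg A)
  have h2 : l1 (a t) * B ≤ M * |B| :=
    (mul_le_mul_of_nonneg_left (le_abs_self B) (l1_nonneg _)).trans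
      (mul_le_mul_of_nonneg_right (hM t ht) (abs_nonneg B))
  gcongr

lemma RapidOn.cube (ha : RapidOn S a) : RapidOn S fun t => cube (a t) := ha.conv (ha.conv ha)

lemma RapidOn.symm_bound (hb : RapidOn S b)
    (h : ∀ t ∈ S, ∀ k, ‖a t k‖ ≤ (‖b t k‖ + ‖b t (-k)‖) / 2) :
    RapidOn S a := fun m => by
  obtain ⟨B, hB⟩ := hb m
  refine ⟨B, fun t ht k => ?_⟩
  have h1 := hB t ht k
  have h2 := hB t ht (-k)
  rw [jap_neg] at h2
  have := pow_pos (jap_pos k) m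
  nlinarith [h t ht k]

lemma RapidOn.posPart (ha : RapidOn S a) : RapidOn S fun t => posPart t (a t) :=
  ha.symm_bound fun t _ k => norm_posPart_le t (a t) k

lemma RapidOn.velPart (ha : RapidOn S a) : RapidOn S fun t => velPart t (a t) :=
  ha.symm_bound fun t _ k => norm_velPart_le t (a t) k

/-- Leibniz rule for the convolution of rapidly decaying families. -/
lemma hasDerivAt_conv {r : ℝ} {a' b' : ℝ → Freq → ℂ}
    (ha : RapidOn (Set.Ioo (-r) r) a) (hb : RapidOn (Set.Ioo (-r) r) b)
    (ha' : RapidOn (Set.Ioo (-r) r) a') (hb' : RapidOn (Set.Ioo (-r) r) b')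
    (had : ∀ t ∈ Set.Ioo (-r) r, ∀ k, HasDerivAt (fun s => a s k) (a' t k) t)
    (hbd : ∀ t ∈ Set.Ioo (-r) r, ∀ k, HasDerivAt (fun s => b s k) (b' t k) t)
    (ht : t ∈ Set.Ioo (-r) r) (k : Freq) :
    HasDerivAt (fun s => conv (a s) (b s) k) (conv (a' t) (b t) k + conv (a t) (b' t) k) t := by
  obtain ⟨g, hg, hag⟩ := ha.exists_summable_bound
  obtain ⟨g', hg', hag'⟩ := ha'.exists_summable_bound
  obtain ⟨B, hB⟩ := hb 0
  obtain ⟨B', hB'⟩ := hb' 0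
  simp only [pow_zero, mul_one] at hB hB'
  have key := hasDerivAt_tsum_of_isPreconnected (t := Set.Ioo (-r) r)
    (u := fun j => g' j * B + g j * B')
    (g := fun j s => a s j * b s (k - j))
    (g' := fun j s => a' s j * b s (k - j) + a s j * b' s (k - j))
    ((hg'.mul_right B).add (hg.mul_right B')) isOpen_Ioo isPreconnected_Ioo
    (fun j s hs => (had s hs j).mul (hbd s hs (k - j))) (fun j s hs => ?_) ht
    ((ha.absSummable ht).conv_fiber (hb.absSummable ht) k) ht
  · refine key.congr_deriv ?_
    exact ((ha'.absSummable ht).conv_fiber (hb.absSummable ht) k).tsum_add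
      ((ha.absSummable ht).conv_fiber (hb'.absSummable ht) k)
  · refine (norm_add_le _ _).trans ?_
    rw [norm_mul, norm_mul]
    have h1 := (norm_nonneg _).trans (hag s hs j)
    have h2 := (norm_nonneg _).trans (hag' s hs j)
    gcongr
    · exact hag' s hs j
    · exact hB s hs _
    · exact hag s hs j
    · exact hB' s hs _

lemma conv_assoc {a b c : Freq → ℂ} (ha : AbsSummable a) (hb : AbsSummable b) (hc : AbsSummable c) :
    conv (conv a b) c = conv a (conv b c) := by
  ext k
  have hs : Summable (Function.uncurry fun j i : Freq => a i * b (j - i) * c (k - j)) := by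
    refine Summable.of_norm_bounded ((ha.conv_prod hb).mul_right (l1 c)) fun p => ?_
    rw [Function.uncurry, norm_mul]
    exact mul_le_mul_of_nonneg_left (hc.norm_le_l1 _) (norm_nonneg _)
  calc conv (conv a b) c k = ∑' j, ∑' i, a i * b (j - i) * c (k - j) :=
        tsum_congr fun j => tsum_mul_right.symm
    _ = ∑' i, ∑' j, a i * b (j - i) * c (k - j) := hs.tsum_comm.symm
    _ = ∑' i, a i * ∑' l, b l * c (k - i - l) := tsum_congr fun i => by
        rw [← tsum_mul_left, ← (Equiv.subRight i).tsum_eq fun l => a i * (b l * c (k - i - l))]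
        refine tsum_congr fun j => ?_
        rw [Equiv.subRight_apply, mul_assoc, sub_sub_sub_cancel_right]
    _ = conv a (conv b c) k := rfl

/-! ### Conservation of energy -/

/-- The energy density in Fourier space. -/
def energyTerm (u p : Freq → ℂ) (k : Freq) : ℝ :=
  (1 / 2) * (‖p k‖ ^ 2 + (∑ i, (k i : ℝ) ^ 2) * ‖u k‖ ^ 2) + (1 / 4) * ‖conv u u k‖ ^ 2

/-- The energy `½‖∂ₜu‖² + ½‖∇u‖² + ¼‖u‖⁴_{L⁴}`. -/
def energy (u p : Freq → ℂ) : ℝ := ∑' k, energyTerm u p k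

lemma energyTerm_nonneg (u p : Freq → ℂ) (k : Freq) : 0 ≤ energyTerm u p k := by
  unfold energyTerm; positivity

/-- Parseval: an L² pairing with a real function is the zero mode of a product, so identities
between pairings reduce to the algebra of convolution. -/
lemma conj_mul_eq_conv {p c : Freq → ℂ} (hp : IsHermitian p) :
    ∑' k, starRingEnd ℂ (p k) * c k = conv c p 0 := by
  simp only [conv, zero_sub]
  exact tsum_congr fun k => by rw [hp k, mul_comm]

lemma summable_energyTerm {u p : Freq → ℂ} (hu : Rapid u) (hp : Rapid p) :
    Summable (energyTerm u p) := by
  have hsq : ∀ a : Freq → ℂ, AbsSummable a → Summable fun k => ‖a k‖ ^ 2 := fun a ha =>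
    Summable.of_nonneg_of_le (fun _ => by positivity)
      (fun k => by rw [sq]; exact mul_le_mul_of_nonneg_left (ha.norm_le_l1 k) (norm_nonneg _))
      (Summable.mul_right (l1 a) ha)
  have hju : AbsSummable fun k => jap k * u k :=
    (hu.of_norm_le 1 1 fun k => by
      rw [norm_mul, Complex.norm_real, Real.norm_of_nonneg (jap_pos k).le]; simp).absSummable
  have h2 : Summable fun k => (∑ i, (k i : ℝ) ^ 2) * ‖u k‖ ^ 2 := by
    refine Summable.of_nonneg_of_le (fun _ => by positivity) (fun k => ?_) (hsq _ hju)
    rw [norm_mul, Complex.norm_real, Real.norm_of_nonneg (jap_pos k).le, mul_pow]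
    gcongr
    exact sum_sq_le_jap_sq k
  exact (((hsq _ hp.absSummable).add h2).mul_left _).add
    ((hsq _ (hu.absSummable.conv hu.absSummable)).mul_left _)

/-- Conservation of energy for rapidly decaying solutions. -/
lemma hasDerivAt_energy {r : ℝ} {u p : ℝ → Freq → ℂ}
    (hu : RapidOn (Set.Ioo (-r) r) u) (hp : RapidOn (Set.Ioo (-r) r) p)
    (hur : ∀ t, IsHermitian (u t)) (hpr : ∀ t, IsHermitian (p t))
    (hud : ∀ t ∈ Set.Ioo (-r) r, ∀ k, HasDerivAt (fun s => u s k) (p t k) t)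
    (hpd : ∀ t ∈ Set.Ioo (-r) r, ∀ k, HasDerivAt (fun s => p s k)
      (-((∑ i, (k i : ℝ) ^ 2 : ℝ) : ℂ) * u t k - cube (u t) k) t)
    (ht : t ∈ Set.Ioo (-r) r) : HasDerivAt (fun s => energy (u s) (p s)) 0 t := by
  have hq := hu.conv hu
  have hup := hu.conv hp
  have hc := hu.cube
  obtain ⟨g₁, hg₁, hpg⟩ := hp.exists_summable_bound
  obtain ⟨g₂, hg₂, hqg⟩ := hq.exists_summable_bound
  obtain ⟨A₁, hA₁⟩ := hc 0
  obtain ⟨A₂, hA₂⟩ := hup 0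
  simp only [pow_zero, mul_one] at hA₁ hA₂
  -- The quadratic terms |k|² Re(p̄u) cancel at each frequency. The remaining two cancel only after
  -- summation over k.
  set e' : Freq → ℝ → ℝ := fun k s => (-(starRingEnd ℂ (p s k) * cube (u s) k) +
    starRingEnd ℂ (conv (u s) (u s) k) * conv (u s) (p s) k).re with he'
  have hterm : ∀ k, ∀ s ∈ Set.Ioo (-r) r,
      HasDerivAt (fun s => energyTerm (u s) (p s) k) (e' k s) s := by
    intro k s hs
    have h1 := (hpd s hs k).norm_sq
    have h2 := (hud s hs k).norm_sq
    have h3 := (hasDerivAt_conv hu hu hp hp hud hud hs k).norm_sq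
    have h4 := ((h1.add (h2.const_mul (∑ i, (k i : ℝ) ^ 2))).const_mul (1 / 2)).add
      (h3.const_mul (1 / 4))
    refine h4.congr_deriv ?_
    rw [conv_comm (p s) (u s)]
    simp only [Complex.inner, he', Complex.add_re, Complex.neg_re, Complex.mul_re, Complex.conj_re,
      Complex.conj_im, Complex.sub_re, Complex.sub_im, Complex.mul_im, Complex.neg_im,
      Complex.ofReal_re, Complex.ofReal_im, Complex.add_im]
    ring
  have key := hasDerivAt_tsum_of_isPreconnected (t := Set.Ioo (-r) r)
    (u := fun k => g₁ k * A₁ + g₂ k * A₂) (g := fun k s => energyTerm (u s) (p s) k) (g' := e')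
    ((hg₁.mul_right A₁).add (hg₂.mul_right A₂)) isOpen_Ioo isPreconnected_Ioo
    (fun k s hs => hterm k s hs) (fun k s hs => ?_) ht
    (summable_energyTerm (hu.rapid ht) (hp.rapid ht)) ht
  · refine key.congr_deriv ?_
    have hus := hu.absSummable ht
    have hps := hp.absSummable ht
    have hsum : ∀ a b : Freq → ℂ, AbsSummable a → AbsSummable b →
        Summable fun k => starRingEnd ℂ (a k) * b k := fun a b ha hb => by
      refine Summable.of_norm_bounded (Summable.mul_right (l1 b) ha) fun k => ?_
      rw [norm_mul, Complex.norm_conj]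
      exact mul_le_mul_of_nonneg_left (hb.norm_le_l1 k) (norm_nonneg _)
    have hs1 := hsum _ _ hps hus.cube
    have hs2 := hsum _ _ (hus.conv hus) (hus.conv hps)
    -- Both sums are the zero mode of u³p, the convolution factors being merely bracketed and
    -- ordered differently.
    rw [he', ← Complex.re_tsum (hs1.neg.add hs2), Summable.tsum_add hs1.neg hs2, tsum_neg,
      conj_mul_eq_conv (hpr t), conj_mul_eq_conv ((hur t).conv (hur t)), cube,
      conv_assoc hus (hus.conv hus) hps, conv_assoc hus hps (hus.conv hus),
      conv_comm (conv (u t) (u t)) (p t)]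
    simp
  · refine (Complex.abs_re_le_norm _).trans ((norm_add_le _ _).trans ?_)
    rw [norm_neg, norm_mul, norm_mul, Complex.norm_conj, Complex.norm_conj]
    have h1 := (norm_nonneg _).trans (hpg s hs k)
    have h2 := (norm_nonneg _).trans (hqg s hs k)
    gcongr
    · exact hpg s hs k
    · exact hA₁ s hs k
    · exact hqg s hs k
    · exact hA₂ s hs k

/-- The energy controls the `H¹` norm. -/
lemma sum_jap_sq_mul_le_energy {u p : Freq → ℂ} (hu : Rapid u) (hp : Rapid p) (hur : IsHermitian u)
    (s : Finset Freq) : ∑ k ∈ s, jap k ^ 2 * ‖u k‖ ^ 2 ≤ 1 + 6 * energy u p := by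
  have hus := hu.absSummable
  have hE := summable_energyTerm hu hp
  have h1 : ∑ k ∈ s, (1 / 2) * ((∑ i, (k i : ℝ) ^ 2) * ‖u k‖ ^ 2) ≤ energy u p :=
    (Finset.sum_le_sum fun k _ => by
      unfold energyTerm
      nlinarith [sq_nonneg ‖p k‖, sq_nonneg ‖conv u u k‖]).trans
      (hE.sum_le_tsum s fun k _ => energyTerm_nonneg u p k)
  have h2 : (1 / 4) * ‖conv u u 0‖ ^ 2 ≤ energy u p := by
    refine le_trans ?_ (hE.le_tsum 0 fun k _ => energyTerm_nonneg u p k)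
    simp only [energyTerm]
    have : 0 ≤ (1 / 2) * (‖p 0‖ ^ 2 + (∑ i, (((0 : Freq) i : ℤ) : ℝ) ^ 2) * ‖u 0‖ ^ 2) := by positivity
    linarith
  -- The gradient does not see the mean of u; the L² norm is recovered from the quartic term, since
  -- the zero mode of u² is ‖u‖²_{ℓ²} and a quarter of its square is below the energy.
  have h3 : conv u u 0 = ((∑' k, ‖u k‖ ^ 2 : ℝ) : ℂ) := by
    rw [← conj_mul_eq_conv hur, Complex.ofReal_tsum]
    refine tsum_congr fun k => ?_
    rw [← Complex.normSq_eq_conj_mul_self, Complex.normSq_eq_norm_sq]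
  have hsq : Summable fun k => ‖u k‖ ^ 2 :=
    Summable.of_nonneg_of_le (fun _ => by positivity)
      (fun k => by rw [sq]; exact mul_le_mul_of_nonneg_left (hus.norm_le_l1 k) (norm_nonneg _))
      (Summable.mul_right (l1 u) hus)
  have h4 : ∑ k ∈ s, ‖u k‖ ^ 2 ≤ ‖conv u u 0‖ := by
    rw [h3, Complex.norm_real]
    exact (hsq.sum_le_tsum s fun _ _ => by positivity).trans (le_abs_self _)
  simp only [jap_sq, add_mul, one_mul, Finset.sum_add_distrib]
  rw [← Finset.mul_sum] at h1
  -- With q = ‖conv u u 0‖, the bound q ≤ (1 + q²)/2 and q² ≤ 4E make the estimate affine in the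
  -- energy.
  nlinarith [sq_nonneg (‖conv u u 0‖ - 1)]

/-! ### A priori bounds and global existence for the profile -/

/-- Solutions of the profile equation keep the rapid decay of their initial value. -/
lemma rapidOn_of_solution {r r' : ℝ} (hr' : 0 ≤ r') (hrr : r' < r) {W : ℝ → L1} (h0 : Rapid (W 0))
    (hW : ∀ t ∈ Set.Ioo (-r) r, HasDerivAt W (fieldL1 t (W t)) t) :
    RapidOn (Set.Icc (-r') r') fun t => W t := by
  have hsub : Set.Icc (-r') r' ⊆ Set.Ioo (-r) r := fun t ht =>
    ⟨by linarith [ht.1], by linarith [ht.2]⟩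
  have hcont : ContinuousOn W (Set.Icc (-r') r') := fun t ht =>
    (hW t (hsub ht)).continuousAt.continuousWithinAt
  obtain ⟨M, hM⟩ := isCompact_Icc.exists_bound_of_continuousOn hcont
  have hMu : ∀ t ∈ Set.Icc (-r') r', l1 (posPart t (W t)) ≤ M := fun t ht =>
    (l1_posPart_le (W t).absSummable t).trans ((L1.norm_eq _).symm.trans_le (hM t ht))
  have hM0 : 0 ≤ M := (norm_nonneg _).trans (hM 0 ⟨by linarith, hr'⟩)
  intro m
  induction m with
  | zero =>
    refine ⟨M, fun t ht k => ?_⟩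
    rw [pow_zero, mul_one]
    exact ((W t).absSummable.norm_le_l1 k).trans ((L1.norm_eq _).symm.trans_le (hM t ht))
  | succ m ih =>
    obtain ⟨C, hC⟩ := ih
    have hC0 : 0 ≤ C := by
      refine le_trans ?_ (hC 0 ⟨by linarith, hr'⟩ 0)
      have := jap_pos 0
      positivity
    -- The gain that drives the induction: u is obtained from w by dividing by ⟨k⟩, so m powers of
    -- decay for w give m + 1 for u, hence for u - u³, and by integration in time for w.
    have hu : ∀ t ∈ Set.Icc (-r') r', ∀ k, ‖posPart t (W t) k‖ * jap k ^ (m + 1) ≤ C := by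
      intro t ht k
      have h1 := norm_jap_mul_posPart_le t (W t) k
      have h2 := hC t ht k
      have h3 := hC t ht (-k)
      rw [jap_neg] at h3
      have := pow_pos (jap_pos k) m
      rw [pow_succ]
      nlinarith
    set B := 2 ^ (m + 1) * (C * M + M * C) with hB
    set F := 2 ^ (m + 1) * (C * (M * M) + M * B) with hF
    have hf : ∀ t ∈ Set.Icc (-r') r', ∀ k,
        ‖force (posPart t (W t)) k‖ * jap k ^ (m + 1) ≤ C + F := by
      intro t ht k
      have hs := (W t).absSummable.posPart t
      have hl := hMu t ht
      have hl0 := l1_nonneg (posPart t (W t))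
      have hq : ∀ k, ‖conv (posPart t (W t)) (posPart t (W t)) k‖ * jap k ^ (m + 1) ≤ B := fun k =>
        (norm_conv_mul_jap_pow_le hs hs (hu t ht) (hu t ht) k).trans (by rw [hB]; gcongr)
      have hB0 : 0 ≤ B := by positivity
      have hcu : ‖cube (posPart t (W t)) k‖ * jap k ^ (m + 1) ≤ F :=
        (norm_conv_mul_jap_pow_le hs (hs.conv hs) (hu t ht) hq k).trans (by
          rw [hF]
          gcongr
          exact (l1_conv_le hs hs).trans (by gcongr))
      have hj := pow_pos (jap_pos k) (m + 1)
      have hsub' : ‖force (posPart t (W t)) k‖ ≤ ‖posPart t (W t) k‖ + ‖cube (posPart t (W t)) k‖ :=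
        norm_sub_le _ _
      nlinarith [hu t ht k]
    obtain ⟨C₀, hC₀⟩ := h0 (m + 1)
    refine ⟨C₀ + (C + F) * r', fun t ht k => ?_⟩
    have hj := pow_pos (jap_pos k) (m + 1)
    have hle := (convex_Icc (-r') r').norm_image_sub_le_of_norm_hasDerivWithin_le
      (f := fun s => W s k) (f' := fun s => field s (W s) k) (C := (C + F) / jap k ^ (m + 1))
      (fun s hs => (hasDerivAt_coord (hW s (hsub hs)) k).hasDerivWithinAt)
      (fun s hs => by rw [norm_field, le_div_iff₀ hj]; exact hf s hs k)
      (show (0 : ℝ) ∈ Set.Icc (-r') r' from ⟨by linarith, hr'⟩) ht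
    have htr : ‖t - 0‖ ≤ r' := by rw [sub_zero]; exact abs_le.2 ht
    have hCF : 0 ≤ C + F := (by positivity : (0 : ℝ) ≤ _).trans (hf t ht k)
    have h1 : ‖W t k‖ ≤ ‖W 0 k‖ + (C + F) / jap k ^ (m + 1) * r' := by
      have h2 : ‖W t k‖ ≤ ‖W 0 k‖ + ‖W t k - W 0 k‖ := by
        simpa using norm_add_le (W 0 k) (W t k - W 0 k)
      refine h2.trans (by gcongr; exact hle.trans (by gcongr))
    calc ‖W t k‖ * jap k ^ (m + 1)
        ≤ (‖W 0 k‖ + (C + F) / jap k ^ (m + 1) * r') * jap k ^ (m + 1) := by gcongr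
      _ = ‖W 0 k‖ * jap k ^ (m + 1) + (C + F) * r' := by field_simp
      _ ≤ C₀ + (C + F) * r' := by gcongr; exact hC₀ k

/-- Two-sided Grönwall inequality. -/
lemma norm_le_of_norm_deriv_le {E : Type*} [NormedAddCommGroup E] [NormedSpace ℝ E] {f f' : ℝ → E}
    {r K : ℝ} (hf : ∀ t ∈ Set.Ioo (-r) r, HasDerivAt f (f' t) t)
    (hK : ∀ t ∈ Set.Ioo (-r) r, ‖f' t‖ ≤ K * ‖f t‖) :
    ∀ t ∈ Set.Ioo (-r) r, ‖f t‖ ≤ ‖f 0‖ * Real.exp (K * |t|) := by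
  have key : ∀ f f' : ℝ → E, (∀ t ∈ Set.Ioo (-r) r, HasDerivAt f (f' t) t) →
      (∀ t ∈ Set.Ioo (-r) r, ‖f' t‖ ≤ K * ‖f t‖) →
      ∀ t ∈ Set.Ioo (-r) r, 0 ≤ t → ‖f t‖ ≤ ‖f 0‖ * Real.exp (K * t) := by
    intro f f' hf hK t ht h0
    have hsub : Set.Icc 0 t ⊆ Set.Ioo (-r) r := fun s hs =>
      ⟨by linarith [hs.1, ht.1, ht.2], by linarith [hs.2, ht.2]⟩
    have := norm_le_gronwallBound_of_norm_deriv_right_le (f := f) (f' := f') (δ := ‖f 0‖) (K := K)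
      (ε := 0) (a := 0) (b := t) (fun s hs => (hf s (hsub hs)).continuousAt.continuousWithinAt)
      (fun s hs => (hf s (hsub ⟨hs.1, hs.2.le⟩)).hasDerivWithinAt) le_rfl
      (fun s hs => by simpa using hK s (hsub ⟨hs.1, hs.2.le⟩)) t ⟨h0, le_rfl⟩
    simpa [gronwallBound_ε0] using this
  intro t ht
  rcases le_total 0 t with h0 | h0
  · rw [abs_of_nonneg h0]
    exact key f f' hf hK t ht h0
  · have hneg : ∀ s ∈ Set.Ioo (-r) r, -s ∈ Set.Ioo (-r) r := fun s hs =>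
      ⟨by linarith [hs.2], by linarith [hs.1]⟩
    have := key (fun s => f (-s)) (fun s => -f' (-s))
      (fun s hs => by
        simpa [Function.comp_def] using (hf (-s) (hneg s hs)).scomp s (hasDerivAt_neg s))
      (fun s hs => by simpa using hK (-s) (hneg s hs)) (-t) (hneg t ht) (by linarith)
    simpa [abs_of_nonpos h0] using this

/-- A priori bound for the profile. -/
lemma norm_le_of_solution {w₀ : L1} (h0 : Rapid w₀) {r : ℝ} {W : ℝ → L1} (hW0 : W 0 = w₀)
    (hW : ∀ t ∈ Set.Ioo (-r) r, HasDerivAt W (fieldL1 t (W t)) t) :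
    ∀ t ∈ Set.Ioo (-r) r, ‖W t‖ ≤ ‖w₀‖ *
      Real.exp ((1 + 8000 * (1 + 6 * energy (posPart 0 w₀) (velPart 0 w₀))) * |t|) := by
  set E₀ := energy (posPart 0 w₀) (velPart 0 w₀) with hE₀
  have hrapid : ∀ r', r' < r → RapidOn (Set.Ioo (-r') r') fun t => W t := fun r' hr' => by
    rcases le_or_gt 0 r' with h | h
    · exact (rapidOn_of_solution h hr' (hW0 ▸ h0) hW).mono Set.Ioo_subset_Icc_self
    · intro m
      exact ⟨0, fun t ht => by linarith [ht.1, ht.2]⟩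
  have hcoord : ∀ t ∈ Set.Ioo (-r) r, ∀ k, HasDerivAt (fun s => W s k) (field t (W t) k) t :=
    fun t ht k => hasDerivAt_coord (hW t ht) k
  have henergy : ∀ t ∈ Set.Ioo (-r) r, Rapid (W t) ∧
      energy (posPart t (W t)) (velPart t (W t)) = E₀ := by
    intro t ht
    -- Uniform rapid decay is available only on compact subintervals, so conservation is derived on
    -- a slightly smaller interval containing 0 and t.
    obtain ⟨r', h1, h2⟩ := exists_between (abs_lt.2 ht)
    have hR := hrapid r' h2
    have hmem : t ∈ Set.Ioo (-r') r' := abs_lt.1 h1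
    have hsub : ∀ s ∈ Set.Ioo (-r') r', s ∈ Set.Ioo (-r) r := fun s hs =>
      ⟨by linarith [hs.1], by linarith [hs.2]⟩
    refine ⟨hR.rapid hmem, ?_⟩
    have hd : ∀ s ∈ Set.Ioo (-r') r',
        HasDerivAt (fun s => energy (posPart s (W s)) (velPart s (W s))) 0 s := fun s hs =>
      hasDerivAt_energy hR.posPart hR.velPart (fun _ => isHermitian_posPart _ _)
        (fun _ => isHermitian_velPart _ _) (fun s hs => hasDerivAt_posPart (hcoord s (hsub s hs)))
        (fun s hs => hasDerivAt_velPart (hcoord s (hsub s hs))) hs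
    have := (convex_Ioo (-r') r').norm_image_sub_le_of_norm_hasDerivWithin_le (C := 0)
      (fun s hs => (hd s hs).hasDerivWithinAt) (fun s _ => by simp)
      (show (0 : ℝ) ∈ Set.Ioo (-r') r' by
        have := (abs_nonneg t).trans_lt h1
        exact ⟨by linarith, this⟩) hmem
    rw [zero_mul, norm_le_zero_iff, sub_eq_zero, hW0] at this
    exact this
  rw [← hW0]
  refine norm_le_of_norm_deriv_le hW fun t ht => ?_
  obtain ⟨hRt, hEt⟩ := henergy t ht
  have hS : RapidOn {t} fun s => (W s : Freq → ℂ) := fun m => by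
    obtain ⟨C, hC⟩ := hRt m
    exact ⟨C, fun s hs => by rw [Set.mem_singleton_iff.1 hs]; exact hC⟩
  have hH := sum_jap_sq_mul_le_energy (hS.posPart.rapid rfl) (hS.velPart.rapid rfl)
    (isHermitian_posPart t (W t))
  rw [hEt] at hH
  have hs := (W t).absSummable
  -- The cubic term becomes a conserved constant times ‖⟨k⟩u‖_{ℓ¹} ≤ ‖w‖_{ℓ¹}, so the growth of w is
  -- at most linear.
  have h3 := l1_pow_three_le (hs.jap_mul_posPart t) hH
  have h4 := l1_jap_mul_posPart_le hs t
  have h5 := l1_posPart_le hs t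
  have hH0 : 0 ≤ 1 + 6 * E₀ := by simpa using hH ∅
  rw [L1.norm_eq, L1.norm_eq, fieldL1, AbsSummable.coe_toL1, l1_field]
  refine (l1_force_le (hs.posPart t)).trans ?_
  have h6 : 8000 * (1 + 6 * E₀) * (l1 fun k => jap k * posPart t (W t) k) ≤
      8000 * (1 + 6 * E₀) * l1 (W t) := by gcongr
  linarith

/-- Global existence for the profile equation with rapidly decaying data. -/
theorem exists_global_profile {w₀ : L1} (h0 : Rapid w₀) :
    ∃ W : ℝ → L1, W 0 = w₀ ∧ ∀ t, HasDerivAt W (fieldL1 t (W t)) t := by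
  refine exists_global_solution continuous_fieldL1 exists_lipschitzOnWith_fieldL1
    exists_bound_fieldL1 fun T hT => ?_
  set K := 1 + 8000 * (1 + 6 * energy (posPart 0 w₀) (velPart 0 w₀)) with hK
  have hK0 : 0 ≤ K := by
    have : 0 ≤ energy (posPart 0 w₀) (velPart 0 w₀) := tsum_nonneg (energyTerm_nonneg _ _)
    positivity
  refine ⟨‖w₀‖ * Real.exp (K * T), fun r _ hrT W hW0 hW t ht => ?_⟩
  refine (norm_le_of_solution h0 hW0 hW t ht).trans ?_
  have : |t| ≤ T := (abs_lt.2 ht).le.trans hrT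
  gcongr

/-! ### Fourier synthesis -/

/-- The linear form `x ↦ k · x`. -/
def phase (k : Freq) : Space →L[ℝ] ℝ := ∑ i, (k i : ℝ) • EuclideanSpace.proj i

lemma phase_apply (k : Freq) (x : Space) : phase k x = ∑ i, (k i : ℝ) * x i := by
  simp [phase]

/-- The character `x ↦ e^{i k·x}`. -/
def character (k : Freq) (x : Space) : ℂ := Complex.exp (Complex.I * (phase k x : ℝ))

lemma norm_character (k : Freq) (x : Space) : ‖character k x‖ = 1 := norm_exp_I_mul _

lemma character_add (j l : Freq) (x : Space) :
    character (j + l) x = character j x * character l x := by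
  rw [character, character, character, ← Complex.exp_add, ← mul_add, ← Complex.ofReal_add]
  congr 3
  simp only [phase_apply, ← Finset.sum_add_distrib]
  exact Finset.sum_congr rfl fun i _ => by simp; ring

lemma character_neg (k : Freq) (x : Space) : character (-k) x = starRingEnd ℂ (character k x) := by
  rw [character, character, ← Complex.exp_conj]
  congr 1
  simp [phase_apply]

/-- The function with Fourier coefficients `a`. -/
def synth (a : Freq → ℂ) (x : Space) : ℂ := ∑' k, a k * character k x

lemma AbsSummable.mul_character {a : Freq → ℂ} (ha : AbsSummable a) (x : Space) :
    AbsSummable fun k => a k * character k x :=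
  ha.of_le fun k => by rw [norm_mul, norm_character, mul_one]

lemma synth_sub {a b : Freq → ℂ} (ha : AbsSummable a) (hb : AbsSummable b) (x : Space) :
    synth (a - b) x = synth a x - synth b x := by
  simp only [synth, Pi.sub_apply, sub_mul]
  exact Summable.tsum_sub (ha.mul_character x).of_norm (hb.mul_character x).of_norm

lemma synth_conv {a b : Freq → ℂ} (ha : AbsSummable a) (hb : AbsSummable b) (x : Space) :
    synth (conv a b) x = synth a x * synth b x := by
  rw [synth, synth, synth, ← tsum_conv (ha.mul_character x) (hb.mul_character x)]
  refine tsum_congr fun k => ?_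
  rw [conv, conv, ← tsum_mul_right]
  refine tsum_congr fun j => ?_
  have : character k x = character j x * character (k - j) x := by
    rw [← character_add, add_sub_cancel]
  rw [this]
  ring

lemma synth_cube {a : Freq → ℂ} (ha : AbsSummable a) (x : Space) :
    synth (cube a) x = synth a x ^ 3 := by
  rw [cube, synth_conv ha (ha.conv ha), synth_conv ha ha]
  ring

lemma IsHermitian.ofReal_re_synth {a : Freq → ℂ} (ha : IsHermitian a) (x : Space) :
    (((synth a x).re : ℝ) : ℂ) = synth a x := by
  rw [← Complex.conj_eq_iff_re, synth, Complex.conj_tsum]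
  rw [← (Equiv.neg Freq).tsum_eq fun k => a k * character k x]
  refine tsum_congr fun k => ?_
  rw [Equiv.neg_apply, ha k, character_neg, map_mul]

/-! ### Smoothness -/

/-- Locally uniform rapid decay. -/
def LocRapid (a : ℝ → Freq → ℂ) : Prop := ∀ T : ℝ, RapidOn (Set.Ioo (-T) T) a

lemma LocRapid.rapid {a : ℝ → Freq → ℂ} (h : LocRapid a) (t : ℝ) : Rapid (a t) :=
  (h (|t| + 1)).rapid (abs_lt.1 (lt_add_one _))

lemma LocRapid.absSummable {a : ℝ → Freq → ℂ} (h : LocRapid a) (t : ℝ) : AbsSummable (a t) :=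
  (h.rapid t).absSummable

lemma Rapid.locRapid {a : Freq → ℂ} (h : Rapid a) : LocRapid fun _ => a := fun _ m => by
  obtain ⟨C, hC⟩ := h m
  exact ⟨C, fun _ _ => hC⟩

/-- The coefficients of `∂ⱼf`. -/
def coordDeriv (j : Fin 3) (a : Freq → ℂ) : Freq → ℂ := fun k => Complex.I * (k j : ℝ) * a k

lemma norm_coordDeriv_le (j : Fin 3) (a : Freq → ℂ) (k : Freq) :
    ‖coordDeriv j a k‖ ≤ 1 * jap k ^ 1 * ‖a k‖ := by
  rw [coordDeriv, norm_mul, norm_mul, Complex.norm_I, one_mul, one_mul, pow_one, Complex.norm_real]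
  gcongr
  exact abs_le_jap k j

lemma LocRapid.coordDeriv {a : ℝ → Freq → ℂ} (h : LocRapid a) (j : Fin 3) :
    LocRapid fun t => coordDeriv j (a t) := fun T =>
  (h T).of_norm_le 1 1 fun t _ k => norm_coordDeriv_le j (a t) k

/-- The candidate for the derivative of `(t, x) ↦ synth (a t) x`, where `b = ∂ₜa`. -/
def synthDeriv (a b : ℝ → Freq → ℂ) (p : ℝ × Space) : ℝ × Space →L[ℝ] ℂ :=
  (ContinuousLinearMap.fst ℝ ℝ Space).smulRight (synth (b p.1) p.2) +
    ∑ j, ((EuclideanSpace.proj j : Space →L[ℝ] ℝ).comp (ContinuousLinearMap.snd ℝ ℝ Space)).smulRight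
      (synth (coordDeriv j (a p.1)) p.2)

lemma norm_proj_comp_snd_le (j : Fin 3) :
    ‖(EuclideanSpace.proj j : Space →L[ℝ] ℝ).comp (ContinuousLinearMap.snd ℝ ℝ Space)‖ ≤ 1 := by
  refine ContinuousLinearMap.opNorm_le_bound _ zero_le_one fun p => ?_
  rw [one_mul]
  exact (PiLp.norm_apply_le p.2 j).trans (norm_snd_le p)

/-- Termwise differentiation on the slab |t| < |p.1| + 1, where rapid decay of b and of the families
ikⱼa bounds the derivatives by a summable sequence independent of the point. -/
lemma hasFDerivAt_synth {a b : ℝ → Freq → ℂ} (ha : LocRapid a) (hb : LocRapid b)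
    (hab : ∀ t k, HasDerivAt (fun s => a s k) (b t k) t) (p : ℝ × Space) :
    HasFDerivAt (fun q : ℝ × Space => synth (a q.1) q.2) (synthDeriv a b p) p := by
  set T := |p.1| + 1
  set s : Set (ℝ × Space) := Set.Ioo (-T) T ×ˢ Set.univ
  have hp : p ∈ s := ⟨abs_lt.1 (lt_add_one _), trivial⟩
  obtain ⟨g, hg, hbg⟩ := (hb T).exists_summable_bound
  choose G hG hGb using fun j => (ha.coordDeriv j T).exists_summable_bound
  set f' : Freq → ℝ × Space → ℝ × Space →L[ℝ] ℂ := fun k q =>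
    (ContinuousLinearMap.fst ℝ ℝ Space).smulRight (b q.1 k * character k q.2) +
    ∑ j, ((EuclideanSpace.proj j : Space →L[ℝ] ℝ).comp (ContinuousLinearMap.snd ℝ ℝ Space)).smulRight
      (coordDeriv j (a q.1) k * character k q.2) with hf'
  have hterm : ∀ k q, q ∈ s →
      HasFDerivAt (fun q : ℝ × Space => a q.1 k * character k q.2) (f' k q) q := by
    intro k q _
    have h1 : HasFDerivAt (fun q : ℝ × Space => a q.1 k)
        ((ContinuousLinearMap.fst ℝ ℝ Space).smulRight (b q.1 k)) q := by
      refine ((hab q.1 k).hasFDerivAt.comp q hasFDerivAt_fst).congr_fderiv ?_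
      ext v <;> simp
    have h2 : HasFDerivAt (fun q : ℝ × Space => character k q.2)
        (character k q.2 • (Complex.I • (Complex.ofRealCLM.comp
          ((phase k).comp (ContinuousLinearMap.snd ℝ ℝ Space))))) q :=
      (((Complex.ofRealCLM.comp ((phase k).comp (ContinuousLinearMap.snd ℝ ℝ Space))).hasFDerivAt
        (x := q)).const_mul Complex.I).cexp
    refine (h1.mul h2).congr_fderiv ?_
    ext v
    · simp [hf', mul_comm]
    · simp [hf', coordDeriv, phase_apply, Fin.sum_univ_three]
      ring
  have hbound : ∀ k q, q ∈ s → ‖f' k q‖ ≤ g k + ∑ j, G j k := by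
    intro k q hq
    refine (norm_add_le _ _).trans (add_le_add ?_ ((norm_sum_le _ _).trans (Finset.sum_le_sum ?_)))
    · rw [ContinuousLinearMap.norm_smulRight_apply, norm_mul, norm_character, mul_one]
      refine (mul_le_of_le_one_left (norm_nonneg _)
        (ContinuousLinearMap.norm_fst_le ℝ ℝ Space)).trans ?_
      exact hbg q.1 hq.1 k
    · intro j _
      rw [ContinuousLinearMap.norm_smulRight_apply, norm_mul, norm_character, mul_one]
      exact (mul_le_of_le_one_left (norm_nonneg _) (norm_proj_comp_snd_le j)).trans (hGb j q.1 hq.1 k)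
  have key := hasFDerivAt_tsum_of_isPreconnected (hg.add (summable_sum fun j _ => hG j))
    (isOpen_Ioo.prod isOpen_univ) (isPreconnected_Ioo.prod isPreconnected_univ) hterm hbound hp
    ((ha.absSummable p.1).mul_character p.2).of_norm hp
  refine key.congr_fderiv ?_
  have hsm : ∀ (L : ℝ × Space →L[ℝ] ℝ) (c : Freq → ℂ), AbsSummable c →
      HasSum (fun k => L.smulRight (c k * character k p.2)) (L.smulRight (synth c p.2)) := by
    intro L c hc
    have h := (hc.mul_character p.2).of_norm.hasSum
    exact (ContinuousLinearMap.smulRightL ℝ (ℝ × Space) ℂ L).hasSum h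
  exact ((hsm _ _ (hb.absSummable p.1)).add
    (hasSum_sum fun j _ => hsm _ _ ((ha.coordDeriv j).absSummable p.1))).tsum_eq

/-- Families with `n` time derivatives, all rapidly decaying locally uniformly in time. -/
def Nice : ℕ → (ℝ → Freq → ℂ) → Prop
  | 0, a => LocRapid a
  | n + 1, a => LocRapid a ∧ ∃ b, (∀ t k, HasDerivAt (fun s => a s k) (b t k) t) ∧ Nice n b

lemma Nice.locRapid : ∀ {n : ℕ} {a : ℝ → Freq → ℂ}, Nice n a → LocRapid a
  | 0, _, h => h
  | _ + 1, _, h => h.1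

lemma Nice.of_succ : ∀ {n : ℕ} {a : ℝ → Freq → ℂ}, Nice (n + 1) a → Nice n a
  | 0, _, h => h.1
  | _ + 1, _, ⟨h, b, hb, hn⟩ => ⟨h, b, hb, hn.of_succ⟩

lemma Nice.add : ∀ {n : ℕ} {a b : ℝ → Freq → ℂ}, Nice n a → Nice n b → Nice n fun t => a t + b t
  | 0, _, _, ha, hb => fun T => (ha T).add (hb T)
  | _ + 1, _, _, ⟨ha, a', ha', hna⟩, ⟨hb, b', hb', hnb⟩ =>
    ⟨fun T => (ha T).add (hb T), fun t => a' t + b' t, fun t k => (ha' t k).add (hb' t k), hna.add hnb⟩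

lemma Nice.mul_left {μ : Freq → ℂ} {M : ℝ} {d : ℕ} (hμ : ∀ k, ‖μ k‖ ≤ M * jap k ^ d) :
    ∀ {n : ℕ} {a : ℝ → Freq → ℂ}, Nice n a → Nice n fun t k => μ k * a t k
  | 0, _, ha => fun T => (ha T).of_norm_le d M fun t _ k => by
      rw [norm_mul]; exact mul_le_mul_of_nonneg_right (hμ k) (norm_nonneg _)
  | _ + 1, _, ⟨ha, a', ha', hna⟩ =>
    ⟨fun T => (ha T).of_norm_le d M fun t _ k => by
      rw [norm_mul]; exact mul_le_mul_of_nonneg_right (hμ k) (norm_nonneg _),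
      fun t k => μ k * a' t k, fun t k => (ha' t k).const_mul _, hna.mul_left hμ⟩

lemma Nice.coordDeriv {n : ℕ} {a : ℝ → Freq → ℂ} (ha : Nice n a) (j : Fin 3) :
    Nice n fun t => coordDeriv j (a t) :=
  ha.mul_left (M := 1) (d := 1) fun k => by
    rw [norm_mul, Complex.norm_I, one_mul, one_mul, pow_one, Complex.norm_real]
    exact abs_le_jap k j

lemma Nice.conv : ∀ {n : ℕ} {a b : ℝ → Freq → ℂ}, Nice n a → Nice n b →
    Nice n fun t => conv (a t) (b t)
  | 0, _, _, ha, hb => fun T => (ha T).conv (hb T)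
  | _ + 1, _, _, hA@⟨ha, _, ha', hna⟩, hB@⟨hb, _, hb', hnb⟩ =>
    ⟨fun T => (ha T).conv (hb T), _, fun t k =>
      hasDerivAt_conv (ha _) (hb _) (hna.locRapid _) (hnb.locRapid _) (fun t _ => ha' t)
        (fun t _ => hb' t) (abs_lt.1 (lt_add_one |t|)) k,
      (hna.conv hB.of_succ).add (hA.of_succ.conv hnb)⟩

/-- The partial derivatives are again syntheses, of b and of the families ikⱼa, each with one time
derivative fewer. The extra unit in `Nice (n + 1)` pays for the base case, where continuity comes
from differentiability. -/
lemma contDiff_synth : ∀ {n : ℕ} {a : ℝ → Freq → ℂ}, Nice (n + 1) a →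
    ContDiff ℝ n fun p : ℝ × Space => synth (a p.1) p.2
  | 0, _, ⟨ha, _, hb, hnb⟩ => by
    rw [Nat.cast_zero, contDiff_zero, continuous_iff_continuousAt]
    exact fun p => (hasFDerivAt_synth ha hnb.locRapid hb p).continuousAt
  | n + 1, a, ⟨ha, b, hb, hnb⟩ => by
    rw [Nat.cast_add, Nat.cast_one, contDiff_succ_iff_hasFDerivAt]
    refine ⟨synthDeriv a b, ?_, fun p => hasFDerivAt_synth ha hnb.locRapid hb p⟩
    refine ContDiff.add (contDiff_const.smulRight (contDiff_synth hnb)) (ContDiff.sum fun j _ => ?_)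
    exact contDiff_const.smulRight
      (contDiff_synth (Nice.coordDeriv (Nice.of_succ (n := n + 1) ⟨ha, b, hb, hnb⟩) j))

lemma hasDerivAt_synth {a b : ℝ → Freq → ℂ} (ha : LocRapid a) (hb : LocRapid b)
    (hab : ∀ t k, HasDerivAt (fun s => a s k) (b t k) t) (t : ℝ) (x : Space) :
    HasDerivAt (fun s => synth (a s) x) (synth (b t) x) t := by
  have h := (hasFDerivAt_synth ha hb hab (t, x)).comp_hasDerivAt t
    ((hasDerivAt_id t).prodMk (hasDerivAt_const t x))
  refine h.congr_deriv ?_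
  simp [synthDeriv]

lemma hasFDerivAt_re_synth {a : Freq → ℂ} (ha : Rapid a) (x : Space) :
    HasFDerivAt (fun y => (synth a y).re) (∑ j, (EuclideanSpace.proj j : Space →L[ℝ] ℝ).smulRight
      (synth (coordDeriv j a) x).re) x := by
  have h0 : LocRapid fun _ => (0 : Freq → ℂ) := fun T m => ⟨0, fun t _ k => by simp⟩
  have h := (hasFDerivAt_synth ha.locRapid h0 (fun t k => hasDerivAt_const t (a k)) (0, x)).comp x
    ((hasFDerivAt_const (0 : ℝ) x).prodMk (hasFDerivAt_id x))
  refine (Complex.reCLM.hasFDerivAt.comp x h).congr_fderiv ?_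
  ext v
  simp [synthDeriv, synth]

lemma laplacian_re_synth {a : Freq → ℂ} (ha : Rapid a) (x : Space) :
    Δ (fun y => (synth a y).re) x =
      (synth (fun k => -((∑ i, (k i : ℝ) ^ 2 : ℝ) : ℂ) * a k) x).re := by
  have hD : ∀ j, Rapid (coordDeriv j a) := fun j => ha.of_norm_le 1 1 (norm_coordDeriv_le j a)
  have hDD : ∀ j, Rapid (coordDeriv j (coordDeriv j a)) := fun j =>
    (hD j).of_norm_le 1 1 (norm_coordDeriv_le j _)
  have h1 : fderiv ℝ (fun y => (synth a y).re) = fun y =>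
      ∑ j, (EuclideanSpace.proj j : Space →L[ℝ] ℝ).smulRight (synth (coordDeriv j a) y).re :=
    funext fun y => (hasFDerivAt_re_synth ha y).fderiv
  have h2 : HasFDerivAt (fun y => ∑ j, (EuclideanSpace.proj j : Space →L[ℝ] ℝ).smulRight
      (synth (coordDeriv j a) y).re) (∑ j, (ContinuousLinearMap.smulRightL ℝ Space ℝ
        (EuclideanSpace.proj j : Space →L[ℝ] ℝ)).comp
        (∑ l, (EuclideanSpace.proj l : Space →L[ℝ] ℝ).smulRight
          (synth (coordDeriv l (coordDeriv j a)) x).re)) x :=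
    HasFDerivAt.fun_sum fun j _ => (ContinuousLinearMap.smulRightL ℝ Space ℝ
        (EuclideanSpace.proj j : Space →L[ℝ] ℝ)).hasFDerivAt.comp x (hasFDerivAt_re_synth (hD j) x)
  rw [InnerProductSpace.laplacian_eq_iteratedFDeriv_orthonormalBasis _
    (EuclideanSpace.basisFun (Fin 3) ℝ)]
  simp only [iteratedFDeriv_two_apply, h1, h2.fderiv]
  have h3 : ∀ i : Fin 3, (∑ j, (ContinuousLinearMap.smulRightL ℝ Space ℝ
        (EuclideanSpace.proj j : Space →L[ℝ] ℝ)).comp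
        (∑ l, (EuclideanSpace.proj l : Space →L[ℝ] ℝ).smulRight
          (synth (coordDeriv l (coordDeriv j a)) x).re)) (EuclideanSpace.basisFun (Fin 3) ℝ i)
          (EuclideanSpace.basisFun (Fin 3) ℝ i) = (synth (coordDeriv i (coordDeriv i a)) x).re := by
    intro i
    simp
  simp only [Matrix.cons_val_zero, Matrix.cons_val_one, h3]
  rw [← Complex.re_sum]
  congr 1
  simp only [synth]
  rw [← Summable.tsum_finsetSum fun j _ => ((hDD j).absSummable.mul_character x).of_norm]
  refine tsum_congr fun k => ?_
  rw [← Finset.sum_mul]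
  congr 1
  simp only [coordDeriv, Fin.sum_univ_three]
  push_cast
  linear_combination ((k 0 : ℂ) ^ 2 + (k 1 : ℂ) ^ 2 + (k 2 : ℂ) ^ 2) * a k * Complex.I_sq

lemma periodic_character (k : Freq) (i : Fin 3) :
    Function.Periodic (character k) (EuclideanSpace.single i (2 * Real.pi)) := by
  intro x
  rw [character, character, Complex.exp_eq_exp_iff_exists_int]
  refine ⟨k i, ?_⟩
  rw [map_add, phase_apply k (EuclideanSpace.single i _)]
  simp
  ring

lemma isPeriodic_re_synth (a : Freq → ℂ) : IsPeriodic fun x => (synth a x).re := by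
  intro i x
  simp only [synth, periodic_character _ i x]

/-! ### Global smooth solutions -/

/-- The profile with initial position `f` and initial velocity `g`. -/
def initialProfile (f g : Freq → ℂ) : Freq → ℂ := fun k => jap k * f k + Complex.I * g k

lemma norm_initialProfile_le (f g : Freq → ℂ) (k : Freq) :
    ‖initialProfile f g k‖ ≤ jap k * ‖f k‖ + ‖g k‖ := by
  refine (norm_add_le _ _).trans_eq ?_
  rw [norm_mul, norm_mul, Complex.norm_I, one_mul, Complex.norm_real,
    Real.norm_of_nonneg (jap_pos k).le]

lemma Rapid.initialProfile {f g : Freq → ℂ} (hf : Rapid f) (hg : Rapid g) :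
    Rapid (initialProfile f g) :=
  (hf.of_norm_le (a := fun k => jap k * f k) 1 1 fun k => by
    rw [norm_mul, Complex.norm_real, Real.norm_of_nonneg (jap_pos k).le]; simp).add
  (hg.of_norm_le (a := fun k => Complex.I * g k) 0 1 fun k => by simp)

lemma posPart_initialProfile {f g : Freq → ℂ} (hf : IsHermitian f) (hg : IsHermitian g) :
    posPart 0 (initialProfile f g) = f := by
  ext k
  have hj : (jap k : ℂ) ≠ 0 := by exact_mod_cast (jap_pos k).ne'
  simp only [posPart, unwind, initialProfile, hf k, hg k, zero_mul, jap_neg, map_add, map_mul,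
    Complex.conj_ofReal, Complex.conj_conj, Complex.conj_I, Complex.ofReal_zero, mul_zero, neg_zero,
    Complex.exp_zero, one_mul]
  push_cast
  field_simp
  ring

lemma velPart_initialProfile {f g : Freq → ℂ} (hf : IsHermitian f) (hg : IsHermitian g) :
    velPart 0 (initialProfile f g) = g := by
  ext k
  simp only [velPart, unwind, initialProfile, hf k, hg k, zero_mul, jap_neg, map_add, map_mul,
    Complex.conj_ofReal, Complex.conj_conj, Complex.conj_I, Complex.ofReal_zero, mul_zero, neg_zero,
    Complex.exp_zero, one_mul]
  rw [div_eq_iff (by simp)]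
  ring

lemma locRapid_of_solution {W : ℝ → L1} (h0 : Rapid (W 0))
    (hW : ∀ t, HasDerivAt W (fieldL1 t (W t)) t) : LocRapid fun t => W t := fun T => by
  have := rapidOn_of_solution (abs_nonneg T) (lt_add_one |T|) h0 fun t _ => hW t
  refine this.mono fun t ht => ⟨?_, ?_⟩
  · linarith [ht.1, le_abs_self T]
  · linarith [ht.2, le_abs_self T]

/-- The time derivative of (u, p) is (p, -|k|²u - u³), built from the pair by a polynomial
multiplier and convolutions. `Nice n` is stable under both, so the induction closes on the pair. -/
lemma nice_of_solution {W : ℝ → L1} (h0 : Rapid (W 0))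
    (hW : ∀ t, HasDerivAt W (fieldL1 t (W t)) t) (n : ℕ) :
    Nice n (fun t => posPart t (W t)) ∧ Nice n fun t => velPart t (W t) := by
  have hR := locRapid_of_solution h0 hW
  have hcoord : ∀ t k, HasDerivAt (fun s => W s k) (field t (W t) k) t :=
    fun t k => hasDerivAt_coord (hW t) k
  have hu : LocRapid fun t => posPart t (W t) := fun T => (hR T).posPart
  have hp : LocRapid fun t => velPart t (W t) := fun T => (hR T).velPart
  induction n with
  | zero => exact ⟨hu, hp⟩
  | succ n ih =>
    refine ⟨⟨hu, _, fun t => hasDerivAt_posPart (hcoord t), ih.2⟩,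
      ⟨hp, _, fun t => hasDerivAt_velPart (hcoord t), ?_⟩⟩
    have h1 := ih.1.mul_left (μ := fun k => -((∑ i, (k i : ℝ) ^ 2 : ℝ) : ℂ)) (M := 1) (d := 2)
      fun k => by
        rw [norm_neg, Complex.norm_real, Real.norm_of_nonneg (by positivity), one_mul]
        exact sum_sq_le_jap_sq k
    have h2 := (ih.1.conv (ih.1.conv ih.1)).mul_left (μ := fun _ => -1) (M := 1) (d := 0)
      fun k => by simp
    have h3 := h1.add h2
    convert h3 using 3 with t k
    simp [cube, sub_eq_add_neg]

lemma timeDeriv_re_synth {W : ℝ → L1} (h0 : Rapid (W 0))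
    (hW : ∀ t, HasDerivAt W (fieldL1 t (W t)) t) (t : ℝ) :
    timeDeriv (fun t x => (synth (posPart t (W t)) x).re) t =
      fun x => (synth (velPart t (W t)) x).re := by
  obtain ⟨hu, hp⟩ := nice_of_solution h0 hW 0
  ext x
  have h := hasDerivAt_synth hu hp
    (fun t => hasDerivAt_posPart fun k => hasDerivAt_coord (hW t) k) t x
  exact (Complex.reCLM.hasFDerivAt.comp_hasDerivAt t h).deriv

/-- The function synthesized from a global profile is a global smooth solution. -/
theorem isSmoothGlobalSolution_of_solution {W : ℝ → L1} (h0 : Rapid (W 0))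
    (hW : ∀ t, HasDerivAt W (fieldL1 t (W t)) t) :
    IsSmoothGlobalSolution fun t x => (synth (posPart t (W t)) x).re where
  periodic t := isPeriodic_re_synth _
  smooth := by
    have h : ContDiff ℝ ∞ fun p : ℝ × Space => synth (posPart p.1 (W p.1)) p.2 :=
      contDiff_infty.2 fun n => contDiff_synth (nice_of_solution h0 hW (n + 1)).1
    exact Complex.reCLM.contDiff.comp h
  equation t x := by
    obtain ⟨hu, hp⟩ := nice_of_solution h0 hW 0
    obtain ⟨_, b, hb, hnb⟩ := (nice_of_solution h0 hW 1).2
    have hcoord : ∀ t k, HasDerivAt (fun s => W s k) (field t (W t) k) t :=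
      fun t k => hasDerivAt_coord (hW t) k
    have hbt : b t = (fun k => -((∑ i, (k i : ℝ) ^ 2 : ℝ) : ℂ) * posPart t (W t) k) -
        cube (posPart t (W t)) := by
      ext k
      exact (hb t k).unique (hasDerivAt_velPart (hcoord t) k)
    have h1 : deriv (fun τ => (synth (posPart τ (W τ)) x).re) =
        fun τ => (synth (velPart τ (W τ)) x).re := by
      ext τ
      exact congrFun (timeDeriv_re_synth h0 hW τ) x
    have h2 := (Complex.reCLM.hasFDerivAt.comp_hasDerivAt t (hasDerivAt_synth hp hnb hb t x)).deriv
    have hus := (hu.rapid t).absSummable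
    have hlap : AbsSummable fun k => -((∑ i, (k i : ℝ) ^ 2 : ℝ) : ℂ) * posPart t (W t) k :=
      ((hu.rapid t).of_norm_le 2 1 fun k => by
        rw [norm_mul, norm_neg, Complex.norm_real, Real.norm_of_nonneg (by positivity), one_mul]
        gcongr
        exact sum_sq_le_jap_sq k).absSummable
    have h3 : iteratedDeriv 2 (fun τ => (synth (posPart τ (W τ)) x).re) t =
        (synth (b t) x).re := by
      rw [iteratedDeriv_succ, iteratedDeriv_one, h1]
      exact h2
    -- Since the synthesis is real, the real part of its cube is the cube of its real part.
    have hre := (isHermitian_posPart t (W t)).ofReal_re_synth x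
    rw [h3, laplacian_re_synth (hu.rapid t), hbt, synth_sub hlap hus.cube, synth_cube hus,
      ← hre, Complex.sub_re, ← Complex.ofReal_pow, Complex.ofReal_re, Complex.ofReal_re]
    ring

/-! ### Integration over the fundamental cell -/

lemma toLp_preimage_cell :
    (WithLp.toLp 2 : (Fin 3 → ℝ) → Space) ⁻¹' cell = Set.Icc 0 (fun _ => 2 * Real.pi) := by
  ext y
  simp only [cell, Set.mem_preimage, Set.mem_ofPred_eq, Set.mem_Icc, Pi.le_def]
  exact ⟨fun h => ⟨fun i => (h i).1, fun i => (h i).2⟩, fun h i => ⟨h.1 i, h.2 i⟩⟩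

lemma isCompact_cell : IsCompact cell := by
  have h : cell = (WithLp.toLp 2 : (Fin 3 → ℝ) → Space) '' Set.Icc 0 (fun _ => 2 * Real.pi) := by
    rw [← toLp_preimage_cell, Set.image_preimage_eq _ (WithLp.toLp_surjective 2)]
  rw [h]
  exact isCompact_Icc.image (PiLp.continuous_toLp 2 _)

lemma setIntegral_cell (H : Space → ℂ) :
    ∫ x in cell, H x =
      ∫ y in Set.Icc (0 : Fin 3 → ℝ) (fun _ => 2 * Real.pi), H (WithLp.toLp 2 y) := by
  rw [← toLp_preimage_cell]
  exact ((PiLp.volume_preserving_toLp (Fin 3)).setIntegral_preimage_emb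
    (MeasurableEquiv.toLp 2 (Fin 3 → ℝ)).measurableEmbedding H cell).symm

lemma volume_real_cell : volume.real cell = (2 * Real.pi) ^ 3 := by
  rw [Measure.real, ← (PiLp.volume_preserving_toLp (Fin 3)).measure_preimage
    isCompact_cell.measurableSet.nullMeasurableSet, toLp_preimage_cell, Real.volume_Icc_pi]
  simp [Real.pi_nonneg]

/-- The `j`-th coordinate vector. -/
abbrev axis (j : Fin 3) : Space := EuclideanSpace.single j 1

/-- The integral over the cell of a partial derivative of a periodic function vanishes. -/
lemma setIntegral_cell_fderiv_eq_zero {F : Space → ℂ} (hF : ContDiff ℝ 1 F) (j : Fin 3)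
    (hper : Function.Periodic F (EuclideanSpace.single j (2 * Real.pi))) :
    ∫ x in cell, fderiv ℝ F x (axis j) = 0 := by
  set e : (Fin 3 → ℝ) ≃L[ℝ] Space :=
    (PiLp.continuousLinearEquiv 2 ℝ fun _ : Fin 3 => ℝ).symm with he
  have hcF : Continuous (fderiv ℝ F) := hF.continuous_fderiv (by norm_num)
  have hd : ∀ y, HasFDerivAt (fun y => F (e y))
      ((fderiv ℝ F (e y)).comp (e : (Fin 3 → ℝ) →L[ℝ] Space)) y :=
    fun y => ((hF.differentiable (by norm_num)) (e y)).hasFDerivAt.comp y e.hasFDerivAt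
  have hsum : ∀ y, ∑ i, (if i = j then (fderiv ℝ F (e y)).comp (e : (Fin 3 → ℝ) →L[ℝ] Space) else 0)
      (Pi.single i 1) = fderiv ℝ F (e y) (axis j) := fun y => by
    rw [Finset.sum_eq_single j (fun i _ hi => by simp [hi]) (by simp)]
    simp only [if_true, ContinuousLinearMap.comp_apply]
    rfl
  have hcont : Continuous fun y => fderiv ℝ F (e y) (axis j) :=
    (hcF.comp e.continuous).clm_apply continuous_const
  -- Divergence theorem for the field whose only nonzero component is the j-th, equal to F;
  -- periodicity cancels the two opposite faces.
  have key := integral_divergence_of_hasFDerivAt_off_countable' (n := 2) (E := ℂ) 0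
    (fun _ => 2 * Real.pi) (fun i => by simp [Real.pi_nonneg])
    (fun i y => if i = j then F (e y) else 0)
    (fun i y => if i = j then (fderiv ℝ F (e y)).comp (e : (Fin 3 → ℝ) →L[ℝ] Space) else 0) ∅
    Set.countable_empty
    (fun i => by
      by_cases h : i = j
      · simp only [h, if_true]; exact (hF.continuous.comp e.continuous).continuousOn
      · simp only [h, if_false]; exact continuousOn_const)
    (fun y _ i => by
      by_cases h : i = j
      · simp only [h, if_true]; exact hd y
      · simp only [h, if_false]; exact hasFDerivAt_const _ _)
    (by
      simp only [hsum]
      exact hcont.continuousOn.integrableOn_compact isCompact_Icc)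
  simp only [hsum] at key
  rw [setIntegral_cell]
  refine Eq.trans key (Finset.sum_eq_zero fun i _ => ?_)
  by_cases h : i = j
  · subst h
    simp only [if_true]
    rw [sub_eq_zero]
    refine setIntegral_congr_fun measurableSet_Icc fun x _ => ?_
    have : e (i.insertNth (2 * Real.pi) x) = e (i.insertNth 0 x) +
        EuclideanSpace.single i (2 * Real.pi) := by
      ext l
      change i.insertNth (α := fun _ => ℝ) (2 * Real.pi) x l = i.insertNth (α := fun _ => ℝ) 0 x l + _
      refine Fin.succAboveCases i ?_ (fun m => ?_) l
      · simp
      · simp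
    simp only [Pi.zero_apply]
    rw [this]
    exact hper _
  · simp [h]

lemma contDiff_character (k : Freq) : ContDiff ℝ ∞ (character k) :=
  Complex.contDiff_exp.comp
    (contDiff_const.mul (Complex.ofRealCLM.contDiff.comp (phase k).contDiff))

lemma hasFDerivAt_character (k : Freq) (x : Space) : HasFDerivAt (character k)
    (character k x • (Complex.I • (Complex.ofRealCLM.comp (phase k)))) x :=
  (((Complex.ofRealCLM.comp (phase k)).hasFDerivAt (x := x)).const_mul Complex.I).cexp

lemma phase_axis (k : Freq) (j : Fin 3) : phase k (axis j) = k j := by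
  simp [phase_apply, axis]

lemma fderiv_character_axis (k : Freq) (x : Space) (j : Fin 3) :
    fderiv ℝ (character k) x (axis j) = Complex.I * (k j : ℝ) * character k x := by
  rw [(hasFDerivAt_character k x).fderiv]
  simp [phase_axis]
  ring

/-- If kⱼ ≠ 0, the character is a multiple of its own j-th partial derivative, which integrates to
zero. -/
lemma setIntegral_character (k : Freq) :
    ∫ x in cell, character k x = if k = 0 then ((2 * Real.pi : ℝ) : ℂ) ^ 3 else 0 := by
  split_ifs with h
  · have : ∀ x, character 0 x = 1 := fun x => by simp [character, phase_apply]
    subst h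
    simp only [this, setIntegral_const, volume_real_cell]
    simp
  · obtain ⟨j, hj⟩ := Function.ne_iff.1 h
    have h1 := setIntegral_cell_fderiv_eq_zero ((contDiff_character k).of_le (by simp)) j
      (periodic_character k j)
    simp only [fderiv_character_axis] at h1
    rw [integral_const_mul] at h1
    have hjne : (Complex.I * ((k j : ℝ) : ℂ)) ≠ 0 := by
      simpa using hj
    exact (mul_eq_zero.1 h1).resolve_left hjne

/-! ### Fourier coefficients -/

lemma fourierCoeff_eq (f : Space → ℝ) (k : Freq) : fourierCoeff f k =
    (1 / (2 * (Real.pi : ℂ)) ^ 3) * ∫ x in cell, (f x : ℂ) * character (-k) x := by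
  rw [fourierCoeff]
  congr 2
  ext x
  rw [character]
  congr 3
  simp [phase_apply]

lemma norm_one_div_two_pi_pow : ‖(1 / (2 * (Real.pi : ℂ)) ^ 3)‖ * (2 * Real.pi) ^ 3 = 1 := by
  have := Real.pi_pos
  simp [abs_of_pos this]

lemma continuous_ofReal_mul_character {f : Space → ℝ} (hf : Continuous f) (k : Freq) :
    Continuous fun x => (f x : ℂ) * character k x :=
  (Complex.continuous_ofReal.comp hf).mul (contDiff_character k).continuous

lemma fourierCoeff_sub {f g : Space → ℝ} (hf : Continuous f) (hg : Continuous g) (k : Freq) :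
    fourierCoeff (f - g) k = fourierCoeff f k - fourierCoeff g k := by
  rw [fourierCoeff_eq, fourierCoeff_eq, fourierCoeff_eq, ← mul_sub, ← integral_sub]
  · congr 2
    ext x
    simp [sub_mul]
  · exact (continuous_ofReal_mul_character hf _).continuousOn.integrableOn_compact isCompact_cell
  · exact (continuous_ofReal_mul_character hg _).continuousOn.integrableOn_compact isCompact_cell

lemma exists_norm_fourierCoeff_le {f : Space → ℝ} (hf : Continuous f) :
    ∃ C, ∀ k, ‖fourierCoeff f k‖ ≤ C := by
  obtain ⟨C, hC⟩ := isCompact_cell.exists_bound_of_continuousOn hf.continuousOn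
  refine ⟨C, fun k => ?_⟩
  have h1 : ‖∫ x in cell, (f x : ℂ) * character (-k) x‖ ≤ C * volume.real cell := by
    refine norm_setIntegral_le_of_norm_le_const isCompact_cell.measure_lt_top fun x hx => ?_
    rw [norm_mul, norm_character, mul_one, Complex.norm_real]
    exact hC x hx
  rw [volume_real_cell] at h1
  rw [fourierCoeff_eq, norm_mul]
  calc _ ≤ ‖(1 / (2 * (Real.pi : ℂ)) ^ 3)‖ * (C * (2 * Real.pi) ^ 3) := by gcongr
    _ = C * (‖(1 / (2 * (Real.pi : ℂ)) ^ 3)‖ * (2 * Real.pi) ^ 3) := by ring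
    _ = C := by rw [norm_one_div_two_pi_pow, mul_one]

/-- The `j`-th partial derivative. -/
def partialDeriv (j : Fin 3) (f : Space → ℝ) : Space → ℝ := fun x => fderiv ℝ f x (axis j)

lemma IsSmoothOnTorus.partialDeriv {f : Space → ℝ} (hf : IsSmoothOnTorus f) (j : Fin 3) :
    IsSmoothOnTorus (partialDeriv j f) := by
  refine ⟨fun i x => ?_, ?_⟩
  · simp only [CubicWave.partialDeriv]
    rw [← fderiv_comp_add_right]
    congr 2
    ext y
    exact hf.1 i y
  · exact (hf.2.fderiv_right (m := ∞) (by simp)).clm_apply contDiff_const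

/-- Integration by parts: the integral of ∂ⱼ(f e^{-ik·x}) over the cell vanishes. -/
lemma fourierCoeff_partialDeriv {f : Space → ℝ} (hf : IsSmoothOnTorus f) (j : Fin 3) (k : Freq) :
    fourierCoeff (partialDeriv j f) k = Complex.I * (k j : ℝ) * fourierCoeff f k := by
  have hF : ContDiff ℝ ∞ fun x => (f x : ℂ) * character (-k) x :=
    (Complex.ofRealCLM.contDiff.comp hf.2).mul (contDiff_character (-k))
  have h := setIntegral_cell_fderiv_eq_zero (hF.of_le (by simp)) j fun x => by
    beta_reduce
    rw [hf.1 j x, periodic_character (-k) j x]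
  have hd : ∀ x, fderiv ℝ (fun x => (f x : ℂ) * character (-k) x) x (axis j) =
      (partialDeriv j f x : ℂ) * character (-k) x -
        Complex.I * (k j : ℝ) * ((f x : ℂ) * character (-k) x) := fun x => by
    have h1 : HasFDerivAt (fun x => (f x : ℂ)) (Complex.ofRealCLM.comp (fderiv ℝ f x)) x :=
      Complex.ofRealCLM.hasFDerivAt.comp x (hf.2.differentiable (by simp) x).hasFDerivAt
    rw [(h1.fun_mul (hasFDerivAt_character (-k) x)).fderiv]
    simp [phase_axis, partialDeriv]
    ring
  simp only [hd] at h
  rw [integral_sub, sub_eq_zero, integral_const_mul] at h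
  · rw [fourierCoeff_eq, fourierCoeff_eq, h]
    ring
  · exact (continuous_ofReal_mul_character
      (hf.partialDeriv j).2.continuous _).continuousOn.integrableOn_compact
      isCompact_cell
  · exact ((continuous_ofReal_mul_character hf.2.continuous _).const_smul
      (Complex.I * ((k j : ℝ) : ℂ))).continuousOn.integrableOn_compact isCompact_cell

lemma jap_le_one_add_sum (k : Freq) : jap k ≤ 1 + ∑ i, |(k i : ℝ)| := by
  rw [jap, Real.sqrt_le_left (by positivity), Fin.sum_univ_three, Fin.sum_univ_three,
    ← sq_abs (k 0 : ℝ), ← sq_abs (k 1 : ℝ), ← sq_abs (k 2 : ℝ)]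
  nlinarith [abs_nonneg (k 0 : ℝ), abs_nonneg (k 1 : ℝ), abs_nonneg (k 2 : ℝ),
    mul_nonneg (abs_nonneg (k 0 : ℝ)) (abs_nonneg (k 1 : ℝ)),
    mul_nonneg (abs_nonneg (k 0 : ℝ)) (abs_nonneg (k 2 : ℝ)),
    mul_nonneg (abs_nonneg (k 1 : ℝ)) (abs_nonneg (k 2 : ℝ))]

/-- The Fourier coefficients of a smooth function decay rapidly. -/
lemma IsSmoothOnTorus.rapid_fourierCoeff {f : Space → ℝ} (hf : IsSmoothOnTorus f) :
    Rapid (fourierCoeff f) := by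
  intro m
  induction m generalizing f with
  | zero => simpa using exists_norm_fourierCoeff_le hf.2.continuous
  | succ m ih =>
    obtain ⟨C, hC⟩ := ih hf
    choose B hB using fun j => ih (hf.partialDeriv j)
    refine ⟨C + ∑ j, B j, fun k => ?_⟩
    have hj := pow_pos (jap_pos k) m
    calc ‖fourierCoeff f k‖ * jap k ^ (m + 1)
        ≤ ‖fourierCoeff f k‖ * (jap k ^ m * (1 + ∑ i, |(k i : ℝ)|)) := by
          rw [pow_succ]
          gcongr
          exact jap_le_one_add_sum k
      _ = ‖fourierCoeff f k‖ * jap k ^ m +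
          ∑ j, ‖fourierCoeff (CubicWave.partialDeriv j f) k‖ * jap k ^ m := by
          rw [mul_add, mul_add, mul_one, Finset.mul_sum, Finset.mul_sum]
          congr 1
          refine Finset.sum_congr rfl fun j _ => ?_
          rw [fourierCoeff_partialDeriv hf, norm_mul, norm_mul, Complex.norm_I, one_mul,
            Complex.norm_real, Real.norm_eq_abs]
          ring
      _ ≤ C + ∑ j, B j := add_le_add (hC k) (Finset.sum_le_sum fun j _ => hB j k)

lemma isHermitian_fourierCoeff (f : Space → ℝ) : IsHermitian (fourierCoeff f) := fun k => by
  rw [fourierCoeff_eq, fourierCoeff_eq, map_mul, ← integral_conj]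
  congr 1
  · simp [show starRingEnd ℂ (2 : ℂ) = 2 from Complex.conj_ofReal 2]
  · congr 1
    ext x
    rw [map_mul, Complex.conj_ofReal, ← character_neg]

/-- The Fourier coefficients of a synthesized function. -/
lemma fourierCoeff_re_synth {a : Freq → ℂ} (ha : AbsSummable a) (hr : IsHermitian a) :
    fourierCoeff (fun x => (synth a x).re) = a := by
  ext k
  rw [fourierCoeff_eq]
  have h1 : ∀ x, (((synth a x).re : ℝ) : ℂ) * character (-k) x =
      ∑' j, a j * character (j - k) x := fun x => by
    rw [hr.ofReal_re_synth x, synth, ← tsum_mul_right]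
    refine tsum_congr fun j => ?_
    rw [sub_eq_add_neg, character_add, mul_assoc]
  have hintg : ∀ j, Integrable (fun x => a j * character (j - k) x) (volume.restrict cell) := fun j =>
    ((contDiff_character (j - k)).continuous.const_smul (a j)).continuousOn.integrableOn_compact
      isCompact_cell
  have hsum : Summable fun j => ∫ x in cell, ‖a j * character (j - k) x‖ := by
    simp only [norm_mul, norm_character, mul_one, setIntegral_const, smul_eq_mul]
    exact Summable.mul_left _ ha
  simp only [h1]
  rw [← integral_tsum_of_summable_integral_norm hintg hsum]
  simp only [integral_const_mul, setIntegral_character, sub_eq_zero]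
  rw [tsum_eq_single k fun j hj => by simp [hj]]
  have : (Real.pi : ℂ) ≠ 0 := by exact_mod_cast Real.pi_ne_zero
  simp
  field_simp

lemma continuous_re_synth {a : Freq → ℂ} (ha : Rapid a) : Continuous fun x => (synth a x).re :=
  continuous_iff_continuousAt.2 fun x => (hasFDerivAt_re_synth ha x).continuousAt

/-! ### Concentrated data -/

/-- The cube `{k : |kᵢ| ≤ n}` of frequencies. -/
def box (n : ℕ) : Finset Freq := Fintype.piFinset fun _ => Finset.Icc (-(n : ℤ)) n

lemma mem_box {n : ℕ} {k : Freq} : k ∈ box n ↔ ∀ i, -(n : ℤ) ≤ k i ∧ k i ≤ n := by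
  simp [box]

lemma card_box (n : ℕ) : (box n).card = (2 * n + 1) ^ 3 := by
  rw [box, Fintype.card_piFinset]
  simp only [Int.card_Icc, Finset.prod_const, Finset.card_univ, Fintype.card_fin]
  congr 1
  omega

lemma sum_sq_le_of_mem_box {n : ℕ} {k : Freq} (hk : k ∈ box n) :
    ∑ i, (k i : ℝ) ^ 2 ≤ 3 * (n : ℝ) ^ 2 := by
  have h : ∀ i, (k i : ℝ) ^ 2 ≤ (n : ℝ) ^ 2 := fun i => by
    have h1 : -(n : ℝ) ≤ k i := by exact_mod_cast (mem_box.1 hk i).1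
    have h2 : (k i : ℝ) ≤ n := by exact_mod_cast (mem_box.1 hk i).2
    exact sq_le_sq' h1 h2
  rw [Fin.sum_univ_three]
  linarith [h 0, h 1, h 2]

lemma jap_le_of_mem_box {n : ℕ} (hn : 1 ≤ n) {k : Freq} (hk : k ∈ box n) : jap k ≤ 2 * n := by
  have hn' : (1 : ℝ) ≤ n := by exact_mod_cast hn
  rw [jap, Real.sqrt_le_left (by positivity)]
  nlinarith [sum_sq_le_of_mem_box hk]

/-- The coefficients of a bump of height `A` concentrated at scale `1 / n`. -/
def bump (A : ℝ) (n : ℕ) : Freq → ℂ := fun k =>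
  if k ∈ box n then ((A / (2 * n + 1) ^ 3 : ℝ) : ℂ) else 0

lemma isHermitian_bump (A : ℝ) (n : ℕ) : IsHermitian (bump A n) := fun k => by
  have : -k ∈ box n ↔ k ∈ box n := by
    simp only [mem_box, Pi.neg_apply]
    exact forall_congr' fun i => by omega
  simp only [bump, this]
  split_ifs
  · exact (Complex.conj_ofReal _).symm
  · simp

lemma bump_eq_zero {A : ℝ} {n : ℕ} {k : Freq} (hk : k ∉ box n) : bump A n k = 0 := if_neg hk

variable {A : ℝ} {n : ℕ}

lemma norm_bump_of_mem (hA : 0 ≤ A) {k : Freq} (hk : k ∈ box n) :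
    ‖bump A n k‖ = A / (2 * n + 1) ^ 3 := by
  rw [bump, if_pos hk, Complex.norm_real, Real.norm_of_nonneg (by positivity)]

lemma hasSum_bump (A : ℝ) (n : ℕ) : HasSum (bump A n) A := by
  have h : ∑ k ∈ box n, bump A n k = A := by
    have hb : ∀ k ∈ box n, bump A n k = ((A / (2 * n + 1) ^ 3 : ℝ) : ℂ) := fun k hk => if_pos hk
    rw [Finset.sum_congr rfl hb, Finset.sum_const, card_box]
    have : (2 * (n : ℂ) + 1) ≠ 0 := by exact_mod_cast (by positivity : (2 * (n : ℝ) + 1) ≠ 0)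
    push_cast
    simp
    field_simp
  have h1 : HasSum (bump A n) (∑ k ∈ box n, bump A n k) :=
    hasSum_sum_of_ne_finset_zero fun k hk => bump_eq_zero hk
  rwa [h] at h1

lemma hasSum_norm_bump (hA : 0 ≤ A) : HasSum (fun k => ‖bump A n k‖) A := by
  have h : ∑ k ∈ box n, ‖bump A n k‖ = A := by
    rw [Finset.sum_congr rfl fun k hk => norm_bump_of_mem hA hk, Finset.sum_const, card_box]
    simp
    field_simp
  have h1 : HasSum (fun k => ‖bump A n k‖) (∑ k ∈ box n, ‖bump A n k‖) :=
    hasSum_sum_of_ne_finset_zero fun k hk => by rw [bump_eq_zero hk, norm_zero]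
  rwa [h] at h1

lemma absSummable_bump (hA : 0 ≤ A) : AbsSummable (bump A n) := (hasSum_norm_bump hA).summable

lemma l1_bump (hA : 0 ≤ A) : l1 (bump A n) = A := (hasSum_norm_bump hA).tsum_eq

lemma rapid_bump (hA : 0 ≤ A) (hn : 1 ≤ n) : Rapid (bump A n) := fun m => by
  refine ⟨A * (2 * n) ^ m, fun k => ?_⟩
  by_cases hk : k ∈ box n
  · have := (absSummable_bump (n := n) hA).norm_le_l1 k
    rw [l1_bump hA] at this
    have hj := (jap_pos k).le
    gcongr
    exact jap_le_of_mem_box hn hk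
  · rw [bump_eq_zero hk, norm_zero, zero_mul]
    positivity

lemma conv_eq_zero_of_support {a b : Freq → ℂ} {m n : ℕ} (ha : ∀ k ∉ box m, a k = 0)
    (hb : ∀ k ∉ box n, b k = 0) : ∀ k ∉ box (m + n), conv a b k = 0 := by
  intro k hk
  rw [conv]
  refine (tsum_congr fun j => ?_).trans tsum_zero
  by_contra hne
  have h1 : j ∈ box m := by
    by_contra h
    exact hne (by rw [ha j h, zero_mul])
  have h2 : k - j ∈ box n := by
    by_contra h
    exact hne (by rw [hb _ h, mul_zero])
  refine hk (mem_box.2 fun i => ?_)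
  have h3 := mem_box.1 h1 i
  have h4 := mem_box.1 h2 i
  simp only [Pi.sub_apply] at h4
  push_cast
  omega

/-- The cube is supported in the box of size 3n, so the sum is the full one, that is, the value at
the origin of the cubed bump. -/
lemma sum_box_cube_bump (hA : 0 ≤ A) : ∑ k ∈ box (3 * n), cube (bump A n) k = (A : ℂ) ^ 3 := by
  have hs := absSummable_bump (n := n) hA
  have h0 : ∀ k ∉ box n, bump A n k = 0 := fun k hk => bump_eq_zero hk
  have hsupp : ∀ k ∉ box (3 * n), cube (bump A n) k = 0 := by
    rw [show 3 * n = n + (n + n) by ring]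
    exact conv_eq_zero_of_support h0 (conv_eq_zero_of_support h0 h0)
  have htsum : ∑' k, cube (bump A n) k = ∑ k ∈ box (3 * n), cube (bump A n) k :=
    tsum_eq_sum hsupp
  rw [← htsum, cube, tsum_conv hs (hs.conv hs), tsum_conv hs hs,
    (hasSum_bump A n).tsum_eq]
  ring

/-! ### Short-time behaviour -/

/-- Mean value inequality in ℓ¹ when only coordinatewise derivatives are known. On each finite set
of frequencies the ℓ¹ norm is tested against the phases c, which reduces it to a scalar function. -/
lemma l1_sub_le_of_hasDerivAt {a a' : ℝ → Freq → ℂ} {T B : ℝ} (hT : 0 ≤ T)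
    (ha : ∀ s ∈ Set.Icc 0 T, ∀ k, HasDerivAt (fun s => a s k) (a' s k) s)
    (hs : ∀ s ∈ Set.Ico 0 T, AbsSummable (a' s)) (hB : ∀ s ∈ Set.Ico 0 T, l1 (a' s) ≤ B)
    (h : AbsSummable (a T - a 0)) : l1 (a T - a 0) ≤ B * T := by
  refine Summable.tsum_le_of_sum_le h fun S => ?_
  set c : Freq → ℂ := fun k => starRingEnd ℂ ((a T - a 0) k) / ‖(a T - a 0) k‖ with hc
  have hc1 : ∀ k, ‖c k‖ ≤ 1 := fun k => by
    rw [hc]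
    simp only [norm_div, Complex.norm_conj, Complex.norm_real, norm_norm]
    exact div_self_le_one _
  have hcz : ∀ k, c k * (a T - a 0) k = ‖(a T - a 0) k‖ := fun k => by
    by_cases hz : (a T - a 0) k = 0
    · simp [hz]
    · have : ((‖(a T - a 0) k‖ : ℝ) : ℂ) ≠ 0 := by
        exact_mod_cast norm_ne_zero_iff.2 hz
      rw [hc]
      simp only
      rw [div_mul_eq_mul_div, ← Complex.normSq_eq_conj_mul_self, Complex.normSq_eq_norm_sq,
        div_eq_iff this]
      push_cast
      ring
  have key := norm_image_sub_le_of_norm_deriv_le_segment' (a := 0) (b := T)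
    (f := fun s => ∑ k ∈ S, c k * a s k) (f' := fun s => ∑ k ∈ S, c k * a' s k) (C := B)
    (fun s hs => (HasDerivAt.fun_sum fun k _ => (ha s hs k).const_mul (c k)).hasDerivWithinAt)
    (fun s hs' => ?_) T ⟨hT, le_rfl⟩
  · rw [← Finset.sum_sub_distrib, sub_zero] at key
    simp only [← mul_sub] at key
    have h2 : ∑ k ∈ S, c k * (a T k - a 0 k) = ((∑ k ∈ S, ‖(a T - a 0) k‖ : ℝ) : ℂ) := by
      push_cast
      exact Finset.sum_congr rfl fun k _ => hcz k
    rw [h2, Complex.norm_real, Real.norm_of_nonneg (by positivity)] at key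
    exact key
  · refine (norm_sum_le _ _).trans (le_trans (Finset.sum_le_sum fun k _ => ?_)
      (((hs s hs').sum_le_l1 S).trans (hB s hs')))
    rw [norm_mul]
    exact mul_le_of_le_one_left (norm_nonneg _) (hc1 k)

section ShortTime

variable {v₀ v₁ : Freq → ℂ} {M : ℝ} {W : ℝ → L1}

/-- On the time scale `1 / (40 A)` the solution stays close to its initial value. -/
lemma l1_posPart_sub_le (hv₀ : Rapid v₀) (hv₁ : Rapid v₁) (hr₀ : IsHermitian v₀)
    (hr₁ : IsHermitian v₁) (hM : 1 ≤ M) (hM₀ : (l1 fun k => jap k * v₀ k) ≤ M) (hM₁ : l1 v₁ ≤ M)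
    (hn : 1 ≤ n) (hAM : 100 * M ≤ A) (hAn : 100 * (n : ℝ) ≤ A)
    (hW0 : (W 0 : Freq → ℂ) = initialProfile (v₀ + bump A n) v₁)
    (hW : ∀ t, HasDerivAt W (fieldL1 t (W t)) t) :
    ∀ t ∈ Set.Icc 0 (1 / (40 * A)), l1 (posPart t (W t) - (v₀ + bump A n)) ≤ A / 40 := by
  have hn' : (1 : ℝ) ≤ n := by exact_mod_cast hn
  have hA : 100 ≤ A := by linarith
  have hA0 : 0 ≤ A := by linarith
  have hb := rapid_bump (n := n) hA0 hn
  have hf : Rapid (v₀ + bump A n) := hv₀.add hb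
  have hrf : IsHermitian (v₀ + bump A n) := hr₀.add (isHermitian_bump A n)
  have h0 : Rapid (W 0) := hW0 ▸ hf.initialProfile hv₁
  have hloc := locRapid_of_solution h0 hW
  have hcoord : ∀ t k, HasDerivAt (fun s => W s k) (field t (W t) k) t :=
    fun t k => hasDerivAt_coord (hW t) k
  have hu0 : posPart 0 (W 0) = v₀ + bump A n := by rw [hW0, posPart_initialProfile hrf hr₁]
  have hjv : AbsSummable fun k => jap k * v₀ k :=
    (hv₀.of_norm_le 1 1 fun k => by
      rw [norm_mul, Complex.norm_real, Real.norm_of_nonneg (jap_pos k).le]; simp).absSummable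
  have hv₀l : l1 v₀ ≤ M := (l1_le_of_le hjv fun k => by
    rw [norm_mul, Complex.norm_real, Real.norm_of_nonneg (jap_pos k).le]
    exact le_mul_of_one_le_left (norm_nonneg _) (one_le_jap k)).trans hM₀
  have hfl : l1 (v₀ + bump A n) ≤ M + A := by
    refine (l1_add_le hv₀.absSummable hb.absSummable).trans ?_
    rw [l1_bump hA0]
    linarith
  -- On the support of the bump ⟨k⟩ ≤ 2n, so its share of Du is at most 2nA; the fixed data
  -- contribute M each.
  have hW0l : ‖W 0‖ ≤ 2 * M + 2 * n * A := by
    rw [L1.norm_eq, hW0]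
    have hsum1 : Summable fun k => 2 * (n : ℝ) * ‖bump A n k‖ := hb.absSummable.mul_left _
    have hle : ∀ k, ‖initialProfile (v₀ + bump A n) v₁ k‖ ≤
        ‖jap k * v₀ k‖ + 2 * n * ‖bump A n k‖ + ‖v₁ k‖ := fun k => by
      refine (norm_initialProfile_le _ _ _).trans ?_
      gcongr
      rw [norm_mul, Complex.norm_real, Real.norm_of_nonneg (jap_pos k).le]
      have h1 : ‖(v₀ + bump A n) k‖ ≤ ‖v₀ k‖ + ‖bump A n k‖ := norm_add_le _ _
      have h2 : jap k * ‖bump A n k‖ ≤ 2 * n * ‖bump A n k‖ := by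
        by_cases hk : k ∈ box n
        · gcongr
          exact jap_le_of_mem_box hn hk
        · simp [bump_eq_zero hk]
      have hj := jap_pos k
      nlinarith
    refine (Summable.tsum_le_tsum hle (hf.initialProfile hv₁).absSummable
      ((Summable.add hjv hsum1).add hv₁.absSummable)).trans ?_
    rw [Summable.tsum_add (Summable.add hjv hsum1) hv₁.absSummable, Summable.tsum_add hjv hsum1,
      tsum_mul_left]
    change (l1 fun k => jap k * v₀ k) + 2 * n * l1 (bump A n) + l1 v₁ ≤ _
    rw [l1_bump hA0]
    linarith
  set T := 1 / (40 * A) with hT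
  have hTA : T * A = 1 / 40 := by rw [hT]; field_simp
  have hT0 : 0 ≤ T := by positivity
  have hsub : ∀ t, AbsSummable (posPart t (W t) - (v₀ + bump A n)) := fun t =>
    ((W t).absSummable.posPart t).sub hf.absSummable
  -- Bootstrap: the bound A/20 up to time r implies A/40 at time r.
  refine le_of_continuity_method (b := A / 20) (by linarith) ?_ ?_
  · obtain ⟨g, hg, hgb⟩ := (hloc (T + 1)).posPart.exists_summable_bound
    refine continuousOn_tsum (u := fun k => g k + ‖(v₀ + bump A n) k‖) (fun k => ?_)
      (hg.add hf.absSummable) fun k t ht => ?_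
    · refine Continuous.continuousOn (Continuous.norm (Continuous.sub ?_ continuous_const))
      exact continuous_iff_continuousAt.2 fun t => (hasDerivAt_posPart (hcoord t) k).continuousAt
    · rw [norm_norm]
      exact (norm_sub_le _ _).trans (by
        gcongr
        exact hgb t ⟨by linarith [ht.1], by linarith [ht.2]⟩ k)
  · intro r hr h
    have hul : ∀ s ∈ Set.Ico 0 r, l1 (posPart s (W s)) ≤ 2 * A := fun s hs => by
      have h1 := l1_add_le (hsub s) hf.absSummable
      rw [sub_add_cancel] at h1
      linarith [h s hs]
    -- From ‖u‖_{ℓ¹} ≤ 2A the forcing is at most 2A + 8A³ ≤ 9A³, as A ≥ 100.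
    have hfield : ∀ s ∈ Set.Ico 0 r, ‖fieldL1 s (W s)‖ ≤ 9 * A ^ 3 := fun s hs => by
      rw [L1.norm_eq, fieldL1, AbsSummable.coe_toL1, l1_field]
      refine (l1_force_le ((W s).absSummable.posPart s)).trans ?_
      have h1 := hul s hs
      have h2 : l1 (posPart s (W s)) ^ 3 ≤ (2 * A) ^ 3 := pow_le_pow_left₀ (l1_nonneg _) h1 3
      nlinarith [mul_nonneg hA0 (mul_nonneg hA0 hA0), mul_self_nonneg A]
    have hWl : ∀ s ∈ Set.Ico 0 r, ‖W s‖ ≤ 2 * M + 2 * n * A + 9 * A ^ 3 * T := by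
      intro s hs
      have h1 := norm_image_sub_le_of_norm_deriv_le_segment' (a := 0) (b := s) (f := W)
        (f' := fun s => fieldL1 s (W s)) (C := 9 * A ^ 3)
        (fun x _ => (hW x).hasDerivWithinAt)
        (fun x hx => hfield x ⟨hx.1, hx.2.trans hs.2⟩) s ⟨hs.1, le_rfl⟩
      have h2 : ‖W s‖ ≤ ‖W 0‖ + ‖W s - W 0‖ := by simpa using norm_add_le (W 0) (W s - W 0)
      have h3 : 9 * A ^ 3 * (s - 0) ≤ 9 * A ^ 3 * T := by
        gcongr
        linarith [hs.2, hr.2]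
      linarith
    have h1 := l1_sub_le_of_hasDerivAt (a := fun s => posPart s (W s))
      (a' := fun s => velPart s (W s)) (B := 2 * M + 2 * n * A + 9 * A ^ 3 * T) hr.1
      (fun s _ => hasDerivAt_posPart (hcoord s)) (fun s _ => (W s).absSummable.velPart s)
      (fun s hs => (l1_velPart_le (W s).absSummable s).trans
        ((L1.norm_eq _).symm.trans_le (hWl s hs)))
      (by simpa only [hu0] using hsub r)
    simp only [hu0] at h1
    refine h1.trans ?_
    have hB0 : 0 ≤ 2 * M + 2 * n * A + 9 * A ^ 3 * T := by positivity
    -- Since T A = 1/40 and M, n ≤ A/100, each part of the velocity bound, multiplied by T, is a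
    -- small fraction of A.
    calc (2 * M + 2 * n * A + 9 * A ^ 3 * T) * r ≤ (2 * M + 2 * n * A + 9 * A ^ 3 * T) * T := by
          gcongr; exact hr.2
      _ = 2 * M * T + 2 * n * (T * A) + 9 * A * (T * A) ^ 2 := by ring
      _ ≤ 2 * (A / 100) * T + 2 * (A / 100) * (T * A) + 9 * A * (T * A) ^ 2 := by
          gcongr <;> linarith
      _ = (T * A) * (2 / 100 + 2 * A / 100 + 9 * A * (T * A)) := by ring
      _ ≤ A / 40 := by rw [hTA]; linarith

/-- The velocity becomes large at low frequencies on the time scale `1 / (40 A)`. -/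
lemma norm_sum_velPart_ge (hv₀ : Rapid v₀) (hv₁ : Rapid v₁) (hr₀ : IsHermitian v₀)
    (hr₁ : IsHermitian v₁) (hM : 1 ≤ M) (hM₀ : (l1 fun k => jap k * v₀ k) ≤ M) (hM₁ : l1 v₁ ≤ M)
    (hn : 1 ≤ n) (hAM : 100 * M ≤ A) (hAn : 100 * (n : ℝ) ≤ A)
    (hW0 : (W 0 : Freq → ℂ) = initialProfile (v₀ + bump A n) v₁)
    (hW : ∀ t, HasDerivAt W (fieldL1 t (W t)) t) :
    ∀ t ∈ Set.Icc (1 / (80 * A)) (1 / (40 * A)),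
      A ^ 2 / 200 ≤ ‖∑ k ∈ box (3 * n), velPart t (W t) k‖ := by
  intro t ht
  have hn' : (1 : ℝ) ≤ n := by exact_mod_cast hn
  have hA : 100 ≤ A := by linarith
  have hA0 : 0 ≤ A := by linarith
  have hclose := l1_posPart_sub_le hv₀ hv₁ hr₀ hr₁ hM hM₀ hM₁ hn hAM hAn hW0 hW
  have hb := rapid_bump (n := n) hA0 hn
  have hf : Rapid (v₀ + bump A n) := hv₀.add hb
  have hrf : IsHermitian (v₀ + bump A n) := hr₀.add (isHermitian_bump A n)
  have hcoord : ∀ t k, HasDerivAt (fun s => W s k) (field t (W t) k) t :=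
    fun t k => hasDerivAt_coord (hW t) k
  have hp0 : velPart 0 (W 0) = v₁ := by rw [hW0, velPart_initialProfile hrf hr₁]
  have hjv : AbsSummable fun k => jap k * v₀ k :=
    (hv₀.of_norm_le 1 1 fun k => by
      rw [norm_mul, Complex.norm_real, Real.norm_of_nonneg (jap_pos k).le]; simp).absSummable
  have hv₀l : l1 v₀ ≤ M := (l1_le_of_le hjv fun k => by
    rw [norm_mul, Complex.norm_real, Real.norm_of_nonneg (jap_pos k).le]
    exact le_mul_of_one_le_left (norm_nonneg _) (one_le_jap k)).trans hM₀
  -- The real part of the low-frequency projection of ∂ₜu at the origin. A scalar quantity allows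
  -- the mean value theorem to be used with a sign.
  set h : ℝ → ℝ := fun s => (∑ k ∈ box (3 * n), velPart s (W s) k).re with hh
  set h' : ℝ → ℝ := fun s => (∑ k ∈ box (3 * n), (-((∑ i, (k i : ℝ) ^ 2 : ℝ) : ℂ) *
    posPart s (W s) k - cube (posPart s (W s)) k)).re with hh'
  have hd : ∀ s, HasDerivAt h (h' s) s := fun s =>
    Complex.reCLM.hasFDerivAt.comp_hasDerivAt s
      (HasDerivAt.fun_sum fun k _ => hasDerivAt_velPart (hcoord s) k)
  -- The derivative is -A³ from the cubed bump, up to a Laplacian error of at most A³/10 (|k|² ≤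
  -- 27n² and n ≤ A/100) and a cubic error of at most A³/5.
  have hbound : ∀ s ∈ Set.Icc 0 (1 / (40 * A)), h' s ≤ -(A ^ 3 / 2) := by
    intro s hs
    set u := posPart s (W s) with hu
    have hus : AbsSummable u := (W s).absSummable.posPart s
    have hub : l1 (u - bump A n) ≤ A / 20 := by
      have e : u - bump A n = (u - (v₀ + bump A n)) + v₀ := by abel
      rw [e]
      refine (l1_add_le (hus.sub hf.absSummable) hv₀.absSummable).trans ?_
      linarith [hclose s hs]
    have hul : l1 u ≤ 11 / 10 * A := by
      have := l1_add_le (hus.sub hb.absSummable) hb.absSummable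
      rw [sub_add_cancel, l1_bump hA0] at this
      linarith
    have hc := l1_cube_sub_cube_le hus hb.absSummable hul (by rw [l1_bump hA0]; linarith)
    have hc2 : l1 (cube u - cube (bump A n)) ≤ A ^ 3 * (2 / 10) := by
      refine hc.trans ?_
      calc 3 * (11 / 10 * A) ^ 2 * l1 (u - bump A n) ≤ 3 * (11 / 10 * A) ^ 2 * (A / 20) := by gcongr
        _ = A ^ 3 * (363 / 2000) := by ring
        _ ≤ A ^ 3 * (2 / 10) := mul_le_mul_of_nonneg_left (by norm_num) (by positivity)
    have hsplit : (∑ k ∈ box (3 * n), (-((∑ i, (k i : ℝ) ^ 2 : ℝ) : ℂ) * u k - cube u k)) =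
        -(A : ℂ) ^ 3 - (∑ k ∈ box (3 * n), ((∑ i, (k i : ℝ) ^ 2 : ℝ) : ℂ) * u k) -
          ∑ k ∈ box (3 * n), (cube u - cube (bump A n)) k := by
      rw [← sum_box_cube_bump (n := n) hA0, ← Finset.sum_neg_distrib, ← Finset.sum_sub_distrib,
        ← Finset.sum_sub_distrib]
      refine Finset.sum_congr rfl fun k _ => ?_
      simp only [Pi.sub_apply]
      ring
    have h1 : ‖∑ k ∈ box (3 * n), ((∑ i, (k i : ℝ) ^ 2 : ℝ) : ℂ) * u k‖ ≤ A ^ 3 * (1 / 10) := by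
      calc ‖∑ k ∈ box (3 * n), ((∑ i, (k i : ℝ) ^ 2 : ℝ) : ℂ) * u k‖
          ≤ ∑ k ∈ box (3 * n), 27 * (n : ℝ) ^ 2 * ‖u k‖ := by
            refine (norm_sum_le _ _).trans (Finset.sum_le_sum fun k hk => ?_)
            rw [norm_mul, Complex.norm_real, Real.norm_of_nonneg (by positivity)]
            gcongr
            refine (sum_sq_le_of_mem_box hk).trans_eq ?_
            push_cast
            ring
        _ ≤ 27 * (n : ℝ) ^ 2 * (11 / 10 * A) := by
            rw [← Finset.mul_sum]
            gcongr
            exact (hus.sum_le_l1 _).trans hul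
        _ ≤ 27 * (A / 100) ^ 2 * (11 / 10 * A) := by gcongr; linarith
        _ = A ^ 3 * (297 / 100000) := by ring
        _ ≤ A ^ 3 * (1 / 10) := mul_le_mul_of_nonneg_left (by norm_num) (by positivity)
    have h2 : ‖∑ k ∈ box (3 * n), (cube u - cube (bump A n)) k‖ ≤ A ^ 3 * (2 / 10) :=
      (norm_sum_le _ _).trans (((hus.cube.sub hb.absSummable.cube).sum_le_l1 _).trans hc2)
    rw [hh']
    simp only
    rw [hsplit, Complex.sub_re, Complex.sub_re]
    have h3 : (-(A : ℂ) ^ 3).re = -A ^ 3 := by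
      rw [← Complex.ofReal_pow, Complex.neg_re, Complex.ofReal_re]
    have h4 := (abs_le.1 ((Complex.abs_re_le_norm _).trans h1)).1
    have h5 := (abs_le.1 ((Complex.abs_re_le_norm _).trans h2)).1
    have hA3 : 0 ≤ A ^ 3 := by positivity
    rw [h3]
    linarith
  have ht0 : 0 < t := lt_of_lt_of_le (by positivity) ht.1
  obtain ⟨c, hc, hce⟩ := exists_hasDerivAt_eq_slope h h' ht0
    (fun s _ => (hd s).continuousAt.continuousWithinAt) fun s _ => hd s
  have hcb := hbound c ⟨hc.1.le, hc.2.le.trans ht.2⟩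
  have hslope : h t = h 0 + h' c * t := by
    rw [hce, sub_zero, div_mul_cancel₀ _ ht0.ne']
    ring
  have hh0 : h 0 ≤ M := by
    rw [hh]
    simp only [hp0]
    exact (Complex.re_le_norm _).trans ((norm_sum_le _ _).trans
      ((hv₁.absSummable.sum_le_l1 _).trans hM₁))
  -- For t ≥ 1/(80A) the decrease is at least A²/160; the initial value, at most M ≤ A/100, is
  -- absorbed in passing to A²/200.
  have h1 : h' c * t ≤ -(A ^ 3 / 2) * (1 / (80 * A)) := by
    have hA3 : 0 ≤ A ^ 3 / 2 := by positivity
    calc h' c * t ≤ -(A ^ 3 / 2) * t := by gcongr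
      _ ≤ -(A ^ 3 / 2) * (1 / (80 * A)) := by
          rw [neg_mul, neg_mul, neg_le_neg_iff]
          gcongr
          exact ht.1
  have h2 : -(A ^ 3 / 2) * (1 / (80 * A)) = -(A ^ 2 / 160) := by
    field_simp
    norm_num
  have h3 : h t ≤ -(A ^ 2 / 200) := by
    rw [h2] at h1
    nlinarith
  have h4 := (Complex.abs_re_le_norm (∑ k ∈ box (3 * n), velPart t (W t) k))
  have h5 : A ^ 2 / 200 ≤ |h t| := by rw [abs_of_nonpos (h3.trans (by simp; positivity))]; linarith
  exact h5.trans h4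

end ShortTime

/-! ### Sobolev norms -/

lemma sobolevNorm_eq {s : ℝ} {f : Space → ℝ} {a : Freq → ℂ} (h : fourierCoeff f = a) :
    sobolevNorm s f = (∑' k, ENNReal.ofReal (jap k ^ (2 * s)) * ‖a k‖ₑ ^ 2) ^ (1 / 2 : ℝ) := by
  subst h; rfl

lemma ofReal_mul_enorm_sq (k : Freq) (s : ℝ) (z : ℂ) :
    ENNReal.ofReal (jap k ^ (2 * s)) * ‖z‖ₑ ^ 2 = ENNReal.ofReal (jap k ^ (2 * s) * ‖z‖ ^ 2) := by
  rw [ENNReal.ofReal_mul (Real.rpow_nonneg (jap_pos k).le _), ENNReal.ofReal_pow (norm_nonneg _),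
    ofReal_norm]

lemma ofReal_le_sobolevNorm {s : ℝ} {f : Space → ℝ} {a : Freq → ℂ} (h : fourierCoeff f = a)
    {S : Finset Freq} {x : ℝ} (hx : 0 ≤ x) (hS : x ^ 2 ≤ ∑ k ∈ S, jap k ^ (2 * s) * ‖a k‖ ^ 2) :
    ENNReal.ofReal x ≤ sobolevNorm s f := by
  rw [sobolevNorm_eq h]
  have h1 : ENNReal.ofReal x = (ENNReal.ofReal (x ^ 2)) ^ (1 / 2 : ℝ) := by
    rw [ENNReal.ofReal_rpow_of_nonneg (by positivity) (by norm_num), ← Real.sqrt_eq_rpow,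
      Real.sqrt_sq hx]
  rw [h1]
  gcongr
  refine le_trans (ENNReal.ofReal_le_ofReal hS) (le_trans ?_ (ENNReal.sum_le_tsum S))
  rw [ENNReal.ofReal_sum_of_nonneg fun k _ =>
    mul_nonneg (Real.rpow_nonneg (jap_pos k).le _) (by positivity)]
  exact (Finset.sum_congr rfl fun k _ => (ofReal_mul_enorm_sq k s (a k)).symm).le

lemma sobolevNorm_le_ofReal {s : ℝ} {f : Space → ℝ} {a : Freq → ℂ} (h : fourierCoeff f = a)
    {S : Finset Freq} (hsupp : ∀ k ∉ S, a k = 0) {x : ℝ} (hx : 0 ≤ x)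
    (hS : ∑ k ∈ S, jap k ^ (2 * s) * ‖a k‖ ^ 2 ≤ x ^ 2) : sobolevNorm s f ≤ ENNReal.ofReal x := by
  rw [sobolevNorm_eq h]
  have h1 : ENNReal.ofReal x = (ENNReal.ofReal (x ^ 2)) ^ (1 / 2 : ℝ) := by
    rw [ENNReal.ofReal_rpow_of_nonneg (by positivity) (by norm_num), ← Real.sqrt_eq_rpow,
      Real.sqrt_sq hx]
  rw [h1]
  gcongr
  rw [tsum_eq_sum (s := S) fun k hk => by simp [hsupp k hk]]
  refine le_trans ?_ (ENNReal.ofReal_le_ofReal hS)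
  rw [ENNReal.ofReal_sum_of_nonneg fun k _ =>
    mul_nonneg (Real.rpow_nonneg (jap_pos k).le _) (by positivity)]
  exact (Finset.sum_congr rfl fun k _ => ofReal_mul_enorm_sq k s (a k)).le

/-- About (2n)³ coefficients of size A/(2n)³ with weight at most (2n)^{2s} give A²(2n)^{2s-3}; as s
≤ 3/2, the factor 2 can be dropped. -/
lemma sobolevNorm_bump_le {s : ℝ} (hs : 0 ≤ s) (hs' : s ≤ 3 / 2) (hA : 0 ≤ A) (hn : 1 ≤ n)
    {f : Space → ℝ} (h : fourierCoeff f = bump A n) :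
    sobolevNorm s f ≤ ENNReal.ofReal (A * (n : ℝ) ^ (s - 3 / 2)) := by
  have hn' : (1 : ℝ) ≤ n := by exact_mod_cast hn
  have hn0 : (0 : ℝ) < n := by linarith
  refine sobolevNorm_le_ofReal h (fun k hk => bump_eq_zero hk) (by positivity) ?_
  have hterm : ∀ k ∈ box n, jap k ^ (2 * s) * ‖bump A n k‖ ^ 2 ≤
      (2 * n) ^ (2 * s) * (A / (2 * n + 1) ^ 3) ^ 2 := fun k hk => by
    rw [norm_bump_of_mem hA hk]
    gcongr
    · exact (jap_pos k).le
    · exact jap_le_of_mem_box hn hk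
  refine (Finset.sum_le_card_nsmul _ _ _ hterm).trans ?_
  rw [card_box, nsmul_eq_mul]
  push_cast
  have h1 : (2 * (n : ℝ) + 1) ^ 3 * ((2 * n) ^ (2 * s) * (A / (2 * n + 1) ^ 3) ^ 2) =
      A ^ 2 * ((2 * n) ^ (2 * s) / (2 * n + 1) ^ 3) := by
    field_simp
  have h2 : (2 * (n : ℝ)) ^ (2 * s) / (2 * n + 1) ^ 3 ≤ (2 * (n : ℝ)) ^ (2 * s) / (2 * n) ^ 3 := by
    gcongr
    linarith
  have h3 : (2 * (n : ℝ)) ^ (2 * s) / (2 * n) ^ 3 = (2 * (n : ℝ)) ^ (2 * (s - 3 / 2)) := by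
    rw [← Real.rpow_natCast, ← Real.rpow_sub (by positivity)]
    congr 1
    push_cast
    ring
  have h4 : (2 * (n : ℝ)) ^ (2 * (s - 3 / 2)) ≤ (n : ℝ) ^ (2 * (s - 3 / 2)) :=
    Real.rpow_le_rpow_of_nonpos hn0 (by linarith) (by linarith)
  rw [h1, mul_pow, ← Real.rpow_natCast ((n : ℝ) ^ (s - 3 / 2)), ← Real.rpow_mul hn0.le]
  gcongr
  refine h2.trans (h3.le.trans (h4.trans_eq ?_))
  congr 1
  push_cast
  ring

/-- Cauchy–Schwarz against ⟨k⟩^{1-s} on the box, where Σ ⟨k⟩^{2(1-s)} ≤ (7n)³ · 36 n^{2(1-s)}, and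
7³ · 36 ≤ 112². -/
lemma le_sobolevNorm_of_sum {s : ℝ} (hs : 0 ≤ s) (hs' : s ≤ 1) (hn : 1 ≤ n) {f : Space → ℝ}
    {a : Freq → ℂ} (h : fourierCoeff f = a) {x : ℝ} (hx : 0 ≤ x)
    (hS : x ≤ ‖∑ k ∈ box (3 * n), a k‖) :
    ENNReal.ofReal (x / (112 * (n : ℝ) ^ (5 / 2 - s))) ≤ sobolevNorm (s - 1) f := by
  have hn' : (1 : ℝ) ≤ n := by exact_mod_cast hn
  have hn0 : (0 : ℝ) < n := by linarith
  refine ofReal_le_sobolevNorm h (S := box (3 * n)) (by positivity) ?_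
  rw [div_pow, div_le_iff₀ (by positivity)]
  have hcs : x ^ 2 ≤ (∑ k ∈ box (3 * n), (jap k ^ (1 - s)) ^ 2) *
      ∑ k ∈ box (3 * n), (jap k ^ (s - 1) * ‖a k‖) ^ 2 := by
    refine le_trans ?_ (Finset.sum_mul_sq_le_sq_mul_sq _ _ _)
    refine pow_le_pow_left₀ hx (hS.trans ((norm_sum_le _ _).trans_eq ?_)) 2
    refine Finset.sum_congr rfl fun k _ => ?_
    rw [← mul_assoc, ← Real.rpow_add (jap_pos k)]
    simp
  have hsq : ∀ k, (jap k ^ (s - 1) * ‖a k‖) ^ 2 = jap k ^ (2 * (s - 1)) * ‖a k‖ ^ 2 := fun k => by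
    rw [mul_pow, ← Real.rpow_natCast (jap k ^ (s - 1)), ← Real.rpow_mul (jap_pos k).le]
    congr 2
    push_cast
    ring
  have hcard : ∑ k ∈ box (3 * n), (jap k ^ (1 - s)) ^ 2 ≤ (112 * (n : ℝ) ^ (5 / 2 - s)) ^ 2 := by
    have hterm : ∀ k ∈ box (3 * n), (jap k ^ (1 - s)) ^ 2 ≤ 36 * ((n : ℝ) ^ (1 - s)) ^ 2 := by
      intro k hk
      have h1 : jap k ≤ 6 * n := by
        have := jap_le_of_mem_box (by omega) hk
        push_cast at this
        linarith
      have h2 : jap k ^ (1 - s) ≤ 6 * (n : ℝ) ^ (1 - s) := by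
        calc jap k ^ (1 - s) ≤ (6 * n) ^ (1 - s) := by
              gcongr
              exact (jap_pos k).le
          _ = 6 ^ (1 - s) * (n : ℝ) ^ (1 - s) := Real.mul_rpow (by norm_num) hn0.le
          _ ≤ 6 ^ (1 : ℝ) * (n : ℝ) ^ (1 - s) := by
              gcongr
              · norm_num
              · linarith
          _ = 6 * (n : ℝ) ^ (1 - s) := by rw [Real.rpow_one]
      calc (jap k ^ (1 - s)) ^ 2 ≤ (6 * (n : ℝ) ^ (1 - s)) ^ 2 :=
            pow_le_pow_left₀ (Real.rpow_nonneg (jap_pos k).le _) h2 2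
        _ = 36 * ((n : ℝ) ^ (1 - s)) ^ 2 := by ring
    refine (Finset.sum_le_card_nsmul _ _ _ hterm).trans ?_
    rw [card_box, nsmul_eq_mul]
    push_cast
    have h1 : (2 * (3 * (n : ℝ)) + 1) ^ 3 ≤ (7 * n) ^ 3 := by
      gcongr
      linarith
    have h2 : ((n : ℝ) ^ (5 / 2 - s)) ^ 2 = (n : ℝ) ^ 3 * ((n : ℝ) ^ (1 - s)) ^ 2 := by
      rw [← Real.rpow_natCast, ← Real.rpow_natCast, ← Real.rpow_natCast, ← Real.rpow_mul hn0.le,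
        ← Real.rpow_mul hn0.le, ← Real.rpow_add hn0]
      congr 1
      push_cast
      ring
    have h3 : 0 ≤ (n : ℝ) ^ 3 * ((n : ℝ) ^ (1 - s)) ^ 2 := by positivity
    calc (2 * (3 * (n : ℝ)) + 1) ^ 3 * (36 * ((n : ℝ) ^ (1 - s)) ^ 2)
        ≤ (7 * n) ^ 3 * (36 * ((n : ℝ) ^ (1 - s)) ^ 2) := by gcongr
      _ ≤ (112 * (n : ℝ) ^ (5 / 2 - s)) ^ 2 := by
          rw [mul_pow 112, h2]
          nlinarith
  simp only [hsq] at hcs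
  refine hcs.trans ?_
  rw [mul_comm]
  exact mul_le_mul_of_nonneg_left hcard (Finset.sum_nonneg fun k _ =>
    mul_nonneg (Real.rpow_nonneg (jap_pos k).le _) (by positivity))

/-! ### Norm inflation -/

/-- Arbitrarily close to given smooth data there are smooth data whose solution becomes arbitrarily
large on some time interval contained in an arbitrarily small neighbourhood of the origin. -/
theorem exists_inflating_solution {s : ℝ} (hs : s ∈ Set.Ioo (0 : ℝ) (1 / 2)) {u₀ u₁ : Space → ℝ}
    (hu₀ : IsSmoothOnTorus u₀) (hu₁ : IsSmoothOnTorus u₁) {ε : ℝ} (hε : 0 < ε) :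
    ∃ (u : ℝ → Space → ℝ) (t₁ t₂ : ℝ), IsSmoothGlobalSolution u ∧ 0 < t₁ ∧ t₁ < t₂ ∧ t₂ < ε ∧
      pairNorm s (u 0 - u₀) (timeDeriv u 0 - u₁) ≤ ENNReal.ofReal ε ∧
      ∀ t ∈ Set.Icc t₁ t₂, ENNReal.ofReal (1 / ε) ≤ pairNorm s (u t) (timeDeriv u t) := by
  have hv₀ := hu₀.rapid_fourierCoeff
  have hv₁ := hu₁.rapid_fourierCoeff
  have hr₀ := isHermitian_fourierCoeff u₀
  have hr₁ := isHermitian_fourierCoeff u₁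
  set v₀ := fourierCoeff u₀
  set v₁ := fourierCoeff u₁
  set M := 1 + (l1 fun k => jap k * v₀ k) + l1 v₁ with hMdef
  have hl₀ : 0 ≤ l1 fun k => jap k * v₀ k := l1_nonneg _
  have hl₁ : 0 ≤ l1 v₁ := l1_nonneg _
  have htend : Tendsto (fun n : ℕ => (n : ℝ) ^ (1 / 2 - s)) atTop atTop :=
    (tendsto_rpow_atTop (by linarith [hs.2])).comp tendsto_natCast_atTop_atTop
  -- With p = n^{1/2-s}, the four thresholds give in turn A ≥ 100M, A ≥ 100n, 1/(40A) < ε, and the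
  -- final lower bound, for which 22400 = 200 · 112.
  obtain ⟨n, hn, hn₁, hn₂, hn₃, hn₄⟩ := ((eventually_ge_atTop 1).and
    ((htend.eventually_ge_atTop (100 * M / ε)).and ((htend.eventually_ge_atTop (100 / ε)).and
      ((htend.eventually_ge_atTop (1 / ε ^ 2)).and
        (htend.eventually_ge_atTop (22400 / ε ^ 3)))))).exists
  have hn' : (1 : ℝ) ≤ n := by exact_mod_cast hn
  have hn0 : (0 : ℝ) < n := by linarith
  have hp0 : 0 < (n : ℝ) ^ (1 / 2 - s) := by positivity
  have hpow₁ : (n : ℝ) ^ (s - 3 / 2) = (n * (n : ℝ) ^ (1 / 2 - s))⁻¹ := by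
    rw [← Real.rpow_one_add' hn0.le (by linarith [hs.2]), ← Real.rpow_neg hn0.le]
    congr 1
    ring
  have hpow₂ : (n : ℝ) ^ (5 / 2 - s) = (n : ℝ) ^ 2 * (n : ℝ) ^ (1 / 2 - s) := by
    rw [← Real.rpow_natCast, ← Real.rpow_add hn0]
    congr 1
    push_cast
    ring
  set p := (n : ℝ) ^ (1 / 2 - s)
  rw [div_le_iff₀ (by positivity)] at hn₁ hn₂ hn₃ hn₄
  -- Here n p = n^{3/2-s}, so A is the height that makes the H^s bound for the bump exactly ε.
  set A := ε * (n * p) with hA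
  have hpA : p * ε ≤ A := by
    rw [hA]
    nlinarith [mul_pos hε hp0]
  have hAM : 100 * M ≤ A := hn₁.trans hpA
  have hAn : 100 * (n : ℝ) ≤ A := by
    rw [hA]
    nlinarith
  have hA0 : 0 < A := by positivity
  have hb := rapid_bump hA0.le hn
  have hrb := isHermitian_bump A n
  have hw : Rapid (initialProfile (v₀ + bump A n) v₁) := (hv₀.add hb).initialProfile hv₁
  obtain ⟨W, hW0, hW⟩ := exists_global_profile (w₀ := hw.absSummable.toL1) hw
  have hW0' : (W 0 : Freq → ℂ) = initialProfile (v₀ + bump A n) v₁ := by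
    rw [hW0, AbsSummable.coe_toL1]
  have h0 : Rapid (W 0) := hW0' ▸ hw
  obtain ⟨hpos, hvel⟩ := nice_of_solution h0 hW 0
  have hposc : ∀ t, fourierCoeff (fun x => (synth (posPart t (W t)) x).re) = posPart t (W t) :=
    fun t => fourierCoeff_re_synth ((W t).absSummable.posPart t) (isHermitian_posPart t _)
  have hvelc : ∀ t, fourierCoeff (timeDeriv (fun t x => (synth (posPart t (W t)) x).re) t) =
      velPart t (W t) := fun t => by
    rw [timeDeriv_re_synth h0 hW]
    exact fourierCoeff_re_synth ((W t).absSummable.velPart t) (isHermitian_velPart t _)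
  refine ⟨fun t x => (synth (posPart t (W t)) x).re, 1 / (80 * A), 1 / (40 * A),
    isSmoothGlobalSolution_of_solution h0 hW, by positivity, ?_, ?_, ?_, fun t ht => ?_⟩
  · exact one_div_lt_one_div_of_lt (by positivity) (by linarith)
  · rw [div_lt_iff₀ (by positivity)]
    nlinarith [mul_le_mul_of_nonneg_left hpA hε.le]
  · have hd₀ : fourierCoeff ((fun x => (synth (posPart 0 (W 0)) x).re) - u₀) = bump A n := by
      ext k
      rw [fourierCoeff_sub (continuous_re_synth (hpos.rapid 0)) hu₀.2.continuous, hposc, hW0',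
        posPart_initialProfile (hr₀.add hrb) hr₁]
      exact add_sub_cancel_left _ _
    have hd₁ : fourierCoeff (timeDeriv (fun t x => (synth (posPart t (W t)) x).re) 0 - u₁) =
        0 := by
      ext k
      rw [fourierCoeff_sub ?_ hu₁.2.continuous, hvelc, hW0',
        velPart_initialProfile (hr₀.add hrb) hr₁]
      · exact sub_self _
      · rw [timeDeriv_re_synth h0 hW]
        exact continuous_re_synth (hvel.rapid 0)
    have h1 := sobolevNorm_bump_le (s := s) hs.1.le (by linarith [hs.2]) hA0.le hn hd₀
    have h2 : sobolevNorm (s - 1)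
        (timeDeriv (fun t x => (synth (posPart t (W t)) x).re) 0 - u₁) = 0 := by
      simp [sobolevNorm_eq hd₁]
    rw [pairNorm, h2, add_zero]
    refine h1.trans_eq ?_
    rw [hpow₁, hA, mul_inv_cancel_right₀ (by positivity)]
  · have h1 := norm_sum_velPart_ge hv₀ hv₁ hr₀ hr₁ (M := M) (by linarith) (by linarith)
      (by linarith) hn hAM hAn hW0' hW t ht
    have h2 := le_sobolevNorm_of_sum (s := s) hs.1.le (by linarith [hs.2]) hn (hvelc t)
      (by positivity) h1
    refine le_trans (ENNReal.ofReal_le_ofReal ?_) (h2.trans le_add_self)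
    rw [hpow₂, hA, div_le_div_iff₀ hε (by positivity)]
    -- After substituting A = εnp, the claim is p ε³ ≥ 22400 up to the positive factor n²p/200.
    have h3 := mul_le_mul_of_nonneg_left hn₄ (by positivity : 0 ≤ (n : ℝ) ^ 2 * p / 200)
    linarith

/-- An essential supremum ignores single times; the lower bound has to hold on an interval of
positive length. -/
lemma le_supNorm {s T t₁ t₂ : ℝ} {u : ℝ → Space → ℝ} {c : ℝ≥0∞} (h₁ : 0 < t₁) (h₁₂ : t₁ < t₂)
    (h₂ : t₂ ≤ T) (h : ∀ t ∈ Set.Icc t₁ t₂, c ≤ pairNorm s (u t) (timeDeriv u t)) :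
    c ≤ supNorm s T u := by
  by_contra! hlt
  have hae := ae_lt_of_essSup_lt hlt
  have hsub : Set.Icc t₁ t₂ ⊆ Set.Icc 0 T := Set.Icc_subset_Icc h₁.le h₂
  have hnull := ae_iff.1 (ae_restrict_of_ae_restrict_of_subset hsub hae)
  rw [Measure.restrict_apply' measurableSet_Icc] at hnull
  have hpos : 0 < volume (Set.Icc t₁ t₂) := by simpa using h₁₂
  have hincl : Set.Icc t₁ t₂ ⊆
      {t | ¬ pairNorm s (u t) (timeDeriv u t) < c} ∩ Set.Icc t₁ t₂ :=
    fun t ht => ⟨not_lt.2 (h t ht), ht⟩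
  exact hpos.ne' (measure_mono_null hincl hnull)

end CubicWave

end

/-! ### Choice of the sequences and of the rates -/

theorem theorem1 (s : ℝ) (hs : s ∈ Set.Ioo (0 : ℝ) (1 / 2))
    (u₀ u₁ : CubicWave.Space → ℝ)
    (hu₀ : CubicWave.IsSmoothOnTorus u₀) (hu₁ : CubicWave.IsSmoothOnTorus u₁) :
    ∃ (δ C : ℝ) (t : ℕ → ℝ) (u : ℕ → ℝ → CubicWave.Space → ℝ),
      0 < δ ∧ 0 < C ∧
      (∀ n, 0 < t n) ∧ Tendsto t atTop (𝓝 0) ∧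
      (∀ n, CubicWave.IsSmoothGlobalSolution (u n)) ∧
      (∀ n : ℕ, 2 ≤ n →
        CubicWave.pairNorm s (u n 0 - u₀) (CubicWave.timeDeriv (u n) 0 - u₁) ≤
          ENNReal.ofReal (C * Real.log n ^ (-δ))) ∧
      Tendsto (fun n => CubicWave.pairNorm s (u n 0 - u₀) (CubicWave.timeDeriv (u n) 0 - u₁))
        atTop (𝓝 0) ∧
      (∀ n : ℕ, 2 ≤ n →
        ENNReal.ofReal (C * Real.log n ^ δ) ≤
          CubicWave.pairNorm s (u n (t n)) (CubicWave.timeDeriv (u n) (t n))) ∧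
      Tendsto (fun n => CubicWave.pairNorm s (u n (t n)) (CubicWave.timeDeriv (u n) (t n)))
        atTop (𝓝 ⊤) ∧
      (∀ T : ℝ, 0 < T → Tendsto (fun n => CubicWave.supNorm s T (u n)) atTop (𝓝 ⊤)) := by
  -- With ε = 1/(n + 1) the data error is at most 1/(n + 1) and the later norm at least n + 1. As 0
  -- < log n ≤ n + 1 for n ≥ 2, the rates hold with δ = C = 1.
  have hε : ∀ n : ℕ, 0 < 1 / ((n : ℝ) + 1) := fun n => by positivity
  choose u t₁ t₂ hsol h₁ h₁₂ h₂ hsmall hlarge using fun n : ℕ =>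
    CubicWave.exists_inflating_solution hs hu₀ hu₁ (hε n)
  simp only [one_div_one_div] at hlarge
  have hε0 : Tendsto (fun n : ℕ => 1 / ((n : ℝ) + 1)) atTop (𝓝 0) :=
    tendsto_one_div_add_atTop_nhds_zero_nat
  have htop : Tendsto (fun n : ℕ => ENNReal.ofReal ((n : ℝ) + 1)) atTop (𝓝 ⊤) :=
    ENNReal.tendsto_ofReal_atTop.comp
      (tendsto_atTop_add_const_right _ _ tendsto_natCast_atTop_atTop)
  have hat : ∀ n : ℕ, ENNReal.ofReal ((n : ℝ) + 1) ≤
      CubicWave.pairNorm s (u n (t₂ n)) (CubicWave.timeDeriv (u n) (t₂ n)) :=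
    fun n => hlarge n _ ⟨(h₁₂ n).le, le_rfl⟩
  have hlog : ∀ n : ℕ, 2 ≤ n → 0 < Real.log n ∧ Real.log n ≤ n + 1 := fun n hn => by
    have hn' : (2 : ℝ) ≤ n := by exact_mod_cast hn
    have := Real.log_le_sub_one_of_pos (by linarith : (0 : ℝ) < n)
    exact ⟨Real.log_pos (by linarith), by linarith⟩
  refine ⟨1, 1, t₂, u, one_pos, one_pos, fun n => (h₁ n).trans (h₁₂ n),
    squeeze_zero (fun n => ((h₁ n).trans (h₁₂ n)).le) (fun n => (h₂ n).le) hε0, hsol,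
    fun n hn => ?_, ?_, fun n hn => ?_, ?_, fun T hT => ?_⟩
  · refine (hsmall n).trans (ENNReal.ofReal_le_ofReal ?_)
    rw [one_mul, Real.rpow_neg_one, ← one_div]
    exact one_div_le_one_div_of_le (hlog n hn).1 (hlog n hn).2
  · have h := ENNReal.tendsto_ofReal hε0
    rw [ENNReal.ofReal_zero] at h
    exact tendsto_of_tendsto_of_tendsto_of_le_of_le tendsto_const_nhds h (fun _ => zero_le)
      hsmall
  · refine le_trans (ENNReal.ofReal_le_ofReal ?_) (hat n)
    rw [one_mul, Real.rpow_one]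
    exact (hlog n hn).2
  · exact tendsto_nhds_top_mono' htop hat
  · refine tendsto_nhds_top_mono htop ?_
    filter_upwards [hε0.eventually (gt_mem_nhds hT)] with n hn
    exact CubicWave.le_supNorm (h₁ n) (h₁₂ n) ((h₂ n).trans hn).le (hlarge n)
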